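/- **Definitions.** Manifolds are smooth (that is, $C^\infty$) manifolds without boundary modelled on a real Banach space. A *Banach symmetric space* $(M,\mu)$ is such a manifold $M$ with a smooth map $\mu\colon M\times M\to M$, $\mu(x,y)=x\cdot y$, such that for all $x,y,z\in M$: (S1) $x\cdot x=x$; (S2) $x\cdot(x\cdot y)=y$; (S3) $x\cdot(y\cdot z)=(x\cdot y)\cdot(x\cdot z)$; (S4) $x$ has a neighborhood $U$ such that $y\in U$ and $x\cdot y=y$ imply $y=x$. A *pointed symmetric space* $(M,\mu,b)$ is a Banach symmetric space with a base point $b\in M$. A *morphism of pointed symmetric spaces* $(M_1,\mu_1,b_1)\to(M_2,\mu_2,b_2)$ is a smooth map $f\colon M_1\to M_2$ with $f(x\cdot y)=f(x)\cdot f(y)$ for all $x,y\in M_1$ and $f(b_1)=b_2$. The *Lie triple system* $\mathrm{Lts}(M,\mu,b)$ of a pointed symmetric space is the tangent space $T_bM$ with the triple product $$[u,v,w]:=\big[[\xi_u,\xi_v],\xi_w\big](b),\qquad u,v,w\in T_bM,$$ where for $v\in T_bM$ the smooth vector field $\xi_v$ on $M$ is given by $\xi_v(x)=\tfrac12\,T\mu\big(v,T\mu(0_b,0_x)\big)$,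 i.e. $\xi_v(x)$ is half the image of $v$ under the tangent map at $b$ of $y\mapsto y\cdot(b\cdot x)$, and the brackets on the right are Lie brackets of vector fields. A *morphism of Lie triple systems* $A\colon \mathrm{Lts}(M_1,\mu_1,b_1)\to \mathrm{Lts}(M_2,\mu_2,b_2)$ is a continuous linear map $A\colon T_{b_1}M_1\to T_{b_2}M_2$ with $A[u,v,w]=[Au,Av,Aw]$ for all $u,v,w\in T_{b_1}M_1$. For a morphism $f$ of pointed symmetric spaces, $\mathrm{Lts}(f):=T_{b_1}f$ is its tangent map at the base point. **Theorem (Integrability Theorem).** Let $(M_1,\mu_1,b_1)$ and $(M_2,\mu_2,b_2)$ be pointed Banach symmetric spaces, and let $A\colon \mathrm{Lts}(M_1,\mu_1,b_1)\to \mathrm{Lts}(M_2,\mu_2,b_2)$ be a morphism of Lie triple systems. If $M_1$ is 1-connected, i.e. connected and simply connected, then there exists a unique morphism $f\colon (M_1,\mu_1,b_1)\to(M_2,\mu_2,b_2)$ of pointed symmetric spaces with $\mathrm{Lts}(f)=A$. -/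

import Mathlib

open scoped Manifold ContDiff

/-- A Banach symmetric space structure on a smooth manifold `M` modelled on the Banach space `E`:
a smooth multiplication satisfying (S1)-(S4). -/
structure SymmetricSpace (E : Type*) [NormedAddCommGroup E] [NormedSpace ℝ E] [CompleteSpace E]
    (M : Type*) [TopologicalSpace M] [ChartedSpace E M] [IsManifold 𝓘(ℝ, E) ∞ M] where
  /-- the multiplication `mul x y = x · y`; the map `mul x` is the symmetry around `x` -/
  mul : M → M → M
  contMDiff_mul : ContMDiff (𝓘(ℝ, E).prod 𝓘(ℝ, E)) 𝓘(ℝ, E) ∞ (fun p : M × M => mul p.1 p.2)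
  mul_self : ∀ x, mul x x = x
  mul_mul_cancel : ∀ x y, mul x (mul x y) = y
  mul_distrib : ∀ x y z, mul x (mul y z) = mul (mul x y) (mul x z)
  isolated : ∀ x, ∃ U ∈ nhds x, ∀ y ∈ U, mul x y = y → y = x

namespace SymmetricSpace

variable {E : Type*} [NormedAddCommGroup E] [NormedSpace ℝ E] [CompleteSpace E]
  {M : Type*} [TopologicalSpace M] [ChartedSpace E M] [IsManifold 𝓘(ℝ, E) ∞ M]

/-- The vector field `ξ_v(x) = ½ Tμ(v, Tμ(0_b, 0_x))` for `v ∈ T_b M`: the unique derivation of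
the symmetric space that is a `(-1)`-eigenvector for the symmetry around `b` and has value `v`
at `b`. As `Tμ(0_b, 0_x)` is the zero vector at `b · x`, it is half the image of `v` under the
tangent map at `b` of `y ↦ y · (b · x)`, a map that sends `b` to `b · (b · x) = x`. (The tangent
spaces at the equal points `b · (b · x)` and `x` are identified; both are `E` by definition.) -/
noncomputable def field (S : SymmetricSpace E M) (b : M) (v : TangentSpace 𝓘(ℝ, E) b) :
    (x : M) → TangentSpace 𝓘(ℝ, E) x := fun x =>
  (1 / 2 : ℝ) •
    (mfderiv 𝓘(ℝ, E) 𝓘(ℝ, E) (fun y => S.mul y (S.mul b x)) b v : TangentSpace 𝓘(ℝ, E) x)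

/-- The triple product `[u, v, w] = [[ξ_u, ξ_v], ξ_w](b)` on `T_b M`, that is, the triple product
`[[ξ, η], ζ]` of the `(-1)`-eigenspace of the Lie algebra of derivations, transported to `T_b M`
by evaluation at `b`. The tangent space `T_b M` with this product is the Lie triple system
`Lts(M, μ, b)` of the pointed symmetric space. -/
noncomputable def triple (S : SymmetricSpace E M) (b : M) (u v w : TangentSpace 𝓘(ℝ, E) b) :
    TangentSpace 𝓘(ℝ, E) b :=
  VectorField.mlieBracket 𝓘(ℝ, E)
    (VectorField.mlieBracket 𝓘(ℝ, E) (S.field b u) (S.field b v)) (S.field b w) b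

variable {E' : Type*} [NormedAddCommGroup E'] [NormedSpace ℝ E'] [CompleteSpace E']
  {M' : Type*} [TopologicalSpace M'] [ChartedSpace E' M'] [IsManifold 𝓘(ℝ, E') ∞ M']

/-- A morphism of the pointed symmetric spaces `(M, S, b)` and `(M', S', b')`. -/
structure PointedHom (S : SymmetricSpace E M) (b : M) (S' : SymmetricSpace E' M') (b' : M') where
  toFun : M → M'
  contMDiff_toFun : ContMDiff 𝓘(ℝ, E) 𝓘(ℝ, E') ∞ toFun
  map_mul : ∀ x y, toFun (S.mul x y) = S'.mul (toFun x) (toFun y)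
  map_base : toFun b = b'

/-- `Lts(f)`: the tangent map of a morphism at the base point. (The tangent spaces at the equal
points `f b` and `b'` are identified; both are `E'` by definition.) -/
noncomputable def PointedHom.lts {S : SymmetricSpace E M} {b : M} {S' : SymmetricSpace E' M'}
    {b' : M'} (f : PointedHom S b S' b') :
    TangentSpace 𝓘(ℝ, E) b →L[ℝ] TangentSpace 𝓘(ℝ, E') b' :=
  mfderiv 𝓘(ℝ, E) 𝓘(ℝ, E') f.toFun b

/-- A continuous linear map `Lts(M, S, b) → Lts(M', S', b')` is a morphism of Lie triple systems
if it respects the triple products. -/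
def IsLtsHom (S : SymmetricSpace E M) (b : M) (S' : SymmetricSpace E' M') (b' : M')
    (A : TangentSpace 𝓘(ℝ, E) b →L[ℝ] TangentSpace 𝓘(ℝ, E') b') : Prop :=
  ∀ u v w, A (S.triple b u v w) = S'.triple b' (A u) (A v) (A w)

end SymmetricSpace

/-! The exponential map at a point b is built without differential equations. By (S4) the symmetry
at b has derivative -1, and differentiating x·x = x then shows that the doubling y ↦ y·b has
derivative 2 at b. Koenigs linearization conjugates doubling to v ↦ 2v, and the conjugation extends
to the whole tangent space as `exp`. It is rigid (`eq_exp_of_two_smul`): a map that commutes with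
doubling and is differentiable at 0 is `exp` composed with its derivative. Rigidity makes the
translations `tr b (t • x)` a one-parameter group in t.

Pulled back to b by these translations, the Jacobi fields along exp(tx) become operators C(t) =
`coshOp` and S(t) = `sinhOp`. An identity between symmetries gives C(t+s) + C(t-s) = 2 C(t) C(s),
and S' = C; hence C'' = C ∘ Q with Q = C''(0). Since C(t)v is the pulled back value of ξ_v, one
finds Q v = [ξ_x, [ξ_x, ξ_v]](b) = -[x, v, x]. A morphism A of Lie triple systems therefore
intertwines the operators Q of x and Ax, and by uniqueness for the linear equation it intertwines
the operators C (`IsLtsHom.compat`), hence also S.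

For any linear map T with this property (`Compat`), the map exp' ∘ T ∘ log on a normal neighbourhood
carries ξ_v to ξ_{Tv}, so it commutes with translations, so it has the same form in normal
coordinates around every point of that neighbourhood, with T transported along
(`Compat.adm_normalMap`). The compatible triples (x, y, T), topologized by these local maps, form a
covering of M₁ (`Jet.isCoveringMap_pt`), and 1-connectedness yields a global section through (b₁,
b₂, A), whose values define f.

Two such maps with the same 1-jet at one point of a connected space coincide. This gives uniqueness,
and also multiplicativity: y ↦ f(x·y) and y ↦ f(x)·f(y) have the same 1-jet at y = x. As `exp` is
only shown to be C¹, smoothness of f comes from a bootstrap on its derivative in the frames ξ_v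
(`Adm.contMDiffAt`). -/

open Filter Topology

/-! ### Linearization at fixed points and d'Alembert's functional equation. -/

section Analysis

variable {E : Type*} [NormedAddCommGroup E] [NormedSpace ℝ E] [CompleteSpace E]

/-- Koenigs linearization: a local map with derivative `1/2` at a fixed point is conjugate to
its derivative by a continuously differentiable map. -/
theorem exists_linearization_half {ρ : E → E} (hρ : ContDiffAt ℝ 2 ρ 0) (h0 : ρ 0 = 0)
    (hd : HasFDerivAt ρ ((1 / 2 : ℝ) • ContinuousLinearMap.id ℝ E) 0) :
    ∃ l : E → E, ContDiffAt ℝ 1 l 0 ∧ l 0 = 0 ∧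
      HasFDerivAt l (ContinuousLinearMap.id ℝ E) 0 ∧
      ∀ᶠ x in 𝓝 0, l (ρ x) = (1 / 2 : ℝ) • l x := by
  have hD : ContDiffAt ℝ 1 (fderiv ℝ ρ) 0 := hρ.fderiv_right (by norm_num)
  have hD0 : fderiv ℝ ρ 0 = (1 / 2 : ℝ) • ContinuousLinearMap.id ℝ E := hd.fderiv
  obtain ⟨K, u, hu, hK⟩ := hD.exists_lipschitzOnWith
  have hdiff : ∀ᶠ x in 𝓝 (0 : E), ContDiffAt ℝ 2 ρ x := hρ.eventually (by simp)
  -- Any bound strictly between 1/2 and 1/√2 would do: the series of derivatives below converges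
  -- because 2 · 0.6² = 0.72 < 1.
  have hsmall : ∀ᶠ x in 𝓝 (0 : E), ‖fderiv ℝ ρ x‖ < 0.6 := by
    have : ContinuousAt (fun x => ‖fderiv ℝ ρ x‖) 0 := hD.continuousAt.norm
    refine this.eventually_lt continuousAt_const ?_
    rw [hD0]
    calc _ ≤ ‖(1 / 2 : ℝ)‖ * ‖ContinuousLinearMap.id ℝ E‖ := norm_smul_le _ _
      _ ≤ ‖(1 / 2 : ℝ)‖ * 1 := by gcongr; exact ContinuousLinearMap.norm_id_le
      _ < _ := by norm_num
  obtain ⟨r, hr, hball⟩ := Metric.eventually_nhds_iff_ball.1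
    (hdiff.and (hsmall.and (eventually_mem_set.2 hu)))
  set B := Metric.ball (0 : E) r with hB
  have h0B : (0 : E) ∈ B := Metric.mem_ball_self hr
  have hder : ∀ x ∈ B, HasFDerivAt ρ (fderiv ℝ ρ x) x := fun x hx =>
    ((hball x hx).1.differentiableAt (by norm_num)).hasFDerivAt
  have hn6 : ∀ x ∈ B, ‖fderiv ℝ ρ x‖ ≤ 0.6 := fun x hx => (hball x hx).2.1.le
  have hcont : ContinuousOn (fderiv ℝ ρ) B := fun x hx =>
    (((hball x hx).1.fderiv_right (m := 1) (by norm_num)).continuousAt).continuousWithinAt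
  have hlip : ∀ x ∈ B, ‖(2 : ℝ) • fderiv ℝ ρ x - ContinuousLinearMap.id ℝ E‖ ≤ 2 * K * ‖x‖ := by
    intro x hx
    have := hK.norm_sub_le (hball x hx).2.2 (mem_of_mem_nhds hu)
    have h2 : (2 : ℝ) • fderiv ℝ ρ x - ContinuousLinearMap.id ℝ E
        = (2 : ℝ) • (fderiv ℝ ρ x - fderiv ℝ ρ 0) := by
      rw [hD0, smul_sub, smul_smul]; norm_num
    rw [h2, norm_smul]
    rw [sub_zero] at this
    norm_num
    nlinarith
  have hcontr : ∀ x ∈ B, ‖ρ x‖ ≤ 0.6 * ‖x‖ := by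
    intro x hx
    have := (convex_ball (0 : E) r).norm_image_sub_le_of_norm_hasFDerivWithin_le
      (fun y hy => (hder y hy).hasFDerivWithinAt) hn6 h0B hx
    simpa [h0] using this
  let D : ℕ → E → E →L[ℝ] E := fun n => Nat.rec (fun _ => ContinuousLinearMap.id ℝ E)
    (fun k Dk x => (fderiv ℝ ρ (ρ^[k] x)).comp (Dk x)) n
  have hDs : ∀ n x, D (n + 1) x = (fderiv ℝ ρ (ρ^[n] x)).comp (D n x) := fun _ _ => rfl
  have hit : ∀ n, ∀ x ∈ B, ρ^[n] x ∈ B ∧ ‖ρ^[n] x‖ ≤ 0.6 ^ n * ‖x‖ := by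
    intro n x hx
    induction n with
    | zero => simpa using hx
    | succ n ih =>
      rw [Function.iterate_succ_apply']
      have h1 := hcontr _ ih.1
      have h2 : ‖ρ (ρ^[n] x)‖ ≤ 0.6 ^ (n + 1) * ‖x‖ := by
        rw [pow_succ]; nlinarith [ih.2]
      refine ⟨?_, h2⟩
      have h3 := ih.1
      rw [hB, mem_ball_zero_iff] at h3 ⊢
      nlinarith [norm_nonneg (ρ^[n] x)]
  have hDder : ∀ n, ∀ x ∈ B, HasFDerivAt (ρ^[n]) (D n x) x := by
    intro n x hx
    induction n with
    | zero => exact hasFDerivAt_id x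
    | succ n ih =>
      rw [Function.iterate_succ', hDs]
      exact (hder _ (hit n x hx).1).comp x ih
  have hDn : ∀ n, ∀ x ∈ B, ‖D n x‖ ≤ 0.6 ^ n := by
    intro n x hx
    induction n with
    | zero =>
      rw [pow_zero]
      exact ContinuousLinearMap.norm_id_le
    | succ n ih =>
      rw [hDs, pow_succ, mul_comm]
      exact (ContinuousLinearMap.opNorm_comp_le _ _).trans
        (mul_le_mul (hn6 _ (hit n x hx).1) ih (norm_nonneg _) (by norm_num))
  have hDc : ∀ n, ContinuousOn (D n) B := by
    intro n
    induction n with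
    | zero => exact continuousOn_const
    | succ n ih =>
      have : ContinuousOn (fun x => fderiv ℝ ρ (ρ^[n] x)) B :=
        hcont.comp (fun x hx => (hDder n x hx).continuousAt.continuousWithinAt)
          (fun x hx => (hit n x hx).1)
      exact this.clm_comp ih
  -- The sums x + f 0 x + … + f (n-1) x telescope to 2^n ρ^n(x), so the series is the Koenigs limit.
  -- In `f' n`, one factor 0.6^n comes from the derivative of ρ^n, the other from 2ρ' - 1 being
  -- Lipschitz and zero at 0.
  let f : ℕ → E → E := fun n x => (2 : ℝ) ^ n • ((2 : ℝ) • ρ (ρ^[n] x) - ρ^[n] x)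
  let f' : ℕ → E → E →L[ℝ] E := fun n x => (2 : ℝ) ^ n •
    (((2 : ℝ) • fderiv ℝ ρ (ρ^[n] x) - ContinuousLinearMap.id ℝ E).comp (D n x))
  have hf : ∀ n x, x ∈ B → HasFDerivAt (f n) (f' n x) x := by
    intro n x hx
    have h1 : HasFDerivAt (fun y => (2 : ℝ) • ρ y - y)
        ((2 : ℝ) • fderiv ℝ ρ (ρ^[n] x) - ContinuousLinearMap.id ℝ E) (ρ^[n] x) :=
      ((hder _ (hit n x hx).1).const_smul (2 : ℝ)).sub (hasFDerivAt_id _)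
    exact (h1.comp x (hDder n x hx)).const_smul ((2 : ℝ) ^ n)
  have hf' : ∀ n x, x ∈ B → ‖f' n x‖ ≤ (2 * K * r) * 0.72 ^ n := by
    intro n x hx
    have h1 := hlip _ (hit n x hx).1
    have h2 := (hit n x hx).2
    have h3 : ‖x‖ ≤ r := (mem_ball_zero_iff.1 hx).le
    have h4 : ‖(2 : ℝ) • fderiv ℝ ρ (ρ^[n] x) - ContinuousLinearMap.id ℝ E‖
        ≤ 2 * K * (0.6 ^ n * r) := h1.trans (by gcongr; exact h2.trans (by gcongr))
    calc ‖f' n x‖ ≤ ‖(2 : ℝ) ^ n‖ * (2 * K * (0.6 ^ n * r) * 0.6 ^ n) := by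
          refine (norm_smul_le ((2 : ℝ) ^ n) (ContinuousLinearMap.comp _ (D n x))).trans ?_
          gcongr
          exact (ContinuousLinearMap.opNorm_comp_le _ _).trans
            (mul_le_mul h4 (hDn n x hx) (norm_nonneg _) (by positivity))
      _ = (2 * K * r) * (2 * 0.6 * 0.6) ^ n := by
          rw [norm_pow, mul_pow, mul_pow, Real.norm_ofNat]; ring
      _ = _ := by norm_num
  have hu' : Summable (fun n : ℕ => (2 * K * r) * (0.72 : ℝ) ^ n) :=
    (summable_geometric_of_lt_one (by norm_num) (by norm_num)).mul_left _
  have hit0 : ∀ n, ρ^[n] 0 = 0 := fun n => Function.iterate_fixed h0 n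
  have hf0 : ∀ n, f n 0 = 0 := fun n => by simp [f, hit0, h0]
  have hf0s : Summable (fun n => f n 0) := by simp [hf0]
  have hpre : IsPreconnected B := (convex_ball (0 : E) r).isPreconnected
  have hsum : ∀ x ∈ B, Summable (fun n => f n x) := fun x hx =>
    summable_of_summable_hasFDerivAt_of_isPreconnected hu' Metric.isOpen_ball hpre hf hf' h0B
      hf0s hx
  have hl : ∀ x ∈ B, HasFDerivAt (fun x => x + ∑' n, f n x)
      (ContinuousLinearMap.id ℝ E + ∑' n, f' n x) x := fun x hx =>
    (hasFDerivAt_id x).add (hasFDerivAt_tsum_of_isPreconnected hu' Metric.isOpen_ball hpre hf hf'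
      h0B hf0s hx)
  have hBn : B ∈ 𝓝 (0 : E) := Metric.ball_mem_nhds _ hr
  refine ⟨fun x => x + ∑' n, f n x, ?_, by simp [hf0], ?_, ?_⟩
  · refine contDiffAt_one_iff.2 ⟨_, B, hBn, ?_, hl⟩
    refine continuousOn_const.add (continuousOn_tsum (fun n => ?_) hu' hf')
    have h1 : ContinuousOn (fun x => fderiv ℝ ρ (ρ^[n] x)) B :=
      hcont.comp (fun x hx => (hDder n x hx).continuousAt.continuousWithinAt)
        (fun x hx => (hit n x hx).1)
    have h2 : ContinuousOn (fun x => (2 : ℝ) • fderiv ℝ ρ (ρ^[n] x) - ContinuousLinearMap.id ℝ E) B :=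
      (h1.const_smul (2 : ℝ)).sub continuousOn_const
    exact (h2.clm_comp (hDc n)).const_smul ((2 : ℝ) ^ n)
  · have h1 : ∀ n, f' n 0 = 0 := fun n => by
      have : (2 : ℝ) • fderiv ℝ ρ 0 - ContinuousLinearMap.id ℝ E = 0 := by
        rw [hD0, smul_smul]; norm_num
      simp only [f', hit0]
      rw [this]; simp
    simpa [h1] using hl 0 h0B
  · filter_upwards [hBn] with x hx
    have hs := hsum x hx
    -- Shifting the series by one term is the functional equation l ∘ ρ = l/2.
    have h1 : ∀ n, f (n + 1) x = (2 : ℝ) • f n (ρ x) := fun n => by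
      simp only [f, Function.iterate_succ_apply, pow_succ', mul_smul]
    have h2 : ∑' n, f n x = ((2 : ℝ) • ρ x - x) + (2 : ℝ) • ∑' n, f n (ρ x) := by
      rw [hs.tsum_eq_zero_add]
      simp only [h1]
      rw [Summable.tsum_const_smul]
      · simp [f]
      · exact hsum _ (hit 1 x hx).1
    rw [h2]
    module

end Analysis

section Analysis

variable {E : Type*} [NormedAddCommGroup E] [NormedSpace ℝ E] [CompleteSpace E]

theorem ContDiffAt.exists_local_inverse {F : Type*} [NormedAddCommGroup F] [NormedSpace ℝ F]
    {f : E → F} {a : E} {f' : E ≃L[ℝ] F} {n : ℕ∞ω}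
    (hf : ContDiffAt ℝ n f a) (hf' : HasFDerivAt f (f' : E →L[ℝ] F) a) (hn : n ≠ 0) :
    ∃ g : F → E, ContDiffAt ℝ n g (f a) ∧ g (f a) = a ∧
      HasFDerivAt g (f'.symm : F →L[ℝ] E) (f a) ∧
      (∀ᶠ x in 𝓝 a, g (f x) = x) ∧ ∀ᶠ y in 𝓝 (f a), f (g y) = y := by
  have h := hf.hasStrictFDerivAt' hf' hn
  exact ⟨h.localInverse f f' a, hf.to_localInverse hf' hn, h.localInverse_apply_image,
    h.to_localInverse.hasFDerivAt, h.eventually_left_inverse, h.eventually_right_inverse⟩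

/-- A local diffeomorphism of derivative `2` at a fixed point is conjugate to its derivative. -/
theorem exists_linearization_two {δ : E → E} (hδ : ContDiffAt ℝ 2 δ 0) (h0 : δ 0 = 0)
    (hd : HasFDerivAt δ ((2 : ℝ) • ContinuousLinearMap.id ℝ E) 0) :
    ∃ ε l : E → E, ContDiffAt ℝ 1 ε 0 ∧ ε 0 = 0 ∧
      HasFDerivAt ε (ContinuousLinearMap.id ℝ E) 0 ∧ ContDiffAt ℝ 1 l 0 ∧ l 0 = 0 ∧
      HasFDerivAt l (ContinuousLinearMap.id ℝ E) 0 ∧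
      (∀ᶠ v in 𝓝 0, l (ε v) = v) ∧ (∀ᶠ u in 𝓝 0, ε (l u) = u) ∧
      (∀ᶠ v in 𝓝 0, ε ((2 : ℝ) • v) = δ (ε v)) ∧
      ∀ᶠ u in 𝓝 0, l (δ u) = (2 : ℝ) • l u := by
  let two : E ≃L[ℝ] E := ContinuousLinearEquiv.smulLeft (Units.mk0 (2 : ℝ) two_ne_zero)
  have htwo : (two : E →L[ℝ] E) = (2 : ℝ) • ContinuousLinearMap.id ℝ E := by
    ext v; rfl
  have hsymm : (two.symm : E →L[ℝ] E) = (1 / 2 : ℝ) • ContinuousLinearMap.id ℝ E := by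
    ext v
    apply two.injective
    have h1 : two (two.symm v) = v := two.apply_symm_apply v
    have h2 : two ((1 / 2 : ℝ) • v) = v := by
      change (2 : ℝ) • ((1 / 2 : ℝ) • v) = v
      rw [smul_smul]; norm_num
    exact h1.trans h2.symm
  rw [← htwo] at hd
  -- The Koenigs series needs a contraction, so it is applied to the local inverse of δ.
  obtain ⟨ρ, hρ, hρ0, hρd, hρl, hρr⟩ := hδ.exists_local_inverse hd (by norm_num)
  rw [h0] at hρ hρ0 hρd hρr
  rw [hsymm] at hρd
  obtain ⟨l, hl, hl0, hld, hlρ⟩ := exists_linearization_half hρ hρ0 hρd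
  have hld' : HasFDerivAt l ((ContinuousLinearEquiv.refl ℝ E : E ≃L[ℝ] E) : E →L[ℝ] E) 0 := hld
  obtain ⟨ε, hε, hε0, hεd, hεl, hεr⟩ := hl.exists_local_inverse hld' one_ne_zero
  rw [hl0] at hε hε0 hεd hεr
  have hδc : Tendsto δ (𝓝 0) (𝓝 0) := by simpa [h0] using hδ.continuousAt.tendsto
  have hεc : Tendsto ε (𝓝 0) (𝓝 0) := by simpa [hε0] using hε.continuousAt.tendsto
  have hlδ : ∀ᶠ u in 𝓝 0, l (δ u) = (2 : ℝ) • l u := by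
    filter_upwards [hδc.eventually hlρ, hρl] with u h1 h2
    rw [h2] at h1
    rw [h1, smul_smul]; norm_num
  refine ⟨ε, l, hε, hε0, hεd, hl, hl0, hld, hεr, hεl, ?_, hlδ⟩
  filter_upwards [hεc.eventually hlδ, hεr, (hδc.comp hεc).eventually hεl] with v h1 h2 h3
  rw [h2] at h1
  rw [← h1]
  exact h3

/-- The derivative of a local involution at an isolated fixed point is `-1`. -/
theorem hasFDerivAt_neg_id_of_involution {σ : E → E} {p : E} {L : E →L[ℝ] E}
    (hσ : ContDiffAt ℝ 1 σ p) (hp : σ p = p) (hL : HasFDerivAt σ L p)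
    (hinv : ∀ᶠ y in 𝓝 p, σ (σ y) = y) (hiso : ∀ᶠ y in 𝓝 p, σ y = y → y = p) :
    L = -ContinuousLinearMap.id ℝ E := by
  have hLL : L.comp L = ContinuousLinearMap.id ℝ E := by
    have h1 : HasFDerivAt (fun y => σ (σ y)) (L.comp L) p :=
      HasFDerivAt.comp p (by rwa [hp]) hL
    have h2 : HasFDerivAt (fun y => σ (σ y)) (ContinuousLinearMap.id ℝ E) p :=
      (hasFDerivAt_id p).congr_of_eventuallyEq hinv
    exact h1.unique h2
  have hLLv : ∀ v, L (L v) = v := fun v => by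
    simpa using congrArg (fun A : E →L[ℝ] E => A v) hLL
  -- Averaging over the group {1, σ} gives a chart k in which σ becomes its linear part: k ∘ σ = L ∘
  -- k, with derivative 1 at p because L² = 1.
  let k : E → E := fun y => (1 / 2 : ℝ) • ((y - p) + L (σ y - p))
  have hk : ContDiffAt ℝ 1 k p := by
    have : ContDiffAt ℝ 1 (fun y => L (σ y - p)) p :=
      L.contDiff.contDiffAt.comp p (hσ.sub contDiffAt_const)
    exact ((contDiffAt_id.sub contDiffAt_const).add this).const_smul (1 / 2 : ℝ)
  have hkp : k p = 0 := by simp [k, hp]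
  have hkd : HasFDerivAt k ((ContinuousLinearEquiv.refl ℝ E : E ≃L[ℝ] E) : E →L[ℝ] E) p := by
    have h1 : HasFDerivAt k
        ((1 / 2 : ℝ) • (ContinuousLinearMap.id ℝ E + L.comp L)) p :=
      (((hasFDerivAt_id p).sub_const p).add
        (L.hasFDerivAt.comp p (hL.sub_const p))).const_smul (1 / 2 : ℝ)
    convert h1 using 1
    rw [hLL]
    ext v
    change v = (1 / 2 : ℝ) • (v + v)
    module
  have hkσ : ∀ᶠ y in 𝓝 p, k (σ y) = L (k y) := by
    filter_upwards [hinv] with y hy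
    simp only [k, hy, map_smul, map_add, hLLv]
    rw [add_comm]
  obtain ⟨g, hg, hg0, -, hgk, hkg⟩ := hk.exists_local_inverse hkd one_ne_zero
  rw [hkp] at hg hg0 hkg
  have hσc : Tendsto σ (𝓝 p) (𝓝 p) := by simpa [hp] using hσ.continuousAt.tendsto
  have hgc : Tendsto g (𝓝 0) (𝓝 p) := by simpa [hg0] using hg.continuousAt.tendsto
  -- A fixed vector u of L would give fixed points g(tu) of σ arbitrarily close to p. Applied to v +
  -- L v, which L fixes, this forces L = -1.
  have hfix : ∀ u, L u = u → u = 0 := by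
    intro u hu
    have ht : Tendsto (fun t : ℝ => t • u) (𝓝[≠] 0) (𝓝 0) := by
      have : Tendsto (fun t : ℝ => t • u) (𝓝 0) (𝓝 ((0 : ℝ) • u)) :=
        (continuous_id.smul continuous_const).tendsto 0
      rw [zero_smul] at this
      exact this.mono_left nhdsWithin_le_nhds
    have hall := (hgc.comp ht).eventually
      (hkσ.and (hgk.and ((hσc.eventually hgk).and hiso)))
    obtain ⟨t, ⟨⟨h1, h2, h3, h4⟩, h5⟩, h6⟩ :=
      ((hall.and (ht.eventually hkg)).and eventually_mem_nhdsWithin).exists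
    simp only [Function.comp_apply] at h1 h2 h3 h4
    have h7 : σ (g (t • u)) = g (t • u) := by
      rw [← h3, h1, h5, map_smul, hu]
    have h8 := h4 h7
    rw [h8, hkp] at h5
    exact (smul_eq_zero.1 h5.symm).resolve_left h6
  ext v
  have := hfix (v + L v) (by rw [map_add, hLLv, add_comm])
  simpa using (eq_neg_of_add_eq_zero_right this)

/-- Solutions of d'Alembert's functional equation with a differentiable primitive are solutions
of a linear second order differential equation. -/
theorem exists_second_derivative_of_dAlembert {A : Type*} [NormedRing A] [NormedAlgebra ℝ A]
    [CompleteSpace A] {C S : ℝ → A} (hC0 : C 0 = 1) (hS0 : S 0 = 0)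
    (hS : ∀ t, HasDerivAt S (C t) t)
    (hC : ∀ t s, C (t + s) + C (t - s) = (2 : ℝ) • (C t * C s)) :
    ∃ (C' : ℝ → A) (Q : A), (∀ t, HasDerivAt C (C' t) t) ∧ C' 0 = 0 ∧
      ∀ t, HasDerivAt C' (C t * Q) t := by
  have hadd : ∀ {F : ℝ → A} {F' : ℝ → A}, (∀ t, HasDerivAt F (F' t) t) → ∀ a t,
      HasDerivAt (fun s => F (a + s)) (F' (a + t)) t := fun h a t =>
    HasDerivAt.comp_const_add a t (h (a + t))
  have hsub : ∀ {F : ℝ → A} {F' : ℝ → A}, (∀ t, HasDerivAt F (F' t) t) → ∀ a t,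
      HasDerivAt (fun s => F (a - s)) (-F' (a - t)) t := fun h a t =>
    HasDerivAt.comp_const_sub a t (h (a - t))
  have hev : ∀ s, C (-s) = C s := fun s => by
    have h := hC 0 s
    rw [hC0, one_mul, zero_add, zero_sub, two_smul] at h
    exact add_left_cancel h
  have hodd : ∀ s, S s + S (-s) = 0 := by
    intro s
    have hd : ∀ t, HasDerivAt (fun t => S t + S (-t)) 0 t := fun t => by
      have h2 : HasDerivAt (fun t => S (-t)) (-C t) t := by simpa [hev] using hsub hS 0 t
      have := (hS t).add h2
      rw [add_neg_cancel] at this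
      exact this
    have := is_const_of_deriv_eq_zero (fun t => (hd t).differentiableAt) (fun t => (hd t).deriv) s 0
    simpa [hS0] using this
  -- This is d'Alembert's equation integrated in t; the constant vanishes since S is odd.
  have hSC : ∀ t s, S (t + s) + S (t - s) = (2 : ℝ) • (S t * C s) := by
    intro t s
    have hd : ∀ t, HasDerivAt (fun t => S (t + s) + S (t - s) - (2 : ℝ) • (S t * C s)) 0 t := by
      intro t
      have h1 : HasDerivAt (fun t => S (t + s)) (C (t + s)) t := (hS _).comp_add_const t s
      have h2 : HasDerivAt (fun t => S (t - s)) (C (t - s)) t := (hS _).comp_sub_const t s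
      have h3 := (((hS t).mul_const (C s)).const_smul (2 : ℝ))
      have := (h1.add h2).sub h3
      rw [hC, sub_self] at this
      exact this
    have := is_const_of_deriv_eq_zero (fun t => (hd t).differentiableAt) (fun t => (hd t).deriv) t 0
    simp only [zero_add, zero_sub, hS0, zero_mul, smul_zero, sub_zero, hodd] at this
    exact sub_eq_zero.1 this
  -- S(h)/h tends to 1, so S(h) is invertible for some small h. Solving the integrated equation at t
  -- = h for C(s) expresses C through S and so gains one derivative; repeating this gives the
  -- second.
  obtain ⟨h, U, hU⟩ : ∃ (h : ℝ) (U : A), U * S h = 1 := by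
    have h1 : Tendsto (slope S 0) (𝓝[≠] 0) (𝓝 1) := by
      rw [← hC0]; exact hasDerivAt_iff_tendsto_slope.1 (hS 0)
    have h2 : ∀ᶠ a in 𝓝 (1 : A), IsUnit a := Units.nhds (1 : Aˣ)
    obtain ⟨h, ⟨u, hu⟩⟩ := (h1.eventually h2).exists
    refine ⟨h, h⁻¹ • (↑u⁻¹ : A), ?_⟩
    have h3 : (u : A) = h⁻¹ • S h := by rw [hu, slope_def_module]; simp [hS0]
    rw [smul_mul_assoc, ← mul_smul_comm, ← h3, Units.inv_mul]
  have hCU : ∀ s, C s = (1 / 2 : ℝ) • (U * (S (h + s) + S (h - s))) := fun s => by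
    rw [hSC, mul_smul_comm, ← mul_assoc, hU, one_mul, smul_smul]; norm_num
  let C1 : ℝ → A := fun s => (1 / 2 : ℝ) • (U * (C (h + s) - C (h - s)))
  have hC1 : ∀ t, HasDerivAt C (C1 t) t := fun t => by
    have := (((hadd hS h t).add (hsub hS h t)).const_mul U).const_smul (1 / 2 : ℝ)
    rw [← sub_eq_add_neg] at this
    exact this.congr_of_eventuallyEq (Eventually.of_forall fun s => hCU s)
  let C2 : ℝ → A := fun s => (1 / 2 : ℝ) • (U * (C1 (h + s) + C1 (h - s)))
  have hC2 : ∀ t, HasDerivAt C1 (C2 t) t := fun t => by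
    have := (((hadd hC1 h t).sub (hsub hC1 h t)).const_mul U).const_smul (1 / 2 : ℝ)
    rw [sub_neg_eq_add] at this
    exact this
  have hd1 : ∀ t s, C1 (t + s) - C1 (t - s) = (2 : ℝ) • (C t * C1 s) := fun t s => by
    have h1 := (hadd hC1 t s).add (hsub hC1 t s)
    have h2 := ((hC1 s).const_mul (C t)).const_smul (2 : ℝ)
    rw [← sub_eq_add_neg] at h1
    exact h1.unique (h2.congr_of_eventuallyEq (Eventually.of_forall fun s => hC t s))
  have hd2 : ∀ t s, C2 (t + s) + C2 (t - s) = (2 : ℝ) • (C t * C2 s) := fun t s => by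
    have h1 := (hadd hC2 t s).sub (hsub hC2 t s)
    have h2 := ((hC2 s).const_mul (C t)).const_smul (2 : ℝ)
    rw [sub_neg_eq_add] at h1
    exact h1.unique (h2.congr_of_eventuallyEq (Eventually.of_forall fun s => hd1 t s))
  refine ⟨C1, C2 0, hC1, by simp [C1], fun t => ?_⟩
  -- Two differentiations of d'Alembert's equation in s, at s = 0, give 2C''(t) = 2C(t)C''(0).
  have h1 := hd2 t 0
  rw [add_zero, sub_zero, ← two_smul ℝ] at h1
  rw [← smul_right_injective A (two_ne_zero (α := ℝ)) h1]
  exact hC2 t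

end Analysis

/-- Uniqueness for the linear differential equation `w'' = w ∘ Q`. -/
theorem eq_zero_of_second_derivative_eq_comp {E E' : Type*} [NormedAddCommGroup E]
    [NormedSpace ℝ E] [NormedAddCommGroup E'] [NormedSpace ℝ E'] {Q : E →L[ℝ] E}
    {w w' : ℝ → E →L[ℝ] E'}
    (hw : ∀ t, HasDerivAt w (w' t) t) (hw' : ∀ t, HasDerivAt w' ((w t).comp Q) t)
    (h0 : w 0 = 0) (h0' : w' 0 = 0) (t : ℝ) : w t = 0 := by
  let Φ : ((E →L[ℝ] E') × (E →L[ℝ] E')) →L[ℝ] ((E →L[ℝ] E') × (E →L[ℝ] E')) :=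
    (ContinuousLinearMap.snd ℝ _ _).prod
      (((ContinuousLinearMap.compL ℝ E E E').flip Q).comp (ContinuousLinearMap.fst ℝ _ _))
  have := ODE_solution_unique_univ (v := fun _ => Φ) (K := ‖Φ‖₊) (s := fun _ => Set.univ)
    (f := fun t => (w t, w' t)) (g := fun _ => 0) (t₀ := 0)
    (fun _ => Φ.lipschitz.lipschitzOnWith) (fun t => ⟨(hw t).prodMk (hw' t), trivial⟩)
    (fun t => ⟨by simpa using hasDerivAt_const t (0 : (E →L[ℝ] E') × (E →L[ℝ] E')), trivial⟩)
    (by simp [h0, h0'])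
  exact congrArg Prod.fst (congrFun this t)

/-! ### Tangent maps as operators between the model spaces. -/

section Derivative

variable {E : Type*} [NormedAddCommGroup E] [NormedSpace ℝ E]
  {M : Type*} [TopologicalSpace M] [ChartedSpace E M]
  {E' : Type*} [NormedAddCommGroup E'] [NormedSpace ℝ E']
  {M' : Type*} [TopologicalSpace M'] [ChartedSpace E' M']
  {E'' : Type*} [NormedAddCommGroup E''] [NormedSpace ℝ E'']
  {M'' : Type*} [TopologicalSpace M''] [ChartedSpace E'' M'']
  {F : Type*} [NormedAddCommGroup F] [NormedSpace ℝ F]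
  {N : Type*} [TopologicalSpace N] [ChartedSpace F N]

/-- `HasT f x L`: the tangent map of `f` at `x` is `L`, where the tangent spaces are identified
with the model spaces. -/
def HasT (f : M → M') (x : M) (L : E →L[ℝ] E') : Prop :=
  HasMFDerivAt 𝓘(ℝ, E) 𝓘(ℝ, E') f x L

/-- The tangent map of `f` at `x`, where the tangent spaces are identified with the model
spaces. -/
noncomputable def tder (f : M → M') (x : M) : E →L[ℝ] E' :=
  mfderiv 𝓘(ℝ, E) 𝓘(ℝ, E') f x

namespace HasT

theorem unique {f : M → M'} {x : M} {L L' : E →L[ℝ] E'} (h : HasT f x L) (h' : HasT f x L') :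
    L = L' :=
  hasMFDerivAt_unique h h'

theorem continuousAt {f : M → M'} {x : M} {L : E →L[ℝ] E'} (h : HasT f x L) :
    ContinuousAt f x :=
  h.1

theorem comp {g : M' → M''} {f : M → M'} {x : M} {y : M'} {K : E' →L[ℝ] E''} {L : E →L[ℝ] E'}
    (hg : HasT g y K) (hf : HasT f x L) (hy : f x = y) : HasT (fun z => g (f z)) x (K.comp L) := by
  subst hy
  exact HasMFDerivAt.comp x hg hf

theorem congr {f g : M → M'} {x : M} {L : E →L[ℝ] E'} (h : HasT f x L) (hg : g =ᶠ[𝓝 x] f) :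
    HasT g x L :=
  HasMFDerivAt.congr_of_eventuallyEq h hg

theorem id (x : M) : HasT (fun z : M => z) x (ContinuousLinearMap.id ℝ E) :=
  hasMFDerivAt_id x

theorem const (x : M) (y : M') : HasT (fun _ : M => y) x (0 : E →L[ℝ] E') :=
  hasMFDerivAt_const y x

theorem of_mdifferentiableAt {f : M → M'} {x : M}
    (h : MDifferentiableAt 𝓘(ℝ, E) 𝓘(ℝ, E') f x) :
    HasT f x (tder f x : E →L[ℝ] E') :=
  h.hasMFDerivAt

theorem tder_eq {f : M → M'} {x : M} {L : E →L[ℝ] E'} (h : HasT f x L) : tder f x = L :=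
  HasMFDerivAt.mfderiv h

/-- The derivative in the charts around the point and its image. -/
theorem _root_.hasT_iff_chart {f : M → M'} {x : M} {L : E →L[ℝ] E'} :
    HasT f x L ↔ ContinuousAt f x ∧ HasFDerivAt
      (fun u => extChartAt 𝓘(ℝ, E') (f x) (f ((extChartAt 𝓘(ℝ, E) x).symm u))) L
      (extChartAt 𝓘(ℝ, E) x x) := by
  unfold HasT HasMFDerivAt
  rw [ModelWithCorners.range_eq_univ]
  exact and_congr_right fun _ => hasFDerivWithinAt_univ

theorem _root_.hasT_iff_hasFDerivAt {f : E → E'} {x : E} {L : E →L[ℝ] E'} :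
    HasT f x L ↔ HasFDerivAt f L x := by
  rw [hasT_iff_chart]
  exact ⟨fun h => h.2, fun h => ⟨h.continuousAt, h⟩⟩

/-- The chain rule for a function of two variables. -/
theorem comp₂ {G : M × M' → M''} {a : M} {b : M'} {f : N → M} {g : N → M'} {n : N}
    {K : E →L[ℝ] E''} {K' : E' →L[ℝ] E''} {L : F →L[ℝ] E} {L' : F →L[ℝ] E'}
    (hG : MDifferentiableAt (𝓘(ℝ, E).prod 𝓘(ℝ, E')) 𝓘(ℝ, E'') G (a, b))
    (hK : HasT (fun y => G (y, b)) a K) (hK' : HasT (fun y => G (a, y)) b K')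
    (hf : HasT f n L) (hg : HasT g n L') (ha : f n = a) (hb : g n = b) :
    HasT (fun z => G (f z, g z)) n (K.comp L + K'.comp L') := by
  subst ha hb
  let D : E × E' →L[ℝ] E'' := mfderiv (𝓘(ℝ, E).prod 𝓘(ℝ, E')) 𝓘(ℝ, E'') G (f n, g n)
  have hD : HasMFDerivAt (𝓘(ℝ, E).prod 𝓘(ℝ, E')) 𝓘(ℝ, E'') G (f n, g n) D := hG.hasMFDerivAt
  have h1 : HasT (fun y => G (y, g n)) (f n)
      (D.comp ((ContinuousLinearMap.id ℝ E).prod (0 : E →L[ℝ] E'))) :=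
    HasMFDerivAt.comp (f n) hD
      (HasMFDerivAt.prodMk (hasMFDerivAt_id (f n)) (hasMFDerivAt_const (g n) (f n)))
  have h2 : HasT (fun y => G (f n, y)) (g n)
      (D.comp ((0 : E' →L[ℝ] E).prod (ContinuousLinearMap.id ℝ E'))) :=
    HasMFDerivAt.comp (g n) hD
      (HasMFDerivAt.prodMk (hasMFDerivAt_const (f n) (g n)) (hasMFDerivAt_id (g n)))
  have h3 : HasT (fun z => G (f z, g z)) n (D.comp (L.prod L')) :=
    HasMFDerivAt.comp n hD (HasMFDerivAt.prodMk hf hg)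
  rw [hK.unique h1, hK'.unique h2]
  convert h3 using 1
  ext v
  change D (L v, 0) + D (0, L' v) = D (L v, L' v)
  rw [← map_add]
  simp

end HasT

end Derivative

/-! ### Charts and the inverse function theorem. -/

section Charts

variable {E : Type*} [NormedAddCommGroup E] [NormedSpace ℝ E]
  {M : Type*} [TopologicalSpace M] [ChartedSpace E M]
  {E' : Type*} [NormedAddCommGroup E'] [NormedSpace ℝ E']
  {M' : Type*} [TopologicalSpace M'] [ChartedSpace E' M']

theorem eventually_extChartAt_right_inv (x : M) :
    ∀ᶠ u in 𝓝 (extChartAt 𝓘(ℝ, E) x x),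
      extChartAt 𝓘(ℝ, E) x ((extChartAt 𝓘(ℝ, E) x).symm u) = u :=
  mem_of_superset (extChartAt_target_mem_nhds x) fun _ hu => (extChartAt 𝓘(ℝ, E) x).right_inv hu

theorem eventually_extChartAt_left_inv (x : M) :
    ∀ᶠ y in 𝓝 x, (extChartAt 𝓘(ℝ, E) x).symm (extChartAt 𝓘(ℝ, E) x y) = y :=
  mem_of_superset (extChartAt_source_mem_nhds x) fun _ hu => (extChartAt 𝓘(ℝ, E) x).left_inv hu

theorem tendsto_extChartAt_symm (x : M) :
    Tendsto (extChartAt 𝓘(ℝ, E) x).symm (𝓝 (extChartAt 𝓘(ℝ, E) x x)) (𝓝 x) := by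
  simpa using (continuousAt_extChartAt_symm (I := 𝓘(ℝ, E)) x).tendsto

theorem ContMDiffAt.contDiffAt_charts {f : M → M'} {x : M} {y : M'} {n : ℕ∞ω}
    (h : ContMDiffAt 𝓘(ℝ, E) 𝓘(ℝ, E') n f x) (hy : f x = y) :
    ContDiffAt ℝ n (fun u => extChartAt 𝓘(ℝ, E') y (f ((extChartAt 𝓘(ℝ, E) x).symm u)))
      (extChartAt 𝓘(ℝ, E) x x) := by
  subst hy
  have := (contMDiffAt_iff.1 h).2
  rw [ModelWithCorners.range_eq_univ, contDiffWithinAt_univ] at this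
  exact this

/-- A map with invertible derivative is locally open. -/
theorem HasT.map_nhds_eq [CompleteSpace E] {f : M → M'} {x : M} {L : E ≃L[ℝ] E'}
    (h : HasT f x (L : E →L[ℝ] E')) (hf : ContMDiffAt 𝓘(ℝ, E) 𝓘(ℝ, E') 1 f x) :
    map f (𝓝 x) = 𝓝 (f x) := by
  have h1 := ((hf.contDiffAt_charts rfl).hasStrictFDerivAt' (hasT_iff_chart.1 h).2
    one_ne_zero).map_nhds_eq_of_equiv
  simp only [extChartAt_to_inv] at h1
  have h2 : ∀ᶠ z in 𝓝 x, (extChartAt 𝓘(ℝ, E') (f x)).symm (extChartAt 𝓘(ℝ, E') (f x)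
      (f ((extChartAt 𝓘(ℝ, E) x).symm (extChartAt 𝓘(ℝ, E) x z)))) = f z := by
    filter_upwards [eventually_extChartAt_left_inv (E := E) x,
      h.continuousAt.tendsto.eventually (eventually_extChartAt_left_inv (E := E') (f x))]
      with z h3 h4
    rw [h3, h4]
  have h3 : map (extChartAt 𝓘(ℝ, E') (f x)).symm (𝓝 (extChartAt 𝓘(ℝ, E') (f x) (f x)))
      = 𝓝 (f x) := by
    rw [← map_extChartAt_nhds_of_boundaryless, map_map]
    have : (extChartAt 𝓘(ℝ, E') (f x)).symm ∘ extChartAt 𝓘(ℝ, E') (f x) =ᶠ[𝓝 (f x)] _root_.id :=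
      eventually_extChartAt_left_inv (E := E') (f x)
    rw [map_congr this, map_id]
  rw [← map_congr h2, ← h3, ← h1, ← map_extChartAt_nhds_of_boundaryless, map_map, map_map]
  rfl

end Charts

/-! ### First-order calculus of the multiplication and the Hausdorff property. -/

namespace SymmetricSpace

variable {E : Type*} [NormedAddCommGroup E] [NormedSpace ℝ E] [CompleteSpace E]
  {M : Type*} [TopologicalSpace M] [ChartedSpace E M] [IsManifold 𝓘(ℝ, E) ∞ M]
  {F : Type*} [NormedAddCommGroup F] [NormedSpace ℝ F] {H : Type*} [TopologicalSpace H]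
  {J : ModelWithCorners ℝ F H} {N : Type*} [TopologicalSpace N] [ChartedSpace H N]
  (S : SymmetricSpace E M)

theorem contMDiffAt_mul₂ {n : ℕ∞ω} (hn : n ≤ ∞) {f g : N → M} {x : N}
    (hf : ContMDiffAt J 𝓘(ℝ, E) n f x) (hg : ContMDiffAt J 𝓘(ℝ, E) n g x) :
    ContMDiffAt J 𝓘(ℝ, E) n (fun z => S.mul (f z) (g z)) x :=
  ContMDiffAt.comp x ((S.contMDiff_mul.of_le hn).contMDiffAt) (hf.prodMk hg)

theorem contMDiff_mul₂ {n : ℕ∞ω} (hn : n ≤ ∞) {f g : N → M}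
    (hf : ContMDiff J 𝓘(ℝ, E) n f) (hg : ContMDiff J 𝓘(ℝ, E) n g) :
    ContMDiff J 𝓘(ℝ, E) n (fun z => S.mul (f z) (g z)) :=
  fun x => S.contMDiffAt_mul₂ hn (hf x) (hg x)

theorem continuous_mul₂ {X : Type*} [TopologicalSpace X] {f g : X → M} (hf : Continuous f)
    (hg : Continuous g) : Continuous (fun z => S.mul (f z) (g z)) :=
  S.contMDiff_mul.continuous.comp (hf.prodMk hg)

theorem contMDiff_mul_left (x : M) : ContMDiff 𝓘(ℝ, E) 𝓘(ℝ, E) ∞ (S.mul x) :=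
  S.contMDiff_mul₂ le_rfl contMDiff_const contMDiff_id

theorem contMDiff_mul_right (x : M) : ContMDiff 𝓘(ℝ, E) 𝓘(ℝ, E) ∞ (fun y => S.mul y x) :=
  S.contMDiff_mul₂ le_rfl contMDiff_id contMDiff_const

theorem mdifferentiableAt_mul (p : M × M) :
    MDifferentiableAt (𝓘(ℝ, E).prod 𝓘(ℝ, E)) 𝓘(ℝ, E) (fun p : M × M => S.mul p.1 p.2) p :=
  S.contMDiff_mul.contMDiffAt.mdifferentiableAt (by simp)

/-- By (S2) and (S4) the symmetry is an involution with isolated fixed point x; both properties are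
read off in the chart at x. -/
theorem hasT_mul_left (x : M) : HasT (S.mul x) x (-ContinuousLinearMap.id ℝ E) := by
  have h := HasT.of_mdifferentiableAt ((S.contMDiff_mul_left x).mdifferentiableAt (x := x) (by simp))
  have hx := S.mul_self x
  have hc := hasT_iff_chart.1 h
  rw [hx] at hc
  set φ := extChartAt 𝓘(ℝ, E) x
  have ht := tendsto_extChartAt_symm (E := E) x
  have hsc : Tendsto (S.mul x) (𝓝 x) (𝓝 x) := by simpa [hx] using hc.1.tendsto
  have hinv : ∀ᶠ u in 𝓝 (φ x), φ (S.mul x (φ.symm (φ (S.mul x (φ.symm u))))) = u := by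
    filter_upwards [eventually_extChartAt_right_inv (E := E) x,
      (hsc.comp ht).eventually (eventually_extChartAt_left_inv (E := E) x)] with u h1 h2
    simp only [Function.comp_apply] at h2
    rw [h2, S.mul_mul_cancel, h1]
  have hiso : ∀ᶠ u in 𝓝 (φ x), φ (S.mul x (φ.symm u)) = u → u = φ x := by
    obtain ⟨U, hU, hU'⟩ := S.isolated x
    filter_upwards [eventually_extChartAt_right_inv (E := E) x,
      (hsc.comp ht).eventually (eventually_extChartAt_left_inv (E := E) x),
      ht.eventually hU] with u h1 h2 h3 h4
    simp only [Function.comp_apply] at h2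
    rw [← hU' _ h3 (by rw [← h2]; exact congrArg φ.symm h4), h1]
  rw [← hasFDerivAt_neg_id_of_involution (((S.contMDiff_mul_left x).contMDiffAt.of_le
    (by simp)).contDiffAt_charts hx) (by simp [hx]) hc.2 hinv hiso]
  exact h

/-- Differentiating x·x = x shows that the partial derivatives R and -1 of the product add up to 1.
-/
theorem hasT_mul_right (x : M) :
    HasT (fun y => S.mul y x) x ((2 : ℝ) • ContinuousLinearMap.id ℝ E) := by
  have h := HasT.of_mdifferentiableAt
    ((S.contMDiff_mul_right x).mdifferentiableAt (x := x) (by simp))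
  have h1 := HasT.comp₂ (G := fun p : M × M => S.mul p.1 p.2) (S.mdifferentiableAt_mul (x, x)) h
    (S.hasT_mul_left x) (HasT.id x) (HasT.id x) rfl rfl
  simp only [S.mul_self] at h1
  have h2 := h1.unique (HasT.id x)
  have h3 : (tder (fun y => S.mul y x) x : E →L[ℝ] E) = (2 : ℝ) • ContinuousLinearMap.id ℝ E := by
    rw [two_smul]
    rw [ContinuousLinearMap.comp_id, ContinuousLinearMap.comp_id] at h2
    rw [← sub_eq_iff_eq_add, sub_eq_add_neg]
    exact h2
  rw [← h3]
  exact h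

theorem map_mul_right_nhds (x : M) : map (fun y => S.mul y x) (𝓝 x) = 𝓝 x := by
  let two : E ≃L[ℝ] E := ContinuousLinearEquiv.smulLeft (Units.mk0 (2 : ℝ) two_ne_zero)
  have h : HasT (fun y => S.mul y x) x (two : E →L[ℝ] E) := S.hasT_mul_right x
  simpa [S.mul_self] using h.map_nhds_eq ((S.contMDiff_mul_right x).contMDiffAt.of_le (by simp))

/-- Suppose x and y have no disjoint neighbourhoods, and let O be a neighbourhood of y = x·(x·y).
Then x·(m·z) ∈ O for m near x and z near y. As y ↦ y·x is open at x, some such z has the form m·x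
with m near x, and x·(m·(m·x)) = x lies in O. So x is in every neighbourhood of y, and M is T1.
Being Hausdorff is needed for limits of translations. -/
theorem t2Space (S : SymmetricSpace E M) : T2Space M := by
  have : T1Space M := ChartedSpace.t1Space E M
  refine t2_iff_nhds.2 fun {x y} hne => ?_
  refine Specializes.eq (specializes_iff_pure.2 (pure_le_iff.2 fun O hO => ?_))
  have hc : Continuous (fun p : M × M => S.mul x (S.mul p.1 p.2)) :=
    S.continuous_mul₂ continuous_const (S.continuous_mul₂ continuous_fst continuous_snd)
  have hO' : ∀ᶠ p in 𝓝 (x, y), S.mul x (S.mul p.1 p.2) ∈ O := by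
    refine hc.continuousAt.eventually ?_
    simpa [S.mul_mul_cancel] using hO
  rw [nhds_prod_eq] at hO'
  obtain ⟨N, hN, N', hN', h⟩ := eventually_prod_iff.1 hO'
  have h1 : (fun m => S.mul m x) '' {m | N m} ∈ 𝓝 x := by
    have := image_mem_map (m := fun m => S.mul m x) hN
    rwa [S.map_mul_right_nhds] at this
  obtain ⟨z, ⟨m, hm, rfl⟩, hz⟩ := hne.nonempty_of_mem (inter_mem_inf h1 hN')
  have := h hm hz
  rwa [S.mul_mul_cancel, S.mul_self] at this

end SymmetricSpace

/-! ### The exponential map as a linearization of doubling. -/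

namespace SymmetricSpace

variable {E : Type*} [NormedAddCommGroup E] [NormedSpace ℝ E] [CompleteSpace E]
  {M : Type*} [TopologicalSpace M] [ChartedSpace E M] [IsManifold 𝓘(ℝ, E) ∞ M]
  (S : SymmetricSpace E M)

/-- The exponential map at `b` is characterized by `e (2 v) = e v · b`, together with its
differential at `0`. -/
structure IsExp (b : M) (e : E → M) : Prop where
  zero : e 0 = b
  two_smul : ∀ v, e ((2 : ℝ) • v) = S.mul (e v) b
  contMDiff : ContMDiff 𝓘(ℝ, E) 𝓘(ℝ, E) 1 e
  hasT_zero : HasT e 0 (ContinuousLinearMap.id ℝ E)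

/-- A local inverse of the exponential map at `b`. -/
structure IsLog (b : M) (e : E → M) (l : M → E) : Prop where
  base : l b = 0
  contMDiffAt : ContMDiffAt 𝓘(ℝ, E) 𝓘(ℝ, E) 1 l b
  hasT_base : HasT l b (ContinuousLinearMap.id ℝ E)
  log_exp : ∀ᶠ v in 𝓝 0, l (e v) = v
  exp_log : ∀ᶠ y in 𝓝 b, e (l y) = y
  mul_base : ∀ᶠ y in 𝓝 b, l (S.mul y b) = (2 : ℝ) • l y

/-- In the chart translated to send b to 0, doubling y ↦ y·b fixes 0 with derivative 2, so
`exists_linearization_two` applies. -/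
theorem exists_local_exp (b : M) : ∃ (e : E → M) (l : M → E) (r : ℝ), 0 < r ∧ e 0 = b ∧
    (∀ v, ‖v‖ < r → e ((2 : ℝ) • v) = S.mul (e v) b ∧ ContMDiffAt 𝓘(ℝ, E) 𝓘(ℝ, E) 1 e v) ∧
    HasT e 0 (ContinuousLinearMap.id ℝ E) ∧ S.IsLog b e l := by
  set φ := extChartAt 𝓘(ℝ, E) b with hφ
  set p := φ b with hp
  have hpb : φ.symm p = b := extChartAt_to_inv b
  have ht := tendsto_extChartAt_symm (E := E) b
  have htr : Tendsto (fun u : E => p + u) (𝓝 0) (𝓝 p) :=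
    Continuous.tendsto' (by fun_prop) _ _ (add_zero p)
  have hbb := S.mul_self b
  let δ : E → E := fun u => φ (S.mul (φ.symm (p + u)) b) - p
  have hch := ((S.contMDiff_mul_right b).contMDiffAt (x := b)).contDiffAt_charts hbb
  have hchd := (hasT_iff_chart.1 (S.hasT_mul_right b)).2
  simp only [hbb] at hchd
  have hδ : ContDiffAt ℝ 2 δ 0 := by
    have h1 : ContDiffAt ℝ 2 (fun u : E => p + u) 0 := contDiffAt_const.add contDiffAt_id
    refine ContDiffAt.sub ?_ contDiffAt_const
    refine ContDiffAt.comp (0 : E) (g := fun u => φ (S.mul (φ.symm u) b)) ?_ h1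
    rw [add_zero]
    exact contDiffAt_infty.1 hch 2
  have hδ0 : δ 0 = 0 := by
    change φ (S.mul (φ.symm (p + 0)) b) - p = 0
    rw [add_zero, hpb, hbb, sub_self]
  have hδd : HasFDerivAt δ ((2 : ℝ) • ContinuousLinearMap.id ℝ E) 0 := by
    have h1 : HasFDerivAt (fun u : E => p + u) (ContinuousLinearMap.id ℝ E) 0 :=
      (hasFDerivAt_id (0 : E)).const_add p
    refine HasFDerivAt.sub_const p ?_
    have h2 : HasFDerivAt (fun u => φ (S.mul (φ.symm u) b)) ((2 : ℝ) • ContinuousLinearMap.id ℝ E)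
      (p + 0) := by rw [add_zero]; exact hchd
    exact h2.comp (0 : E) h1
  obtain ⟨ε, l, hε, hε0, hεd, hl, hl0, hld, hlε, hεl, hεδ, hlδ⟩ :=
    exists_linearization_two hδ hδ0 hδd
  have hεt : Tendsto (fun v => p + ε v) (𝓝 0) (𝓝 p) := by
    refine htr.comp ?_
    simpa [hε0] using hε.continuousAt.tendsto
  have hmulb : Tendsto (fun y => S.mul y b) (𝓝 b) (𝓝 b) := by
    simpa [hbb] using (S.contMDiff_mul_right b).continuous.tendsto b
  have hsub : Tendsto (fun y => φ y - p) (𝓝 b) (𝓝 0) := by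
    have : Tendsto φ (𝓝 b) (𝓝 p) := (continuousAt_extChartAt (I := 𝓘(ℝ, E)) b).tendsto
    simpa using this.sub_const p
  have hfac : ∀ᶠ v in 𝓝 (0 : E), ContMDiffAt 𝓘(ℝ, E) 𝓘(ℝ, E) 1 (fun v => φ.symm (p + ε v)) v := by
    have h1 : ∀ᶠ u in 𝓝 p, ContMDiffAt 𝓘(ℝ, E) 𝓘(ℝ, E) 1 φ.symm u := by
      refine mem_of_superset (extChartAt_target_mem_nhds (I := 𝓘(ℝ, E)) b) fun u hu => ?_
      have : IsManifold 𝓘(ℝ, E) 1 M := IsManifold.of_le (n := ∞) (by simp)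
      exact contMDiffOn_extChartAt_symm b |>.contMDiffAt
        ((isOpen_extChartAt_target b).mem_nhds hu)
    filter_upwards [hε.eventually (by simp), hεt.eventually h1] with v h2 h3
    exact ContMDiffAt.comp v h3 (contDiffAt_const.add h2).contMDiffAt
  have hmul : ∀ᶠ v in 𝓝 (0 : E),
      φ.symm (p + ε ((2 : ℝ) • v)) = S.mul (φ.symm (p + ε v)) b := by
    filter_upwards [hεδ, (hmulb.comp (ht.comp hεt)).eventually
      (eventually_extChartAt_left_inv (E := E) b)] with v h1 h2
    rw [h1]
    simp only [Function.comp_apply] at h2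
    rw [← hφ] at h2
    simp only [δ]
    rw [add_sub_cancel, h2]
  obtain ⟨r, hr, hball⟩ := Metric.eventually_nhds_iff_ball.1 (hmul.and hfac)
  refine ⟨fun v => φ.symm (p + ε v), fun y => l (φ y - p), r, hr, by simp [hε0, hpb], ?_, ?_, ?_⟩
  · intro v hv
    exact hball v (by simpa using hv)
  · refine hasT_iff_chart.2 ⟨hfac.self_of_nhds.continuousAt, ?_⟩
    simp only [hε0, add_zero, hpb, extChartAt_model_space_eq_id, PartialEquiv.refl_symm,
      PartialEquiv.refl_coe, id]
    refine (hεd.const_add p).congr_of_eventuallyEq ?_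
    exact hεt.eventually (eventually_extChartAt_right_inv (E := E) b)
  · have hφd : HasT φ b (ContinuousLinearMap.id ℝ E) := by
      refine hasT_iff_chart.2 ⟨continuousAt_extChartAt (I := 𝓘(ℝ, E)) b, ?_⟩
      simp only [extChartAt_model_space_eq_id, PartialEquiv.refl_coe, id]
      exact (hasFDerivAt_id _).congr_of_eventuallyEq
        (eventually_extChartAt_right_inv (E := E) b)
    refine ⟨by simp [hp, hl0], ?_, ?_, ?_, ?_, ?_⟩
    · have : IsManifold 𝓘(ℝ, E) 1 M := IsManifold.of_le (n := ∞) (by simp)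
      have h1 : ContMDiffAt 𝓘(ℝ, E) 𝓘(ℝ, E) 1 φ b := contMDiffAt_extChartAt
      refine ContMDiffAt.comp b (g := fun u => l (u - p)) ?_ h1
      refine ContDiffAt.contMDiffAt (ContDiffAt.comp (φ b) ?_ (contDiffAt_id.sub contDiffAt_const))
      simpa [hp] using hl
    · have h1 : HasT (fun u => l (u - p)) p (ContinuousLinearMap.id ℝ E) := by
        rw [hasT_iff_hasFDerivAt]
        have h2 : HasFDerivAt l (ContinuousLinearMap.id ℝ E) (p - p) := by rwa [sub_self]
        exact HasFDerivAt.comp (f := fun u => u - p) p h2 ((hasFDerivAt_id p).sub_const p)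
      exact h1.comp hφd rfl
    · filter_upwards [hlε, hεt.eventually (eventually_extChartAt_right_inv (E := E) b)] with v h1 h2
      rw [h2, add_sub_cancel_left, h1]
    · filter_upwards [hsub.eventually hεl, eventually_extChartAt_left_inv (E := E) b] with y h1 h2
      rw [h1, add_sub_cancel, h2]
    · filter_upwards [hsub.eventually hlδ, eventually_extChartAt_left_inv (E := E) b] with y h1 h2
      simp only [δ, add_sub_cancel] at h1
      rw [← h1, h2]

theorem exists_exp (b : M) : ∃ (e : E → M) (l : M → E), S.IsExp b e ∧ S.IsLog b e l := by
  obtain ⟨e₀, l, r, hr, h0, h2, hd, hl⟩ := S.exists_local_exp b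
  let δ : M → M := fun y => S.mul y b
  -- The local map is extended by halving the vector n times and doubling the point n times; the
  -- result no longer depends on n once 2^n r exceeds the norm of v. Near each v the extension thus
  -- agrees with a single `a n`.
  let a : ℕ → E → M := fun n v => δ^[n] (e₀ (((2 : ℝ) ^ n)⁻¹ • v))
  have hnorm : ∀ (n : ℕ) (v : E), ‖v‖ < 2 ^ n * r → ‖((2 : ℝ) ^ n)⁻¹ • v‖ < r := fun n v hv => by
    rw [norm_smul, norm_inv, norm_pow, Real.norm_ofNat, inv_mul_lt_iff₀ (by positivity)]
    exact hv
  have hstep : ∀ n v, ‖v‖ < 2 ^ n * r → a (n + 1) v = a n v := by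
    intro n v hv
    have h3 := hnorm (n + 1) v (hv.trans_le (by rw [pow_succ]; nlinarith [pow_pos (two_pos (α := ℝ)) n]))
    have h4 := (h2 _ h3).1
    rw [smul_smul, pow_succ, mul_inv, mul_comm, mul_assoc, inv_mul_cancel₀ two_ne_zero, mul_one]
      at h4
    simp only [a, Function.iterate_succ_apply]
    rw [pow_succ, mul_inv, h4, mul_comm]
  have hmono : ∀ n k v, ‖v‖ < 2 ^ n * r → a (n + k) v = a n v := by
    intro n k v hv
    induction k with
    | zero => rfl
    | succ k ih =>
      rw [← add_assoc, hstep, ih]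
      refine hv.trans_le ?_
      gcongr
      · norm_num
      · omega
  have hex : ∀ v : E, ∃ n : ℕ, ‖v‖ < 2 ^ n * r := fun v => by
    obtain ⟨n, hn⟩ := pow_unbounded_of_one_lt (‖v‖ / r) (one_lt_two (α := ℝ))
    exact ⟨n, (div_lt_iff₀ hr).1 hn⟩
  choose n hn using hex
  let e : E → M := fun v => a (n v) v
  have he : ∀ m v, ‖v‖ < 2 ^ m * r → e v = a m v := fun m v hv => by
    rw [← hmono m (n v) v hv, add_comm, hmono (n v) m v (hn v)]
  have hnhds : ∀ m v, ‖v‖ < 2 ^ m * r → e =ᶠ[𝓝 v] a m := fun m v hv => by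
    filter_upwards [continuous_norm.continuousAt.eventually_lt continuousAt_const hv] with w hw
    exact he m w hw
  have hδs : ∀ m, ContMDiff 𝓘(ℝ, E) 𝓘(ℝ, E) 1 δ^[m] := fun m => by
    induction m with
    | zero => exact contMDiff_id
    | succ m ih => exact ih.comp ((S.contMDiff_mul_right b).of_le (by simp))
  have he0 : e =ᶠ[𝓝 0] e₀ := by
    refine (hnhds 0 0 (by simpa using hr)).trans (Eventually.of_forall fun v => ?_)
    simp [a]
  refine ⟨e, l, ⟨?_, ?_, ?_, hd.congr he0⟩, ⟨hl.base, hl.contMDiffAt, hl.hasT_base, ?_, ?_,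
    hl.mul_base⟩⟩
  · rw [he0.self_of_nhds, h0]
  · intro v
    have h3 : ‖(2 : ℝ) • v‖ < 2 ^ (n v + 1) * r := by
      rw [norm_smul, Real.norm_ofNat, pow_succ']
      nlinarith [hn v]
    rw [he _ _ h3, he _ _ (hn v)]
    simp only [a, Function.iterate_succ_apply']
    rw [smul_smul, pow_succ, mul_inv, mul_assoc, inv_mul_cancel₀ two_ne_zero, mul_one]
  · intro v
    refine ContMDiffAt.congr_of_eventuallyEq ?_ (hnhds (n v) v (hn v))
    refine ContMDiffAt.comp v (hδs _).contMDiffAt ?_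
    refine ContMDiffAt.comp v (h2 _ (hnorm _ _ (hn v))).2 ?_
    exact ((contDiff_const.smul contDiff_id).contMDiff).contMDiffAt
  · filter_upwards [he0, hl.log_exp] with v h3 h4
    rw [h3, h4]
  · have h3 : Tendsto l (𝓝 b) (𝓝 0) := by
      simpa [hl.base] using hl.contMDiffAt.continuousAt.tendsto
    filter_upwards [h3.eventually he0, hl.exp_log] with y h4 h5
    rw [h4, h5]

/-- The exponential map at `b`. -/
noncomputable def exp (b : M) : E → M := (S.exists_exp b).choose

/-- A local inverse of the exponential map at `b`. -/
noncomputable def log (b : M) : M → E := (S.exists_exp b).choose_spec.choose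

theorem isExp_exp (b : M) : S.IsExp b (S.exp b) := (S.exists_exp b).choose_spec.choose_spec.1

theorem isLog_log (b : M) : S.IsLog b (S.exp b) (S.log b) :=
  (S.exists_exp b).choose_spec.choose_spec.2

@[simp] theorem exp_zero (b : M) : S.exp b 0 = b := (S.isExp_exp b).zero

theorem exp_two_smul (b : M) (v : E) : S.exp b ((2 : ℝ) • v) = S.mul (S.exp b v) b :=
  (S.isExp_exp b).two_smul v

theorem contMDiff_exp (b : M) : ContMDiff 𝓘(ℝ, E) 𝓘(ℝ, E) 1 (S.exp b) :=
  (S.isExp_exp b).contMDiff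

theorem continuous_exp (b : M) : Continuous (S.exp b) := (S.contMDiff_exp b).continuous

theorem hasT_exp_zero (b : M) : HasT (S.exp b) 0 (ContinuousLinearMap.id ℝ E) :=
  (S.isExp_exp b).hasT_zero

/-- A map that intertwines doublings is determined by its derivative. -/
theorem eq_exp_of_two_smul {F : Type*} [NormedAddCommGroup F] [NormedSpace ℝ F] {b : M}
    {h : F → M} {L : F →L[ℝ] E} (h0 : h 0 = b) (h2 : ∀ v, h ((2 : ℝ) • v) = S.mul (h v) b)
    (hd : HasT h 0 L) (v : F) : h v = S.exp b (L v) := by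
  have hl := S.isLog_log b
  have hsmul : ∀ v : F, Tendsto (fun n : ℕ => ((2 : ℝ) ^ n)⁻¹ • v) atTop (𝓝 0) := fun v => by
    have : Tendsto (fun n : ℕ => ((2 : ℝ) ^ n)⁻¹) atTop (𝓝 0) :=
      tendsto_inv_atTop_zero.comp (tendsto_pow_atTop_atTop_of_one_lt one_lt_two)
    simpa using this.smul_const v
  have hhc : Tendsto h (𝓝 0) (𝓝 b) := by simpa [h0] using hd.continuousAt.tendsto
  have hg : HasFDerivAt (fun v => S.log b (h v)) L 0 := by
    rw [← hasT_iff_hasFDerivAt]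
    exact hl.hasT_base.comp hd h0
  have hg2 : ∀ᶠ v in 𝓝 (0 : F), S.log b (h v) = L v := by
    have h3 : ∀ᶠ v in 𝓝 (0 : F), S.log b (h ((2 : ℝ) • v)) = (2 : ℝ) • S.log b (h v) := by
      filter_upwards [hhc.eventually hl.mul_base] with v hv
      rw [h2, hv]
    obtain ⟨r, hr, hball⟩ := Metric.eventually_nhds_iff_ball.1 h3
    filter_upwards [Metric.ball_mem_nhds (0 : F) hr] with v hv
    rw [mem_ball_zero_iff] at hv
    -- For g = log ∘ h the quotients 2^n g(2^{-n} v) do not depend on n, while differentiability at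
    -- 0 makes them converge to L v. So g is linear near 0.
    have h4 : ∀ n : ℕ, (2 : ℝ) ^ n • S.log b (h (((2 : ℝ) ^ n)⁻¹ • v)) = S.log b (h v) := by
      intro n
      induction n with
      | zero => simp
      | succ n ih =>
        rw [← ih, pow_succ, mul_smul, ← hball]
        · rw [smul_smul, mul_inv, mul_left_comm, mul_inv_cancel₀ two_ne_zero, mul_one]
        · rw [mem_ball_zero_iff, norm_smul, norm_inv, norm_mul, norm_pow, Real.norm_ofNat,
            inv_mul_lt_iff₀ (by positivity)]
          nlinarith [one_le_pow₀ (one_le_two (α := ℝ)) (n := n)]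
    have h5 := hg.lim v (c := fun n : ℕ => (2 : ℝ) ^ n) (l := atTop)
      (by simpa using tendsto_pow_atTop_atTop_of_one_lt (one_lt_two (α := ℝ)))
    simp only [zero_add, h0, hl.base, sub_zero, h4] at h5
    exact tendsto_nhds_unique tendsto_const_nhds h5
  have hloc : ∀ᶠ v in 𝓝 (0 : F), h v = S.exp b (L v) := by
    filter_upwards [hg2, hhc.eventually hl.exp_log] with v h3 h4
    rw [← h3, h4]
  obtain ⟨n, hn⟩ := ((hsmul v).eventually hloc).exists
  have hit : ∀ (n : ℕ) (v : F), h v = S.exp b (L v) → h ((2 : ℝ) ^ n • v) = S.exp b (L ((2 : ℝ) ^ n • v)) := by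
    intro n v hv
    induction n with
    | zero => simpa using hv
    | succ n ih => rw [pow_succ', mul_smul, h2, ih, ← exp_two_smul, map_smul L (2 : ℝ)]
  have := hit n _ hn
  rwa [smul_smul, mul_inv_cancel₀ (by positivity), one_smul] at this

end SymmetricSpace

/-! ### Translations along geodesics form one-parameter groups. -/

namespace SymmetricSpace

variable {E : Type*} [NormedAddCommGroup E] [NormedSpace ℝ E] [CompleteSpace E]
  {M : Type*} [TopologicalSpace M] [ChartedSpace E M] [IsManifold 𝓘(ℝ, E) ∞ M]
  (S : SymmetricSpace E M)

/-- The symmetry around `x`. -/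
def sym (x : M) : Equiv.Perm M where
  toFun := S.mul x
  invFun := S.mul x
  left_inv := S.mul_mul_cancel x
  right_inv := S.mul_mul_cancel x

@[simp] theorem sym_apply (x y : M) : S.sym x y = S.mul x y := rfl

theorem sym_mul_self (x : M) : S.sym x * S.sym x = 1 := by
  ext y; exact S.mul_mul_cancel x y

theorem sym_inv (x : M) : (S.sym x)⁻¹ = S.sym x := rfl

theorem sym_mul_apply (x y : M) : S.sym (S.mul x y) = S.sym x * S.sym y * S.sym x := by
  ext z
  have := S.mul_distrib x y (S.mul x z)
  rw [S.mul_mul_cancel] at this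
  exact this.symm

/-- The translation along the geodesic through `b` with velocity `x`, by `x`. -/
noncomputable def tr (b : M) (x : E) : Equiv.Perm M := S.sym (S.exp b ((1 / 2 : ℝ) • x)) * S.sym b

theorem tr_apply (b : M) (x : E) (y : M) :
    S.tr b x y = S.mul (S.exp b ((1 / 2 : ℝ) • x)) (S.mul b y) := rfl

theorem tr_map_mul (b : M) (x : E) (y z : M) :
    S.tr b x (S.mul y z) = S.mul (S.tr b x y) (S.tr b x z) := by
  rw [tr_apply, S.mul_distrib b, S.mul_distrib]
  rfl

theorem sym_pow_apply (b y z : M) (m : ℕ) : S.sym (((S.sym y * S.sym b) ^ m) z) =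
    (S.sym y * S.sym b) ^ m * S.sym z * ((S.sym y * S.sym b) ^ m)⁻¹ := by
  induction m with
  | zero => simp
  | succ m ih =>
    rw [pow_succ', Equiv.Perm.mul_apply, Equiv.Perm.mul_apply, sym_apply, sym_apply,
      sym_mul_apply, sym_mul_apply, ih, mul_inv_rev, mul_inv_rev, sym_inv, sym_inv]
    simp only [mul_assoc]

theorem sym_mul_pow (b y : M) (m : ℕ) : S.sym b * ((S.sym y * S.sym b) ^ m)⁻¹ =
    (S.sym y * S.sym b) ^ m * S.sym b := by
  induction m with
  | zero => simp
  | succ m ih =>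
    have h1 : S.sym b * (S.sym y * S.sym b)⁻¹ = (S.sym y * S.sym b) * S.sym b := by
      rw [mul_inv_rev, sym_inv, sym_inv, mul_assoc, S.sym_mul_self, mul_one, ← mul_assoc,
        S.sym_mul_self, one_mul]
    rw [pow_succ', mul_inv_rev, ← mul_assoc, ih, mul_assoc, h1, ← mul_assoc, ← pow_succ,
      ← pow_succ']

/-- Even powers commute with doubling. -/
theorem pow_apply_mul_base (b y : M) (m : ℕ) :
    ((S.sym (S.mul y b) * S.sym b) ^ m) b = S.mul (((S.sym y * S.sym b) ^ m) b) b := by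
  change _ = S.sym (((S.sym y * S.sym b) ^ m) b) b
  rw [sym_pow_apply, mul_assoc, sym_mul_pow, sym_mul_apply, mul_assoc (S.sym y * S.sym b),
    ← pow_two, ← pow_mul, mul_comm 2 m, pow_mul, pow_two]
  simp [S.mul_self]

/-- Each further factor σ_y σ_b adds 2: the point y in σ_y contributes 2, and the two symmetries act
on the previous term by (-1)(-1). -/
theorem hasT_pow_apply (b : M) (m : ℕ) :
    HasT (fun y => ((S.sym y * S.sym b) ^ m) b) b ((2 * m : ℝ) • ContinuousLinearMap.id ℝ E) := by
  induction m with
  | zero => simpa using HasT.const b b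
  | succ m ih =>
    have h0 : ((S.sym b * S.sym b) ^ m) b = b := by rw [S.sym_mul_self]; simp
    have h1 := HasT.comp₂ (G := fun p : M × M => S.mul p.1 p.2) (S.mdifferentiableAt_mul (b, b))
      (S.hasT_mul_right b) (S.hasT_mul_left b) (HasT.id b) ((S.hasT_mul_left b).comp ih h0) rfl
      (by rw [h0, S.mul_self])
    simp only [pow_succ', Equiv.Perm.mul_apply, sym_apply]
    convert h1 using 1
    ext v
    push_cast
    change (2 * ((m : ℝ) + 1)) • v = (2 : ℝ) • v + -(-((2 * m : ℝ) • v))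
    module

theorem exp_neg (b : M) (v : E) : S.exp b (-v) = S.mul b (S.exp b v) := by
  have h := S.eq_exp_of_two_smul (b := b) (h := fun v => S.mul b (S.exp b v))
    (L := (-ContinuousLinearMap.id ℝ E)) (by simp [S.mul_self])
    (fun v => by rw [S.exp_two_smul, S.mul_distrib, S.mul_self])
    (by simpa using (S.hasT_mul_left b).comp (S.hasT_exp_zero b) (S.exp_zero b)) v
  simpa using h.symm

/-- The map v ↦ (σ_{exp v} σ_b)^m b commutes with doubling and has derivative 2m, so by rigidity it
is exp(2m v); the claim is the case v = x/2. -/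
theorem tr_pow_apply_base (b : M) (x : E) (m : ℕ) : ((S.tr b x) ^ m) b = S.exp b ((m : ℝ) • x) := by
  have h := S.eq_exp_of_two_smul (b := b)
    (h := fun v => ((S.sym (S.exp b v) * S.sym b) ^ m) b)
    (L := (2 * m : ℝ) • ContinuousLinearMap.id ℝ E)
    (by simp [S.sym_mul_self])
    (fun v => by rw [S.exp_two_smul, S.pow_apply_mul_base])
    (by simpa using (S.hasT_pow_apply b m).comp (S.hasT_exp_zero b) (S.exp_zero b))
    ((1 / 2 : ℝ) • x)
  rw [tr, h]
  congr 1
  simp only [_root_.smul_apply, ContinuousLinearMap.id_apply, smul_smul]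
  congr 1
  ring

theorem tr_apply_base (b : M) (x : E) : S.tr b x b = S.exp b x := by
  simpa using S.tr_pow_apply_base b x 1

/-- With g = `tr b x`, the symmetry at exp(mx) = g^m b is g^m σ_b g^{-m}, and σ_b inverts g; only
even multiples appear directly. The general case follows by halving x. -/
theorem tr_two_mul_nat_smul (b : M) (x : E) (m : ℕ) :
    S.tr b ((2 * m : ℝ) • x) = (S.tr b x) ^ (2 * m) := by
  have h : (1 / 2 : ℝ) • (2 * m : ℝ) • x = (m : ℝ) • x := by
    rw [smul_smul]; congr 1; ring
  rw [tr, h, ← tr_pow_apply_base, tr, sym_pow_apply, mul_assoc, mul_assoc, ← mul_assoc (S.sym b),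
    sym_mul_pow, mul_assoc, S.sym_mul_self, mul_one, ← pow_add, two_mul]

theorem tr_nat_smul (b : M) (x : E) (m : ℕ) : S.tr b ((m : ℝ) • x) = (S.tr b x) ^ m := by
  have h1 : (m : ℝ) • x = (2 * m : ℝ) • ((1 / 2 : ℝ) • x) := by
    rw [smul_smul]; congr 1; ring
  have h2 : x = (2 * (1 : ℕ) : ℝ) • ((1 / 2 : ℝ) • x) := by
    rw [smul_smul]; norm_num
  rw [h1, tr_two_mul_nat_smul, pow_mul]
  conv_rhs => rw [h2]
  rw [tr_two_mul_nat_smul]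

theorem tr_neg (b : M) (x : E) : S.tr b (-x) = (S.tr b x)⁻¹ := by
  rw [tr, smul_neg, exp_neg, sym_mul_apply, mul_assoc, mul_assoc, S.sym_mul_self, mul_one, tr,
    mul_inv_rev, sym_inv, sym_inv]

theorem tr_int_smul (b : M) (x : E) (m : ℤ) : S.tr b ((m : ℝ) • x) = (S.tr b x) ^ m := by
  obtain ⟨n, rfl | rfl⟩ := m.eq_nat_or_neg
  · simpa using S.tr_nat_smul b x n
  · simp [tr_neg, tr_nat_smul]

theorem continuous_tr {X : Type*} [TopologicalSpace X] (b : M) {f : X → E} {g : X → M}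
    (hf : Continuous f) (hg : Continuous g) : Continuous (fun z => S.tr b (f z) (g z)) :=
  S.continuous_mul₂ ((S.continuous_exp b).comp (hf.const_smul _))
    (S.continuous_mul₂ continuous_const hg)

/-- Integer multiples are powers, so the identity holds when p and q are multiples of 1/n. The
approximations ⌊pn⌋/n and ⌊qn⌋/n share the denominator n, and limits in M are unique. -/
theorem tr_add_smul (b : M) (x : E) (p q : ℝ) :
    S.tr b ((p + q) • x) = S.tr b (p • x) * S.tr b (q • x) := by
  have := S.t2Space
  have hfl : ∀ p : ℝ, Tendsto (fun n : ℕ => (⌊p * n⌋ : ℝ) / n) atTop (𝓝 p) := fun p => by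
    refine tendsto_order.2 ⟨fun a ha => ?_, fun a ha => ?_⟩
    · obtain ⟨N, hN⟩ := exists_nat_gt (1 / (p - a))
      have hN' : 0 < (p - a) := by linarith
      filter_upwards [eventually_ge_atTop N, eventually_gt_atTop 0] with n hn hn0
      have hn0' : (0 : ℝ) < n := by exact_mod_cast hn0
      have hn' : (N : ℝ) ≤ n := by exact_mod_cast hn
      rw [lt_div_iff₀ hn0']
      have h1 := Int.sub_one_lt_floor (p * n)
      rw [div_lt_iff₀ hN'] at hN
      nlinarith
    · filter_upwards [eventually_gt_atTop 0] with n hn0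
      have hn0' : (0 : ℝ) < n := by exact_mod_cast hn0
      refine lt_of_le_of_lt ?_ ha
      rw [div_le_iff₀ hn0']
      exact Int.floor_le _
  ext y
  have h1 : Continuous (fun p : ℝ × ℝ => S.tr b ((p.1 + p.2) • x) y) :=
    S.continuous_tr b (by fun_prop) continuous_const
  have h2 : Continuous (fun p : ℝ × ℝ => S.tr b (p.1 • x) (S.tr b (p.2 • x) y)) :=
    S.continuous_tr b (by fun_prop) (S.continuous_tr b (by fun_prop) continuous_const)
  have h3 := (hfl p).prodMk_nhds (hfl q)
  refine tendsto_nhds_unique ((h1.tendsto (p, q)).comp h3)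
    (((h2.tendsto (p, q)).comp h3).congr fun n => ?_)
  simp only [Function.comp_apply, div_eq_mul_inv, ← add_mul, mul_smul, ← Int.cast_add, tr_int_smul,
    zpow_add, Equiv.Perm.mul_apply]

theorem tr_zero (b : M) : S.tr b 0 = 1 := by
  simp [tr, S.sym_mul_self]

theorem tr_smul_exp (b : M) (x : E) (p q : ℝ) :
    S.tr b (p • x) (S.exp b (q • x)) = S.exp b ((p + q) • x) := by
  rw [← tr_apply_base, ← tr_apply_base, tr_add_smul, Equiv.Perm.mul_apply]

section Morphisms

variable {E' : Type*} [NormedAddCommGroup E'] [NormedSpace ℝ E'] [CompleteSpace E']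
  {M' : Type*} [TopologicalSpace M'] [ChartedSpace E' M'] [IsManifold 𝓘(ℝ, E') ∞ M']
  {S} {S' : SymmetricSpace E' M'}

/-- Rigidity again: f ∘ exp commutes with doubling and has derivative L. -/
theorem map_exp {f : M → M'} (hf : ∀ x y, f (S.mul x y) = S'.mul (f x) (f y)) {b : M}
    {L : E →L[ℝ] E'} (hL : HasT f b L) (v : E) : f (S.exp b v) = S'.exp (f b) (L v) :=
  S'.eq_exp_of_two_smul (h := fun v => f (S.exp b v)) (by simp)
    (fun v => by rw [S.exp_two_smul, hf])
    (by simpa using hL.comp (S.hasT_exp_zero b) (S.exp_zero b)) v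

theorem map_tr {f : M → M'} (hf : ∀ x y, f (S.mul x y) = S'.mul (f x) (f y)) {b : M}
    {L : E →L[ℝ] E'} (hL : HasT f b L) (v : E) (y : M) :
    f (S.tr b v y) = S'.tr (f b) (L v) (f y) := by
  rw [tr_apply, tr_apply, hf, hf, map_exp hf hL, map_smul]

end Morphisms

end SymmetricSpace

/-! ### Jacobi operators along a geodesic. -/

section Parameters

variable {E : Type*} [NormedAddCommGroup E] [NormedSpace ℝ E]
  {E' : Type*} [NormedAddCommGroup E'] [NormedSpace ℝ E']
  {M' : Type*} [TopologicalSpace M'] [ChartedSpace E' M'] [IsManifold 𝓘(ℝ, E') ∞ M']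

/-- Continuous dependence of the tangent map on a real parameter. -/
theorem continuousAt_tder_of_contMDiff {K : ℝ → E → M'} {g : ℝ → E} {s₀ : ℝ} {b : M'}
    (hK : ContMDiff (𝓘(ℝ, ℝ).prod 𝓘(ℝ, E)) 𝓘(ℝ, E') 1 (fun p : ℝ × E => K p.1 p.2))
    (hg : ContinuousAt g s₀) (hb : ∀ s, K s (g s) = b) :
    ContinuousAt (fun s => (tder (K s) (g s) : E →L[ℝ] E')) s₀ := by
  have : IsManifold 𝓘(ℝ, E') 1 M' := IsManifold.of_le (n := ∞) (by simp)
  -- Because K s sends g s to b for every s, all these tangent maps are expressed in the one chart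
  -- at b, and continuity reduces to that of a derivative between normed spaces.
  set φ := extChartAt 𝓘(ℝ, E') b
  have hφK : ContDiffAt ℝ 1 (fun p : ℝ × E => φ (K p.1 p.2)) (s₀, g s₀) := by
    have h1 : ContMDiffAt (𝓘(ℝ, ℝ).prod 𝓘(ℝ, E)) 𝓘(ℝ, E') 1 (fun p : ℝ × E => φ (K p.1 p.2))
        (s₀, g s₀) := by
      refine ContMDiffAt.comp (g := φ) _ ?_ hK.contMDiffAt
      simp only [hb]
      exact contMDiffAt_extChartAt
    rwa [← modelWithCornersSelf_prod, chartedSpaceSelf_prod, contMDiffAt_iff_contDiffAt] at h1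
  have hpt : Tendsto (fun s => (s, g s)) (𝓝 s₀) (𝓝 (s₀, g s₀)) :=
    (continuousAt_id.prodMk hg).tendsto
  have hD : ContinuousAt (fun s => (fderiv ℝ (fun p : ℝ × E => φ (K p.1 p.2)) (s, g s)).comp
      (ContinuousLinearMap.inr ℝ ℝ E)) s₀ := by
    have h1 : ContinuousAt (fderiv ℝ (fun p : ℝ × E => φ (K p.1 p.2))) (s₀, g s₀) :=
      (hφK.fderiv_right (m := 0) (by norm_num)).continuousAt
    exact (ContinuousAt.comp (f := fun s => (s, g s)) h1 hpt).clm_comp continuousAt_const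
  refine hD.congr ?_
  filter_upwards [hpt.eventually (hφK.eventually (by simp))] with s hs
  symm
  refine HasT.tder_eq (hasT_iff_chart.2 ⟨?_, ?_⟩)
  · exact hK.continuous.continuousAt.comp (f := fun z => (s, z)) (by fun_prop)
  · simp only [hb, extChartAt_model_space_eq_id, PartialEquiv.refl_symm, PartialEquiv.refl_coe, id]
    have h1 := (hs.differentiableAt (by norm_num)).hasFDerivAt
    have h2 : HasFDerivAt (fun z : E => (s, z)) (ContinuousLinearMap.inr ℝ ℝ E) (g s) :=
      hasFDerivAt_prodMk_right s (g s)
    exact h1.comp (g s) h2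

end Parameters

namespace SymmetricSpace

variable {E : Type*} [NormedAddCommGroup E] [NormedSpace ℝ E] [CompleteSpace E]
  {M : Type*} [TopologicalSpace M] [ChartedSpace E M] [IsManifold 𝓘(ℝ, E) ∞ M]
  (S : SymmetricSpace E M)

theorem contMDiff_tr (b : M) (x : E) : ContMDiff 𝓘(ℝ, E) 𝓘(ℝ, E) ∞ (S.tr b x) :=
  (S.contMDiff_mul_left _).comp (S.contMDiff_mul_left b)

theorem hasT_tr (b : M) (x : E) (y : M) :
    HasT (S.tr b x) y (tder (S.tr b x) y : E →L[ℝ] E) :=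
  HasT.of_mdifferentiableAt ((S.contMDiff_tr b x).mdifferentiable (by simp) y)

theorem contMDiff_tr₂ {F : Type*} [NormedAddCommGroup F] [NormedSpace ℝ F] {H : Type*}
    [TopologicalSpace H] {J : ModelWithCorners ℝ F H} {N : Type*} [TopologicalSpace N]
    [ChartedSpace H N] (b : M) {f : N → E} {g : N → M} (hf : ContMDiff J 𝓘(ℝ, E) 1 f)
    (hg : ContMDiff J 𝓘(ℝ, E) 1 g) : ContMDiff J 𝓘(ℝ, E) 1 (fun z => S.tr b (f z) (g z)) := by
  refine S.contMDiff_mul₂ (by simp) ?_ (S.contMDiff_mul₂ (by simp) contMDiff_const hg)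
  have h1 : ContMDiff 𝓘(ℝ, E) 𝓘(ℝ, E) 1 (fun v : E => (1 / 2 : ℝ) • v) :=
    (contDiff_const.smul contDiff_id).contMDiff
  exact (S.contMDiff_exp b).comp (h1.comp hf)

theorem sym_apply_of_map_mul {g : Equiv.Perm M}
    (hg : ∀ y z, g (S.mul y z) = S.mul (g y) (g z)) (x : M) : S.sym (g x) = g * S.sym x * g⁻¹ := by
  ext z
  simp [hg]

theorem tr_neg_smul (b : M) (x : E) (t : ℝ) : S.tr b ((-t) • x) = (S.tr b (t • x))⁻¹ := by
  rw [neg_smul, tr_neg]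

theorem sym_mul_tr (b : M) (x : E) : S.sym b * S.tr b x = (S.tr b x)⁻¹ * S.sym b := by
  rw [tr, mul_inv_rev, sym_inv, sym_inv, mul_assoc]

theorem tr_neg_smul_exp (b : M) (x : E) (t : ℝ) :
    S.tr b ((-t) • x) (S.exp b (t • x)) = b := by
  rw [tr_smul_exp]; simp

/-- The map `y ↦ τ₋ₜ (y · (b · e (t x)))`, where `τ` is the one-parameter group of translations
along the geodesic with velocity `x`. It fixes `b`. -/
noncomputable def jacobiMap (b : M) (x : E) (t : ℝ) (y : M) : M :=
  S.tr b ((-t) • x) (S.mul y (S.mul b (S.exp b (t • x))))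

@[simp] theorem jacobiMap_base (b : M) (x : E) (t : ℝ) : S.jacobiMap b x t b = b := by
  rw [jacobiMap, S.mul_mul_cancel, tr_neg_smul_exp]

theorem contMDiff_jacobiMap (b : M) (x : E) (t : ℝ) :
    ContMDiff 𝓘(ℝ, E) 𝓘(ℝ, E) ∞ (S.jacobiMap b x t) :=
  (S.contMDiff_tr b _).comp (S.contMDiff_mul_right _)

/-- The value at time `t` of the operator valued Jacobi field along the geodesic with velocity `x`
with initial value `1` and initial derivative `0`, in the parallel frame. -/
noncomputable def coshOp (b : M) (x : E) (t : ℝ) : E →L[ℝ] E :=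
  (1 / 2 : ℝ) • (tder (S.jacobiMap b x t) b : E →L[ℝ] E)

theorem hasT_jacobiMap (b : M) (x : E) (t : ℝ) :
    HasT (S.jacobiMap b x t) b ((2 : ℝ) • S.coshOp b x t) := by
  rw [coshOp, smul_smul]
  norm_num
  exact HasT.of_mdifferentiableAt ((S.contMDiff_jacobiMap b x t).mdifferentiable (by simp) b)

theorem coshOp_zero (b : M) (x : E) : S.coshOp b x 0 = ContinuousLinearMap.id ℝ E := by
  have h : S.jacobiMap b x 0 = fun y => S.mul y b := by
    ext y
    simp [jacobiMap, tr_zero, S.mul_self]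
  rw [coshOp, h, (S.hasT_mul_right b).tder_eq, smul_smul]
  norm_num

/-- The value at time `t` of the operator valued Jacobi field along the geodesic with velocity `x`
with initial value `0` and initial derivative `1`, in the parallel frame. -/
noncomputable def sinhOp (b : M) (x : E) (t : ℝ) : E →L[ℝ] E :=
  tder (fun z => S.tr b ((-t) • x) (S.exp b (t • z))) x

theorem hasT_sinhOp (b : M) (x : E) (t : ℝ) :
    HasT (fun z => S.tr b ((-t) • x) (S.exp b (t • z))) x (S.sinhOp b x t) := by
  refine HasT.of_mdifferentiableAt (ContMDiff.mdifferentiable (n := 1) ?_ (by simp) x)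
  refine ((S.contMDiff_tr b _).of_le (by simp)).comp ((S.contMDiff_exp b).comp ?_)
  exact (contDiff_const.smul contDiff_id).contMDiff

theorem sinhOp_zero (b : M) (x : E) : S.sinhOp b x 0 = 0 := by
  refine HasT.tder_eq ?_
  simp only [neg_zero, zero_smul, exp_zero]
  exact HasT.const x _

/-- Write J_s(y) = α(b) with the automorphism α = U⁻¹ σ_y σ_b U. Then σ_{α(b)} = α σ_b α⁻¹, so y
occurs twice in J_t(J_s(y)), once in α and once in α⁻¹. With the occurrences made independent as
G(y, y'), the partial maps G(·, b) and G(b, ·) are J_{t+s} and J_{t-s}. The chain rule on the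
diagonal gives the identity, as T_b J_r = 2C(r). -/
theorem coshOp_add_sub (b : M) (x : E) (t s : ℝ) :
    S.coshOp b x (t + s) + S.coshOp b x (t - s) = (2 : ℝ) • (S.coshOp b x t * S.coshOp b x s) := by
  set a := S.sym b with ha
  have haa : a * a = 1 := S.sym_mul_self b
  set T := S.tr b (t • x) with hT
  set U := S.tr b (s • x) with hU
  have hT' : S.tr b ((-t) • x) = T⁻¹ := S.tr_neg_smul b x t
  have hU' : S.tr b ((-s) • x) = U⁻¹ := S.tr_neg_smul b x s
  have haT : a * T = T⁻¹ * a := S.sym_mul_tr b _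
  have haU : a * U = U⁻¹ * a := S.sym_mul_tr b _
  have hTU : S.tr b ((t + s) • x) = T * U := S.tr_add_smul b x t s
  have hUT : S.tr b ((t + s) • x) = U * T := by rw [add_comm, S.tr_add_smul b x s t]
  have hTU' : S.tr b ((t - s) • x) = T * U⁻¹ := by
    rw [sub_eq_add_neg, S.tr_add_smul, hU']
  have hUT' : S.tr b ((t - s) • x) = U⁻¹ * T := by
    rw [sub_eq_add_neg, add_comm, S.tr_add_smul, hU']
  have hjac : ∀ r y, S.jacobiMap b x r y =
      ((S.tr b (r • x))⁻¹ * S.sym y * a * S.tr b (r • x)) b := fun r y => by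
    rw [jacobiMap, tr_neg_smul]
    simp only [Equiv.Perm.mul_apply, tr_apply_base]
    rfl
  let G : M × M → M := fun p =>
    (T⁻¹ * (U⁻¹ * S.sym p.1 * a * U) * a * (U⁻¹ * a * S.sym p.2 * U) * a * T) b
  have hG1 : ∀ y, G (y, b) = S.jacobiMap b x (t + s) y := fun y => by
    rw [hjac, hUT]
    have : T⁻¹ * (U⁻¹ * S.sym y * a * U) * a * (U⁻¹ * a * S.sym b * U) * a * T =
      (U * T)⁻¹ * S.sym y * a * (U * T) := by
      rw [← ha, mul_assoc U⁻¹ a a, haa, mul_one, inv_mul_cancel, mul_one, mul_assoc _ a a, haa,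
        mul_one, mul_inv_rev]
      simp only [mul_assoc]
    exact congrArg (fun g : Equiv.Perm M => g b) this
  have hG2 : ∀ y, G (b, y) = S.jacobiMap b x (t - s) y := fun y => by
    rw [hjac, hUT']
    have h1 : a * U⁻¹ * a = U := by
      rw [← mul_right_inj a, ← mul_assoc, ← mul_assoc, haa, one_mul, ← haU]
    have h2 : U * a = a * U⁻¹ := by
      rw [← h1, mul_assoc _ a a, haa, mul_one, h1]
    have : T⁻¹ * (U⁻¹ * S.sym b * a * U) * a * (U⁻¹ * a * S.sym y * U) * a * T =
      (U⁻¹ * T)⁻¹ * S.sym y * a * (U⁻¹ * T) := by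
      rw [← ha, mul_assoc U⁻¹ a a, haa, mul_one, inv_mul_cancel, mul_one, mul_inv_rev, inv_inv]
      calc T⁻¹ * a * (U⁻¹ * a * S.sym y * U) * a * T
          = T⁻¹ * (a * U⁻¹ * a) * S.sym y * (U * a) * T := by simp only [mul_assoc]
        _ = _ := by rw [h1, h2]; simp only [mul_assoc]
    exact congrArg (fun g : Equiv.Perm M => g b) this
  have hGd : ∀ y, S.jacobiMap b x t (S.jacobiMap b x s y) = G (y, y) := fun y => by
    rw [hjac, hjac s, ← hT, ← hU]
    set α : Equiv.Perm M := U⁻¹ * S.sym y * a * U with hα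
    have hαm : ∀ y z, α (S.mul y z) = S.mul (α y) (α z) := fun y z => by
      have h1 : ∀ y z, U⁻¹ (S.mul y z) = S.mul (U⁻¹ y) (U⁻¹ z) := by
        rw [← hU']; exact S.tr_map_mul b _
      simp only [hα, ha, Equiv.Perm.mul_apply, sym_apply]
      rw [hU, S.tr_map_mul, S.mul_distrib b, S.mul_distrib, ← hU, h1]
    have hαi : α⁻¹ = U⁻¹ * a * S.sym y * U := by
      simp only [hα, mul_inv_rev, inv_inv, sym_inv, mul_assoc, ha]
    rw [S.sym_apply_of_map_mul hαm, hαi]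
    simp only [G, ← ha, mul_assoc, hα]
  have hGs : ContMDiff (𝓘(ℝ, E).prod 𝓘(ℝ, E)) 𝓘(ℝ, E) ∞ G := by
    have hTs := S.contMDiff_tr b ((-t) • x)
    have hUs := S.contMDiff_tr b ((-s) • x)
    rw [hT'] at hTs
    rw [hU'] at hUs
    have hUs' := S.contMDiff_tr b (s • x)
    have has : ContMDiff 𝓘(ℝ, E) 𝓘(ℝ, E) ∞ a := S.contMDiff_mul_left b
    have h1 : ContMDiff (𝓘(ℝ, E).prod 𝓘(ℝ, E)) 𝓘(ℝ, E) ∞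
        (fun p : M × M => S.mul p.2 (U (a (T b)))) :=
      S.contMDiff_mul₂ le_rfl contMDiff_snd contMDiff_const
    have h2 := has.comp (hUs.comp (has.comp h1))
    have h3 : ContMDiff (𝓘(ℝ, E).prod 𝓘(ℝ, E)) 𝓘(ℝ, E) ∞
        (fun p : M × M => S.mul p.1 (a (U (a (U⁻¹ (a (S.mul p.2 (U (a (T b)))))))))) :=
      S.contMDiff_mul₂ le_rfl contMDiff_fst (has.comp (hUs'.comp h2))
    exact hTs.comp (hUs.comp h3)
  have h1 : HasT (fun y => G (y, b)) b ((2 : ℝ) • S.coshOp b x (t + s)) := by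
    simp only [hG1]; exact S.hasT_jacobiMap b x (t + s)
  have h2 : HasT (fun y => G (b, y)) b ((2 : ℝ) • S.coshOp b x (t - s)) := by
    simp only [hG2]; exact S.hasT_jacobiMap b x (t - s)
  have h3 := HasT.comp₂ (hGs.mdifferentiable (by simp) (b, b)) h1 h2 (HasT.id b) (HasT.id b) rfl rfl
  have h4 := (S.hasT_jacobiMap b x t).comp (S.hasT_jacobiMap b x s) (S.jacobiMap_base b x s)
  simp only [hGd] at h4
  have h5 := h4.unique h3
  ext v
  have h6 := congrArg (fun L : E →L[ℝ] E => (1 / 2 : ℝ) • L v) h5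
  change (1 / 2 : ℝ) • (2 : ℝ) • S.coshOp b x t ((2 : ℝ) • S.coshOp b x s v) =
    (1 / 2 : ℝ) • ((2 : ℝ) • S.coshOp b x (t + s) v + (2 : ℝ) • S.coshOp b x (t - s) v) at h6
  change S.coshOp b x (t + s) v + S.coshOp b x (t - s) v =
    (2 : ℝ) • S.coshOp b x t (S.coshOp b x s v)
  rw [map_smul] at h6
  calc S.coshOp b x (t + s) v + S.coshOp b x (t - s) v
      = (1 / 2 : ℝ) • ((2 : ℝ) • S.coshOp b x (t + s) v + (2 : ℝ) • S.coshOp b x (t - s) v) := by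
        module
    _ = _ := h6.symm
    _ = _ := by module

/-- Since exp((t+s)z) = exp(sz/2)·(b·exp(tz)), differentiating the two occurrences of z separately
gives S(t+s) = S(t) + (s/2) T K_s. The difference quotient is ½ T K_s at (s/2)x, which tends to ½ T
K_0 = C(t) by mere continuity, so `exp` need only be C¹. -/
theorem hasDerivAt_sinhOp (b : M) (x : E) (t : ℝ) :
    HasDerivAt (S.sinhOp b x) (S.coshOp b x t) t := by
  let K : ℝ → E → M := fun s z => S.tr b ((-(t + s)) • x) (S.mul (S.exp b z)
    (S.mul b (S.exp b (t • x))))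
  have hK : ContMDiff (𝓘(ℝ, ℝ).prod 𝓘(ℝ, E)) 𝓘(ℝ, E) 1 (fun p : ℝ × E => K p.1 p.2) := by
    refine S.contMDiff_tr₂ b ?_ (S.contMDiff_mul₂ (by simp) ?_ contMDiff_const)
    · have : ContMDiff 𝓘(ℝ, ℝ) 𝓘(ℝ, E) 1 (fun s : ℝ => (-(t + s)) • x) := by
        refine ContDiff.contMDiff ?_
        fun_prop
      exact this.comp contMDiff_fst
    · exact (S.contMDiff_exp b).comp contMDiff_snd
  let g : ℝ → E := fun s => (s / 2) • x
  have htrexp : ∀ (s : ℝ) z w, S.mul (S.exp b ((s / 2) • z)) (S.mul b w) = S.tr b (s • z) w := by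
    intro s z w
    rw [tr_apply, smul_smul]
    congr 3
    ring
  have hKg : ∀ s, K s (g s) = b := fun s => by
    simp only [K, g]
    rw [htrexp, tr_smul_exp, tr_smul_exp]
    rw [show -(t + s) + (s + t) = 0 by ring, zero_smul, exp_zero]
  have hcont := continuousAt_tder_of_contMDiff (g := g) (s₀ := 0) hK (by fun_prop) hKg
  have hK0 : (tder (K 0) (g 0) : E →L[ℝ] E) = (2 : ℝ) • S.coshOp b x t := by
    have h1 := (S.hasT_jacobiMap b x t).comp (S.hasT_exp_zero b) (S.exp_zero b)
    have : g 0 = 0 := by simp [g]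
    rw [this]
    refine HasT.tder_eq ?_
    simpa [K, jacobiMap] using h1
  have hS : ∀ s, S.sinhOp b x (t + s) = S.sinhOp b x t +
      (s / 2) • (tder (K s) (g s) : E →L[ℝ] E) := by
    intro s
    let G : E × E → M := fun p => S.tr b ((-(t + s)) • x)
      (S.mul (S.exp b ((s / 2) • p.1)) (S.mul b (S.exp b (t • p.2))))
    have hlin : ∀ r : ℝ, ContMDiff 𝓘(ℝ, E) 𝓘(ℝ, E) 1 (fun z : E => r • z) := fun r =>
      (contDiff_const.smul contDiff_id).contMDiff
    have hG : ContMDiff (𝓘(ℝ, E).prod 𝓘(ℝ, E)) 𝓘(ℝ, E) 1 G := by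
      refine ((S.contMDiff_tr b _).of_le (by simp)).comp ?_
      refine S.contMDiff_mul₂ (by simp) ((S.contMDiff_exp b).comp ((hlin _).comp contMDiff_fst))
        (S.contMDiff_mul₂ (by simp) contMDiff_const
          ((S.contMDiff_exp b).comp ((hlin _).comp contMDiff_snd)))
    have h1 : HasT (fun z => G (z, x)) x ((s / 2) • (tder (K s) (g s) : E →L[ℝ] E)) := by
      have h3 : HasT (K s) (g s) (tder (K s) (g s) : E →L[ℝ] E) := by
        refine HasT.of_mdifferentiableAt (ContMDiff.mdifferentiable (n := 1) ?_ (by simp) _)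
        refine ((S.contMDiff_tr b _).of_le (by simp)).comp ?_
        exact S.contMDiff_mul₂ (by simp) (S.contMDiff_exp b) contMDiff_const
      have h4 : HasT (fun z : E => (s / 2) • z) x ((s / 2) • ContinuousLinearMap.id ℝ E) :=
        hasT_iff_hasFDerivAt.2 ((hasFDerivAt_id x).const_smul (s / 2))
      have h5 := h3.comp h4 rfl
      rwa [ContinuousLinearMap.comp_smul, ContinuousLinearMap.comp_id] at h5
    have h2 : HasT (fun z => G (x, z)) x (S.sinhOp b x t) := by
      have : ∀ z, G (x, z) = S.tr b ((-t) • x) (S.exp b (t • z)) := fun z => by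
        simp only [G]
        rw [htrexp, ← Equiv.Perm.mul_apply, ← tr_add_smul]
        congr 3
        ring
      simp only [this]
      exact S.hasT_sinhOp b x t
    have h3 := HasT.comp₂ (hG.mdifferentiable (by simp) (x, x)) h1 h2 (HasT.id x) (HasT.id x) rfl rfl
    rw [ContinuousLinearMap.comp_id, ContinuousLinearMap.comp_id, add_comm] at h3
    refine (S.hasT_sinhOp b x (t + s)).unique ?_
    have : (fun z => S.tr b ((-(t + s)) • x) (S.exp b ((t + s) • z))) = fun z => G (z, z) := by
      ext z
      simp only [G]
      rw [htrexp, tr_smul_exp, add_comm s t]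
    rw [this]
    exact h3
  rw [hasDerivAt_iff_tendsto_slope_zero]
  have h1 : Tendsto (fun s => (1 / 2 : ℝ) • (tder (K s) (g s) : E →L[ℝ] E)) (𝓝[≠] 0)
      (𝓝 (S.coshOp b x t)) := by
    have := (hcont.tendsto.mono_left (nhdsWithin_le_nhds (s := {0}ᶜ))).const_smul (1 / 2 : ℝ)
    rw [hK0, smul_smul] at this
    norm_num at this
    simpa using this
  refine h1.congr' ?_
  filter_upwards [eventually_mem_nhdsWithin] with s hs
  rw [hS, add_sub_cancel_left, smul_smul]
  congr 1
  have : s ≠ 0 := hs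
  field_simp

end SymmetricSpace

/-! ### Vector fields and Lie brackets in charts. -/

section VectorFields

variable {E : Type*} [NormedAddCommGroup E] [NormedSpace ℝ E]
  {M : Type*} [TopologicalSpace M] [ChartedSpace E M]

theorem hasT_extChartAt_self (p : M) :
    HasT (extChartAt 𝓘(ℝ, E) p) p (ContinuousLinearMap.id ℝ E) := by
  refine hasT_iff_chart.2 ⟨continuousAt_extChartAt p, ?_⟩
  refine (hasFDerivAt_id _).congr_of_eventuallyEq ?_
  simp only [extChartAt_model_space_eq_id, PartialEquiv.refl_coe, id]
  exact eventually_extChartAt_right_inv (E := E) p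

theorem hasT_extChartAt_symm_self (p : M) :
    HasT (extChartAt 𝓘(ℝ, E) p).symm (extChartAt 𝓘(ℝ, E) p p) (ContinuousLinearMap.id ℝ E) := by
  refine hasT_iff_chart.2 ⟨continuousAt_extChartAt_symm p, ?_⟩
  refine (hasFDerivAt_id _).congr_of_eventuallyEq ?_
  simp only [extChartAt_model_space_eq_id, PartialEquiv.refl_coe, PartialEquiv.refl_symm, id,
    extChartAt_to_inv]
  exact eventually_extChartAt_right_inv (E := E) p

/-- The expression of a vector field in the chart around `p`. -/
noncomputable def chartField (p : M) (Z : M → E) (y : E) : E :=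
  (tder (extChartAt 𝓘(ℝ, E) p) ((extChartAt 𝓘(ℝ, E) p).symm y) : E →L[ℝ] E)
    (Z ((extChartAt 𝓘(ℝ, E) p).symm y))

theorem chartField_self (p : M) (Z : M → E) : chartField p Z (extChartAt 𝓘(ℝ, E) p p) = Z p := by
  rw [chartField, extChartAt_to_inv, (hasT_extChartAt_self p).tder_eq]
  rfl

variable [IsManifold 𝓘(ℝ, E) ∞ M]

theorem contMDiffAt_extChartAt_infty {p m : M} (h : m ∈ (extChartAt 𝓘(ℝ, E) p).source) :
    ContMDiffAt 𝓘(ℝ, E) 𝓘(ℝ, E) ∞ (extChartAt 𝓘(ℝ, E) p) m :=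
  contMDiffAt_extChartAt' (by simpa using h)

theorem contMDiffAt_extChartAt_symm_infty (p : M) :
    ContMDiffAt 𝓘(ℝ, E) 𝓘(ℝ, E) ∞ (extChartAt 𝓘(ℝ, E) p).symm (extChartAt 𝓘(ℝ, E) p p) :=
  (contMDiffOn_extChartAt_symm p).contMDiffAt (extChartAt_target_mem_nhds p)

theorem hasT_extChartAt {p m : M} (h : m ∈ (extChartAt 𝓘(ℝ, E) p).source) :
    HasT (extChartAt 𝓘(ℝ, E) p) m (tder (extChartAt 𝓘(ℝ, E) p) m : E →L[ℝ] E) :=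
  HasT.of_mdifferentiableAt ((contMDiffAt_extChartAt_infty h).mdifferentiableAt (by simp))

theorem mpullbackWithin_eq_chartField (p : M) (Z : (x : M) → TangentSpace 𝓘(ℝ, E) x) :
    VectorField.mpullbackWithin 𝓘(ℝ, E) 𝓘(ℝ, E) (extChartAt 𝓘(ℝ, E) p).symm Z
      (Set.range 𝓘(ℝ, E)) =ᶠ[𝓝 (extChartAt 𝓘(ℝ, E) p p)] chartField p Z := by
  have : IsManifold 𝓘(ℝ, E) 1 M := IsManifold.of_le (n := ∞) (by simp)
  filter_upwards [extChartAt_target_mem_nhds (I := 𝓘(ℝ, E)) p] with y hy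
  rw [VectorField.mpullbackWithin_apply, ContinuousLinearMap.inverse_eq
    (mfderivWithin_extChartAt_symm_comp_mfderiv_extChartAt hy)
    (mfderiv_extChartAt_comp_mfderivWithin_extChartAt_symm hy)]
  rfl

theorem mlieBracket_eq_chart (p : M) (V W : (x : M) → TangentSpace 𝓘(ℝ, E) x) :
    VectorField.mlieBracket 𝓘(ℝ, E) V W p =
      (fderiv ℝ (chartField p W) (extChartAt 𝓘(ℝ, E) p p) (V p) -
        fderiv ℝ (chartField p V) (extChartAt 𝓘(ℝ, E) p p) (W p) : E) := by
  rw [← VectorField.mlieBracketWithin_univ, VectorField.mlieBracketWithin_apply]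
  have h1 : mfderiv 𝓘(ℝ, E) 𝓘(ℝ, E) (extChartAt 𝓘(ℝ, E) p) p = ContinuousLinearMap.id ℝ E :=
    (hasT_extChartAt_self p).tder_eq
  rw [h1]
  erw [ContinuousLinearMap.inverse_id]
  have key : ∀ {V' W' : E → E} {s : Set E}, s = Set.univ →
      V' =ᶠ[𝓝 (extChartAt 𝓘(ℝ, E) p p)] chartField p V →
      W' =ᶠ[𝓝 (extChartAt 𝓘(ℝ, E) p p)] chartField p W →
      VectorField.lieBracketWithin ℝ V' W' s (extChartAt 𝓘(ℝ, E) p p) =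
        fderiv ℝ (chartField p W) (extChartAt 𝓘(ℝ, E) p p) (V p) -
        fderiv ℝ (chartField p V) (extChartAt 𝓘(ℝ, E) p p) (W p) := by
    rintro V' W' s rfl hV hW
    rw [VectorField.lieBracketWithin_univ, Filter.EventuallyEq.lieBracket_vectorField_eq hV hW,
      VectorField.lieBracket_eq]
    exact congrArg₂ (· - ·) (congrArg _ (chartField_self p V)) (congrArg _ (chartField_self p W))
  exact key (by simp) (mpullbackWithin_eq_chartField p V) (mpullbackWithin_eq_chartField p W)

theorem differentiableAt_chartField [CompleteSpace E] {p : M}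
    {Z : (x : M) → TangentSpace 𝓘(ℝ, E) x}
    (hZ : MDifferentiableAt 𝓘(ℝ, E) 𝓘(ℝ, E).tangent
      (fun x => (⟨x, Z x⟩ : TangentBundle 𝓘(ℝ, E) M)) p) :
    DifferentiableAt ℝ (chartField p Z) (extChartAt 𝓘(ℝ, E) p p) := by
  have : IsManifold 𝓘(ℝ, E) 2 M := IsManifold.of_le (n := ∞) (WithTop.coe_le_coe.2 (le_top : (2 : ℕ∞) ≤ ⊤))
  rw [← mdifferentiableWithinAt_univ] at hZ
  have h := hZ.differentiableWithinAt_mpullbackWithin_vectorField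
  have key : ∀ {V' : E → E} {s : Set E}, s = Set.univ →
      V' =ᶠ[𝓝 (extChartAt 𝓘(ℝ, E) p p)] chartField p Z →
      DifferentiableWithinAt ℝ V' s (extChartAt 𝓘(ℝ, E) p p) →
      DifferentiableAt ℝ (chartField p Z) (extChartAt 𝓘(ℝ, E) p p) := by
    rintro V' s rfl hV hd
    exact hV.differentiableAt_iff.1 (differentiableWithinAt_univ.1 hd)
  exact key (by simp) (mpullbackWithin_eq_chartField p Z) h

end VectorFields

/-! ### Translations and the Lie derivative. -/

namespace SymmetricSpace

variable {E : Type*} [NormedAddCommGroup E] [NormedSpace ℝ E] [CompleteSpace E]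
  {M : Type*} [TopologicalSpace M] [ChartedSpace E M] [IsManifold 𝓘(ℝ, E) ∞ M]
  (S : SymmetricSpace E M)

/-- The map `(a, m) ↦ a · (b · m)` in the charts around `b` and `p`. -/
noncomputable def chartMul (b p : M) (u : E × E) : E :=
  extChartAt 𝓘(ℝ, E) p (S.mul ((extChartAt 𝓘(ℝ, E) b).symm u.1)
    (S.mul b ((extChartAt 𝓘(ℝ, E) p).symm u.2)))

theorem contDiffAt_chartMul (b p : M) :
    ContDiffAt ℝ ∞ (S.chartMul b p) (extChartAt 𝓘(ℝ, E) b b, extChartAt 𝓘(ℝ, E) p p) := by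
  have h : ContMDiffAt (𝓘(ℝ, E).prod 𝓘(ℝ, E)) 𝓘(ℝ, E) ∞ (S.chartMul b p)
      (extChartAt 𝓘(ℝ, E) b b, extChartAt 𝓘(ℝ, E) p p) := by
    refine ContMDiffAt.comp (g := extChartAt 𝓘(ℝ, E) p) _ ?_ (S.contMDiffAt_mul₂ le_rfl
      (ContMDiffAt.comp (g := (extChartAt 𝓘(ℝ, E) b).symm) _ ?_ contMDiffAt_fst)
      (S.contMDiffAt_mul₂ le_rfl contMDiffAt_const
      (ContMDiffAt.comp (g := (extChartAt 𝓘(ℝ, E) p).symm) _ ?_ contMDiffAt_snd)))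
    · simp only [extChartAt_to_inv, S.mul_mul_cancel]
      exact contMDiffAt_extChartAt
    · exact contMDiffAt_extChartAt_symm_infty b
    · exact contMDiffAt_extChartAt_symm_infty p
  rwa [← modelWithCornersSelf_prod, chartedSpaceSelf_prod, contMDiffAt_iff_contDiffAt] at h

theorem chartMul_base (b p : M) :
    ∀ᶠ y in 𝓝 (extChartAt 𝓘(ℝ, E) p p), S.chartMul b p (extChartAt 𝓘(ℝ, E) b b, y) = y := by
  filter_upwards [eventually_extChartAt_right_inv (E := E) p] with y hy
  rw [chartMul, extChartAt_to_inv, S.mul_mul_cancel, hy]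

theorem field_apply (b x : M) (v : E) : S.field b v x =
    (1 / 2 : ℝ) • (tder (fun y => S.mul y (S.mul b x)) b : E →L[ℝ] E) v := rfl

theorem chartField_field (b p : M) :
    ∀ᶠ y in 𝓝 (extChartAt 𝓘(ℝ, E) p p), ∀ x : E, chartField p (S.field b x) y =
      (1 / 2 : ℝ) • fderiv ℝ (S.chartMul b p) (extChartAt 𝓘(ℝ, E) b b, y) (x, 0) := by
  have hc : Tendsto (fun y : E => (extChartAt 𝓘(ℝ, E) b b, y)) (𝓝 (extChartAt 𝓘(ℝ, E) p p))
    (𝓝 (extChartAt 𝓘(ℝ, E) b b, extChartAt 𝓘(ℝ, E) p p)) := by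
    exact (Continuous.prodMk_right _).tendsto _
  filter_upwards [extChartAt_target_mem_nhds (I := 𝓘(ℝ, E)) p,
    hc.eventually (((S.contDiffAt_chartMul b p).of_le (m := 1) (by simp)).eventually (by simp))]
    with y hy hd x
  set m := (extChartAt 𝓘(ℝ, E) p).symm y with hm
  have hms : m ∈ (extChartAt 𝓘(ℝ, E) p).source := (extChartAt 𝓘(ℝ, E) p).map_target hy
  have h1 : HasT (fun z => S.mul z (S.mul b m)) b
      (tder (fun z => S.mul z (S.mul b m)) b : E →L[ℝ] E) :=
    HasT.of_mdifferentiableAt ((S.contMDiff_mul_right _).mdifferentiable (by simp) b)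
  have h2 := (hasT_extChartAt hms).comp (h1.comp (hasT_extChartAt_symm_self b)
    (extChartAt_to_inv b)) (by rw [extChartAt_to_inv, S.mul_mul_cancel])
  rw [hasT_iff_hasFDerivAt] at h2
  have h3 : HasFDerivAt (fun u => S.chartMul b p (u, y)) ((fderiv ℝ (S.chartMul b p)
      (extChartAt 𝓘(ℝ, E) b b, y)).comp (ContinuousLinearMap.inl ℝ E E))
      (extChartAt 𝓘(ℝ, E) b b) :=
    (hd.differentiableAt (by simp)).hasFDerivAt.comp (f := fun e => (e, y))
      (extChartAt 𝓘(ℝ, E) b b) (hasFDerivAt_prodMk_left _ y)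
  have h4 := congrArg (fun L : E →L[ℝ] E => L x) (h2.unique h3)
  change (tder (extChartAt 𝓘(ℝ, E) p) m : E →L[ℝ] E) (S.field b x m) = _
  rw [field_apply, map_smul]
  exact congrArg ((1 / 2 : ℝ) • ·) h4

/-- In charts `tr b ((-h) • x)` is y ↦ N(α(h), y), so the function is ∂₂N(α(h), β(h)) Z(β(h)), where
β(h) represents the moved point. As N(a₀, y) = y, at h = 0 the operator ∂₂N is 1 and the second
y-derivative of N vanishes. There remain DZ·X from β and, by symmetry of second derivatives, -DX·Z
from α, since X = ½∂₁N represents ξ_x; this is the bracket. -/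
theorem hasDerivAt_tder_tr (b p : M) (x : E) {Z : (x : M) → TangentSpace 𝓘(ℝ, E) x}
    (hZ : DifferentiableAt ℝ (chartField p Z) (extChartAt 𝓘(ℝ, E) p p)) :
    HasDerivAt (fun h : ℝ => (tder (S.tr b ((-h) • x)) (S.tr b (h • x) p) : E →L[ℝ] E)
      (Z (S.tr b (h • x) p)))
      (VectorField.mlieBracket 𝓘(ℝ, E) (S.field b x) Z p : E) 0 := by
  set a₀ := extChartAt 𝓘(ℝ, E) b b with ha₀
  set q := extChartAt 𝓘(ℝ, E) p p with hq
  set N := S.chartMul b p with hN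
  set α : ℝ → E := fun h => extChartAt 𝓘(ℝ, E) b (S.exp b ((-(h / 2)) • x)) with hα
  set β : ℝ → E := fun h => extChartAt 𝓘(ℝ, E) p (S.tr b (h • x) p) with hβ
  have hNs : ContDiffAt ℝ ∞ N (a₀, q) := S.contDiffAt_chartMul b p
  have hN1 : HasFDerivAt N (fderiv ℝ N (a₀, q)) (a₀, q) :=
    (hNs.differentiableAt (by simp)).hasFDerivAt
  have hα0 : α 0 = a₀ := by simp [hα, ha₀]
  have hαd : ∀ c : ℝ, HasDerivAt (fun h : ℝ => extChartAt 𝓘(ℝ, E) b (S.exp b ((c * h) • x)))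
      (c • x) 0 := fun c => by
    have h1 := (hasT_extChartAt_self b).comp (S.hasT_exp_zero b) (S.exp_zero b)
    rw [hasT_iff_hasFDerivAt] at h1
    have h2 : HasDerivAt (fun h : ℝ => (c * h) • x) (c • x) 0 := by
      simpa using ((hasDerivAt_id (0 : ℝ)).const_mul c).smul_const x
    have h3 := HasFDerivAt.comp_hasDerivAt_of_eq (0 : ℝ) h1 h2 (by simp)
    rwa [ContinuousLinearMap.comp_id, ContinuousLinearMap.id_apply] at h3
  have hα1 : HasDerivAt α (-((1 / 2 : ℝ) • x)) 0 := by
    have := hαd (-(1 / 2))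
    simp only [neg_smul] at this
    convert this using 2
    simp only [hα]
    congr 3
    ring_nf
  have hβ0 : β 0 = q := by simp [hβ, hq, tr_zero]
  have hexp : ∀ c : ℝ, ∀ᶠ h : ℝ in 𝓝 0, (extChartAt 𝓘(ℝ, E) b).symm (extChartAt 𝓘(ℝ, E) b
      (S.exp b ((c * h) • x))) = S.exp b ((c * h) • x) := fun c => by
    have h1 : Continuous fun h : ℝ => S.exp b ((c * h) • x) :=
      (S.continuous_exp b).comp (by fun_prop)
    have h2 := h1.tendsto 0
    simp only [mul_zero, zero_smul, exp_zero] at h2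
    exact h2.eventually (eventually_extChartAt_left_inv (E := E) b)
  have hβN : ∀ᶠ h in 𝓝 0, β h = N (extChartAt 𝓘(ℝ, E) b (S.exp b (((1 / 2 : ℝ) * h) • x)), q) := by
    filter_upwards [hexp (1 / 2)] with h hh
    rw [hN, chartMul, hh, hq, extChartAt_to_inv, hβ]
    simp only [tr_apply, smul_smul]
  have hβ1 : HasDerivAt β ((1 / 2 : ℝ) • fderiv ℝ N (a₀, q) (x, 0)) 0 := by
    have h1 : HasDerivAt (fun h : ℝ => (extChartAt 𝓘(ℝ, E) b (S.exp b (((1 / 2 : ℝ) * h) • x)), q))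
        ((1 / 2 : ℝ) • x, 0) 0 := (hαd (1 / 2)).prodMk (hasDerivAt_const 0 q)
    have h2 := HasFDerivAt.comp_hasDerivAt_of_eq (0 : ℝ) hN1 h1 (by simp [ha₀])
    refine (h2.congr_of_eventuallyEq hβN).congr_deriv ?_
    rw [← map_smul, Prod.smul_mk, smul_zero]
  have htr : ∀ᶠ h in 𝓝 (0 : ℝ), (tder (S.tr b ((-h) • x)) (S.tr b (h • x) p) : E →L[ℝ] E)
      (Z (S.tr b (h • x) p)) = fderiv ℝ N (α h, β h) (0, chartField p Z (β h)) := by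
    have hβc : Tendsto (fun h : ℝ => S.tr b (h • x) p) (𝓝 0) (𝓝 p) := by
      have h1 : Continuous (fun h : ℝ => S.tr b (h • x) p) :=
        S.continuous_tr b (by fun_prop) continuous_const
      simpa [tr_zero] using h1.tendsto 0
    have hαβ : Tendsto (fun h => (α h, β h)) (𝓝 0) (𝓝 (a₀, q)) := by
      have := (hα1.continuousAt.prodMk hβ1.continuousAt).tendsto
      rwa [hα0, hβ0] at this
    filter_upwards [hexp (-(1 / 2)), hβc.eventually (extChartAt_source_mem_nhds (I := 𝓘(ℝ, E)) p),
      hαβ.eventually ((hNs.of_le (m := 1) (by simp)).eventually (by simp))] with h h1 h2 h3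
    set m := S.tr b (h • x) p with hm
    have h4 : S.tr b ((-h) • x) m = p := by
      rw [hm, tr_neg_smul, Equiv.Perm.inv_def, Equiv.symm_apply_apply]
    have h5 := (hasT_extChartAt_self p).comp (S.hasT_tr b ((-h) • x) m) h4
    have h6 : HasFDerivAt (fun y => N (α h, y)) ((fderiv ℝ N (α h, β h)).comp
        (ContinuousLinearMap.inr ℝ E E)) (β h) :=
      (h3.differentiableAt (by simp)).hasFDerivAt.comp _ (hasFDerivAt_prodMk_right _ _)
    have h7 := (hasT_iff_hasFDerivAt.2 h6).comp (hasT_extChartAt h2) rfl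
    have h8 : (fun z => N (α h, extChartAt 𝓘(ℝ, E) p z)) =ᶠ[𝓝 m]
        fun z => extChartAt 𝓘(ℝ, E) p (S.tr b ((-h) • x) z) := by
      filter_upwards [(isOpen_extChartAt_source p).mem_nhds h2] with z hz
      have h9 : α h = extChartAt 𝓘(ℝ, E) b (S.exp b ((-(1 / 2) * h) • x)) := by
        simp only [hα]; congr 3; ring
      rw [hN, chartMul, h9, h1, (extChartAt 𝓘(ℝ, E) p).left_inv hz, tr_apply, smul_smul]
      congr 4; ring
    rw [ContinuousLinearMap.id_comp] at h5
    rw [h5.unique (h7.congr h8.symm)]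
    change fderiv ℝ N (α h, β h) (0, (tder (extChartAt 𝓘(ℝ, E) p) m : E →L[ℝ] E) (Z m)) = _
    have h10 : (extChartAt 𝓘(ℝ, E) p).symm (β h) = m := (extChartAt 𝓘(ℝ, E) p).left_inv h2
    exact congrArg (fun z => fderiv ℝ N (α h, β h)
      (0, (tder (extChartAt 𝓘(ℝ, E) p) z : E →L[ℝ] E) (Z z))) h10.symm
  have hD : HasFDerivAt (fderiv ℝ N) (fderiv ℝ (fderiv ℝ N) (a₀, q)) (a₀, q) :=
    ((hNs.fderiv_right (m := 1) (by norm_cast)).differentiableAt (by simp)).hasFDerivAt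
  have hsymm : ∀ u v, fderiv ℝ (fderiv ℝ N) (a₀, q) u v = fderiv ℝ (fderiv ℝ N) (a₀, q) v u :=
    hNs.isSymmSndFDerivAt (by simpa using (WithTop.coe_le_coe.2 (le_top : (2 : ℕ∞) ≤ ⊤)))
  have hid : ∀ᶠ y in 𝓝 q, ∀ w, fderiv ℝ N (a₀, y) (0, w) = w := by
    have hc : Tendsto (fun y : E => (a₀, y)) (𝓝 q) (𝓝 (a₀, q)) :=
      (Continuous.prodMk_right _).tendsto _
    filter_upwards [(S.chartMul_base b p).eventually_nhds,
      hc.eventually ((hNs.of_le (m := 1) (by simp)).eventually (by simp))] with y h1 h2 w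
    have h6 : HasFDerivAt (fun y => N (a₀, y)) ((fderiv ℝ N (a₀, y)).comp
        (ContinuousLinearMap.inr ℝ E E)) y :=
      (h2.differentiableAt (by simp)).hasFDerivAt.comp _ (hasFDerivAt_prodMk_right _ _)
    have h7 := h6.unique ((hasFDerivAt_id y).congr_of_eventuallyEq h1)
    exact congrArg (fun L : E →L[ℝ] E => L w) h7
  have hX : HasFDerivAt (chartField p (S.field b x)) ((1 / 2 : ℝ) •
      ((ContinuousLinearMap.apply ℝ E ((x, 0) : E × E)).comp (fderiv ℝ (fderiv ℝ N) (a₀, q))).comp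
      (ContinuousLinearMap.inr ℝ E E)) q := by
    refine HasFDerivAt.congr_of_eventuallyEq ?_
      ((S.chartField_field b p).mono fun y h => h x)
    refine HasFDerivAt.const_smul ?_ _
    have h1 : HasFDerivAt (fun y => fderiv ℝ N (a₀, y)) _ q :=
      hD.comp q (hasFDerivAt_prodMk_right a₀ q)
    exact (ContinuousLinearMap.apply ℝ E ((x, 0) : E × E)).hasFDerivAt.comp q h1
  have hmain : HasDerivAt (fun h => fderiv ℝ N (α h, β h) (0, chartField p Z (β h)))
      (fderiv ℝ (fderiv ℝ N) (a₀, q) (-((1 / 2 : ℝ) • x), (1 / 2 : ℝ) • fderiv ℝ N (a₀, q) (x, 0))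
        (0, Z p) + fderiv ℝ N (a₀, q) (0, fderiv ℝ (chartField p Z) q
        ((1 / 2 : ℝ) • fderiv ℝ N (a₀, q) (x, 0)))) 0 := by
    have h1 : HasDerivAt (fun h => fderiv ℝ N (α h, β h)) _ 0 :=
      HasFDerivAt.comp_hasDerivAt_of_eq (0 : ℝ) hD (hα1.prodMk hβ1) (by simp only [hα0, hβ0])
    have h2 : HasDerivAt (fun h => ((0 : E), chartField p Z (β h))) _ 0 :=
      (hasDerivAt_const 0 (0 : E)).prodMk
        (HasFDerivAt.comp_hasDerivAt_of_eq (0 : ℝ) hZ.hasFDerivAt hβ1 hβ0.symm)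
    have h3 := h1.clm_apply h2
    simp only [hα0, hβ0] at h3
    rw [← chartField_self p Z]
    exact h3
  refine (hmain.congr_of_eventuallyEq htr).congr_deriv ?_
  rw [mlieBracket_eq_chart, hX.fderiv, ← chartField_self p (S.field b x)]
  have hXq := (S.chartField_field b p).self_of_nhds x
  rw [hXq, hid.self_of_nhds]
  -- The pure second derivative in y vanishes because N(a₀, ·) is the identity near q.
  have h1 : fderiv ℝ (fderiv ℝ N) (a₀, q) (0, Z p) (0, (1 / 2 : ℝ) • fderiv ℝ N (a₀, q) (x, 0))
      = 0 := by
    have hc : HasFDerivAt (fun y => fderiv ℝ N (a₀, y)) _ q :=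
      hD.comp q (hasFDerivAt_prodMk_right a₀ q)
    have h2 := (ContinuousLinearMap.apply ℝ E
      ((0, (1 / 2 : ℝ) • fderiv ℝ N (a₀, q) (x, 0)) : E × E)).hasFDerivAt.comp q hc
    have h3 := h2.unique ((hasFDerivAt_const _ q).congr_of_eventuallyEq (hid.mono fun y hy => hy _))
    exact congrArg (fun L : E →L[ℝ] E => L (Z p)) h3
  have h2 : ((-((1 / 2 : ℝ) • x), (1 / 2 : ℝ) • fderiv ℝ N (a₀, q) (x, 0)) : E × E) =
      -((1 / 2 : ℝ) • ((x, 0) : E × E)) + (0, (1 / 2 : ℝ) • fderiv ℝ N (a₀, q) (x, 0)) := by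
    simp
  rw [hsymm, h2, map_add, map_neg, map_smul, h1, add_zero, sub_eq_add_neg, add_comm]
  rfl

end SymmetricSpace

/-! ### The Jacobi equation and the triple product. -/

namespace SymmetricSpace

variable {E : Type*} [NormedAddCommGroup E] [NormedSpace ℝ E] [CompleteSpace E]
  {M : Type*} [TopologicalSpace M] [ChartedSpace E M] [IsManifold 𝓘(ℝ, E) ∞ M]
  (S : SymmetricSpace E M)

/-- The field is the tangent map of (y, x) ↦ y·(b·x) applied to the smooth section x ↦ (½v at b, 0
at x). -/
theorem contMDiff_field (b : M) (v : E) :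
    ContMDiff 𝓘(ℝ, E) 𝓘(ℝ, E).tangent ∞
      (fun x => (⟨x, S.field b v x⟩ : TangentBundle 𝓘(ℝ, E) M)) := by
  let G : M × M → M := fun p => S.mul p.1 (S.mul b p.2)
  have hG : ContMDiff (𝓘(ℝ, E).prod 𝓘(ℝ, E)) 𝓘(ℝ, E) ∞ G :=
    S.contMDiff_mul₂ le_rfl contMDiff_fst (S.contMDiff_mul₂ le_rfl contMDiff_const contMDiff_snd)
  have h1 : ContMDiff 𝓘(ℝ, E) (𝓘(ℝ, E).tangent.prod 𝓘(ℝ, E).tangent) ∞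
      (fun x : M => ((⟨b, ((1 / 2 : ℝ) • v : E)⟩ : TangentBundle 𝓘(ℝ, E) M),
        (⟨x, (0 : E)⟩ : TangentBundle 𝓘(ℝ, E) M))) :=
    contMDiff_const.prodMk (Bundle.contMDiff_zeroSection ℝ (TangentSpace 𝓘(ℝ, E)))
  have h2 := (hG.contMDiff_tangentMap (m := ∞) (by simp)).comp
    (contMDiff_equivTangentBundleProd_symm.comp h1)
  have heq : ∀ (x y : M) (_ : x = y) (L L' : E) (_ : L = L'), (⟨x, L⟩ : TangentBundle 𝓘(ℝ, E) M) = ⟨y, L'⟩ := by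
    rintro _ _ rfl _ _ rfl; rfl
  refine h2.congr fun x => ?_
  refine heq _ _ (S.mul_mul_cancel b x).symm _ _ ?_
  let D : E × E →L[ℝ] E := mfderiv (𝓘(ℝ, E).prod 𝓘(ℝ, E)) 𝓘(ℝ, E) G (b, x)
  have hD : HasMFDerivAt (𝓘(ℝ, E).prod 𝓘(ℝ, E)) 𝓘(ℝ, E) G (b, x) D :=
    (hG.mdifferentiable (by simp) (b, x)).hasMFDerivAt
  have h3 : HasT (fun y => G (y, x)) b
      (D.comp ((ContinuousLinearMap.id ℝ E).prod (0 : E →L[ℝ] E))) :=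
    HasMFDerivAt.comp (f := fun y => (y, x)) b hD
      (HasMFDerivAt.prodMk (hasMFDerivAt_id b) (hasMFDerivAt_const x b))
  rw [field_apply, ← map_smul]
  exact congrArg (fun L : E →L[ℝ] E => L ((1 / 2 : ℝ) • v)) h3.tder_eq

theorem coshOp_apply (b : M) (x : E) (s : ℝ) (v : E) : S.coshOp b x s v =
    (tder (S.tr b ((-s) • x)) (S.exp b (s • x)) : E →L[ℝ] E) (S.field b v (S.exp b (s • x))) := by
  have h1 : HasT (fun y => S.mul y (S.mul b (S.exp b (s • x)))) b _ :=
    HasT.of_mdifferentiableAt ((S.contMDiff_mul_right _).mdifferentiable (by simp) b)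
  have h2 := (S.hasT_tr b ((-s) • x) (S.exp b (s • x))).comp h1 (S.mul_mul_cancel _ _)
  rw [coshOp, field_apply, map_smul]
  exact congrArg (fun L : E →L[ℝ] E => (1 / 2 : ℝ) • L v) h2.tder_eq

/-- The group law reduces the derivative at s to the derivative at 0 based at the point exp(sx). -/
theorem hasDerivAt_tder_tr_exp (b : M) (x : E) {Z : (x : M) → TangentSpace 𝓘(ℝ, E) x}
    (hZ : MDifferentiable 𝓘(ℝ, E) 𝓘(ℝ, E).tangent
      (fun x => (⟨x, Z x⟩ : TangentBundle 𝓘(ℝ, E) M))) (s : ℝ) :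
    HasDerivAt (fun s : ℝ => (tder (S.tr b ((-s) • x)) (S.exp b (s • x)) : E →L[ℝ] E)
        (Z (S.exp b (s • x))))
      ((tder (S.tr b ((-s) • x)) (S.exp b (s • x)) : E →L[ℝ] E)
        (VectorField.mlieBracket 𝓘(ℝ, E) (S.field b x) Z (S.exp b (s • x)))) s := by
  have h1 := S.hasDerivAt_tder_tr b (S.exp b (s • x)) x (differentiableAt_chartField (hZ _))
  have h2 := (tder (S.tr b ((-s) • x)) (S.exp b (s • x)) : E →L[ℝ] E).hasFDerivAt.comp_hasDerivAt
    (0 : ℝ) h1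
  have h3 := HasDerivAt.comp_sub_const s s (by rwa [sub_self])
  refine h3.congr_of_eventuallyEq (Eventually.of_forall fun r => ?_)
  have h4 : S.tr b ((r - s) • x) (S.exp b (s • x)) = S.exp b (r • x) := by
    rw [tr_smul_exp, sub_add_cancel]
  have h5 : S.tr b ((-(r - s)) • x) (S.exp b (r • x)) = S.exp b (s • x) := by
    rw [tr_smul_exp]; congr 2; ring
  have h6 := (S.hasT_tr b ((-s) • x) (S.exp b (s • x))).comp
    (S.hasT_tr b ((-(r - s)) • x) (S.exp b (r • x))) h5
  have h7 : (fun z => S.tr b ((-s) • x) (S.tr b ((-(r - s)) • x) z)) = S.tr b ((-r) • x) := by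
    ext z
    rw [← Equiv.Perm.mul_apply, ← tr_add_smul]
    congr 3; ring
  rw [h7] at h6
  have h8 : (tder (S.tr b ((-r) • x)) (S.exp b (r • x)) : E →L[ℝ] E) (Z (S.exp b (r • x))) =
      (tder (S.tr b ((-s) • x)) (S.exp b (s • x)) : E →L[ℝ] E)
        ((tder (S.tr b ((-(r - s)) • x)) (S.exp b (r • x)) : E →L[ℝ] E) (Z (S.exp b (r • x)))) :=
    congrArg (fun L : E →L[ℝ] E => L (Z (S.exp b (r • x)))) h6.tder_eq
  refine h8.trans ?_
  exact congrArg (fun z => (tder (S.tr b ((-s) • x)) (S.exp b (s • x)) : E →L[ℝ] E)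
    ((tder (S.tr b ((-(r - s)) • x)) z : E →L[ℝ] E) (Z z))) h4.symm

/-- The operator valued Jacobi equation. -/
theorem exists_deriv_coshOp (b : M) (x : E) : ∃ (C' : ℝ → E →L[ℝ] E) (Q : E →L[ℝ] E),
    (∀ t, HasDerivAt (S.coshOp b x) (C' t) t) ∧ C' 0 = 0 ∧
    (∀ t, HasDerivAt C' ((S.coshOp b x t).comp Q) t) ∧ ∀ v, Q v = -(S.triple b x v x : E) := by
  obtain ⟨C', Q, h1, h2, h3⟩ := exists_second_derivative_of_dAlembert (S.coshOp_zero b x)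
    (S.sinhOp_zero b x) (S.hasDerivAt_sinhOp b x) (S.coshOp_add_sub b x)
  refine ⟨C', Q, h1, h2, h3, fun v => ?_⟩
  have : IsManifold 𝓘(ℝ, E) ((2 : ℕ∞) + 1) M :=
    IsManifold.of_le (n := ∞) (WithTop.coe_le_coe.2 (le_top : (3 : ℕ∞) ≤ ⊤))
  have : IsManifold 𝓘(ℝ, E) (minSmoothness ℝ 2) M := by
    simp only [minSmoothness_of_isRCLikeNormedField]
    exact IsManifold.of_le (n := ∞) (WithTop.coe_le_coe.2 (le_top : (2 : ℕ∞) ≤ ⊤))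
  have hf : ∀ v, MDifferentiable 𝓘(ℝ, E) 𝓘(ℝ, E).tangent
      (fun x => (⟨x, S.field b v x⟩ : TangentBundle 𝓘(ℝ, E) M)) := fun v =>
    (S.contMDiff_field b v).mdifferentiable (by simp)
  have hf2 : ∀ v, ContMDiff 𝓘(ℝ, E) 𝓘(ℝ, E).tangent (2 : ℕ∞)
      (fun x => (⟨x, S.field b v x⟩ : TangentBundle 𝓘(ℝ, E) M)) := fun v =>
    (S.contMDiff_field b v).of_le (WithTop.coe_le_coe.2 (le_top : (2 : ℕ∞) ≤ ⊤))
  have hbr : MDifferentiable 𝓘(ℝ, E) 𝓘(ℝ, E).tangent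
      (fun y => (⟨y, VectorField.mlieBracket 𝓘(ℝ, E) (S.field b x) (S.field b v) y⟩ :
        TangentBundle 𝓘(ℝ, E) M)) :=
    (ContDiff.mlieBracket_vectorField (m := 1) (hf2 x) (hf2 v) (by simp; norm_num)).mdifferentiable
      (by simp)
  have h4 : ∀ s, HasDerivAt (fun s => S.coshOp b x s v) _ s := fun s =>
    (S.hasDerivAt_tder_tr_exp b x (hf v) s).congr_of_eventuallyEq
      (Eventually.of_forall fun s => S.coshOp_apply b x s v)
  have hcl : ∀ {F : ℝ → E →L[ℝ] E} {L : E →L[ℝ] E} {s : ℝ}, HasDerivAt F L s →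
      HasDerivAt (fun s => F s v) (L v) s := fun h => by
    simpa using h.clm_apply (hasDerivAt_const _ v)
  -- C(s)v is ξ_v pulled back along the geodesic, so C'(s)v is the pulled back [ξ_x, ξ_v]; a second
  -- derivative at 0 gives [ξ_x, [ξ_x, ξ_v]](b).
  have h5 : ∀ s, C' s v = _ := fun s => (hcl (h1 s)).unique (h4 s)
  have h6 := (S.hasDerivAt_tder_tr_exp b x hbr 0).congr_of_eventuallyEq (Eventually.of_forall h5)
  have h7 := (hcl (h3 0)).unique h6
  rw [coshOp_zero] at h7
  have h8 : (tder (S.tr b ((-0 : ℝ) • x)) b : E →L[ℝ] E) = ContinuousLinearMap.id ℝ E := by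
    simp only [neg_zero, zero_smul, tr_zero]
    exact (HasT.id b).tder_eq
  have h9 : S.exp b ((0 : ℝ) • x) = b := by rw [zero_smul, exp_zero]
  refine (show Q v = _ from h7).trans ((congrArg (fun z => (tder (S.tr b ((-0 : ℝ) • x)) z : E →L[ℝ] E)
    (VectorField.mlieBracket 𝓘(ℝ, E) (S.field b x) (VectorField.mlieBracket 𝓘(ℝ, E)
      (S.field b x) (S.field b v)) z)) h9).trans ?_)
  refine (congrArg (fun L : E →L[ℝ] E => L (VectorField.mlieBracket 𝓘(ℝ, E) (S.field b x)
    (VectorField.mlieBracket 𝓘(ℝ, E) (S.field b x) (S.field b v)) b)) h8).trans ?_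
  -- The triple product has the double bracket in its first slot, hence the minus sign.
  exact VectorField.mlieBracket_swap_apply

end SymmetricSpace

/-! ### Linear maps that intertwine Jacobi operators. -/

namespace SymmetricSpace

variable {E : Type*} [NormedAddCommGroup E] [NormedSpace ℝ E] [CompleteSpace E]
  {M : Type*} [TopologicalSpace M] [ChartedSpace E M] [IsManifold 𝓘(ℝ, E) ∞ M]
  {E' : Type*} [NormedAddCommGroup E'] [NormedSpace ℝ E'] [CompleteSpace E']
  {M' : Type*} [TopologicalSpace M'] [ChartedSpace E' M'] [IsManifold 𝓘(ℝ, E') ∞ M']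
  {E'' : Type*} [NormedAddCommGroup E''] [NormedSpace ℝ E''] [CompleteSpace E'']
  {M'' : Type*} [TopologicalSpace M''] [ChartedSpace E'' M''] [IsManifold 𝓘(ℝ, E'') ∞ M'']
  {S : SymmetricSpace E M} {S' : SymmetricSpace E' M'} {S'' : SymmetricSpace E'' M''}

variable (S S') in
/-- The linear map `T : T_x M → T_y M'` intertwines the Jacobi fields along all geodesics through
`x` with those along their images. -/
def Compat (x : M) (y : M') (T : E →L[ℝ] E') : Prop :=
  ∀ v t, T.comp (S.coshOp x v t) = (S'.coshOp y (T v) t).comp T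

theorem Compat.comp {x : M} {y : M'} {z : M''} {T : E →L[ℝ] E'} {T' : E' →L[ℝ] E''}
    (h' : Compat S' S'' y z T') (h : Compat S S' x y T) : Compat S S'' x z (T'.comp T) := by
  intro v t
  rw [ContinuousLinearMap.comp_assoc, h, ← ContinuousLinearMap.comp_assoc, h',
    ContinuousLinearMap.comp_assoc]
  rfl

/-- A multiplicative map conjugates `jacobiMap` into `jacobiMap`; differentiate at the base point.
-/
theorem compat_of_map_mul {f : M → M'} (hf : ∀ x y, f (S.mul x y) = S'.mul (f x) (f y)) {x : M}
    {L : E →L[ℝ] E'} (hL : HasT f x L) : Compat S S' x (f x) L := by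
  intro v t
  have h1 := hL.comp (S.hasT_jacobiMap x v t) (S.jacobiMap_base x v t)
  have h2 := (S'.hasT_jacobiMap (f x) (L v) t).comp hL rfl
  have h3 : (fun z => f (S.jacobiMap x v t z)) = fun z => S'.jacobiMap (f x) (L v) t (f z) := by
    ext z
    rw [jacobiMap, jacobiMap, map_tr hf hL, hf, hf, map_exp hf hL, map_smul, map_smul]
  rw [h3] at h1
  have h4 := h1.unique h2
  rw [ContinuousLinearMap.comp_smul, ContinuousLinearMap.smul_comp] at h4
  exact smul_right_injective _ (two_ne_zero (α := ℝ)) h4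

theorem compat_tr (b : M) (v : E) (x : M) :
    Compat S S x (S.tr b v x) (tder (S.tr b v) x : E →L[ℝ] E) :=
  compat_of_map_mul (S.tr_map_mul b v) (S.hasT_tr b v x)

/-- The difference w of the two sides satisfies w'' = w ∘ Q₁ with zero initial data. Only the
products [v, u, v] enter, through Q₂ ∘ A = A ∘ Q₁. -/
theorem IsLtsHom.compat {x : M} {y : M'} {A : E →L[ℝ] E'} (hA : IsLtsHom S x S' y A) :
    Compat S S' x y A := by
  intro v t
  obtain ⟨C₁, Q₁, h1, h10, h1', hQ1⟩ := S.exists_deriv_coshOp x v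
  obtain ⟨C₂, Q₂, h2, h20, h2', hQ2⟩ := S'.exists_deriv_coshOp y (A v)
  have hQ : Q₂.comp A = A.comp Q₁ := by
    ext u
    have h := hA v u v
    rw [ContinuousLinearMap.comp_apply, ContinuousLinearMap.comp_apply, hQ1, hQ2]
    exact (congrArg Neg.neg h.symm).trans (A.map_neg _).symm
  rw [← sub_eq_zero]
  have hcomp : ∀ {F : ℝ → E →L[ℝ] E} {G : ℝ → E' →L[ℝ] E'} {F' G' t}, HasDerivAt F F' t →
      HasDerivAt G G' t → HasDerivAt (fun t => A.comp (F t) - (G t).comp A)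
      (A.comp F' - G'.comp A) t := fun hF hG =>
    ((ContinuousLinearMap.compL ℝ E E E' A).hasFDerivAt.comp_hasDerivAt _ hF).sub
      (((ContinuousLinearMap.compL ℝ E E' E').flip A).hasFDerivAt.comp_hasDerivAt _ hG)
  refine eq_zero_of_second_derivative_eq_comp (Q := Q₁) (fun t => hcomp (h1 t) (h2 t))
    (fun t => (hcomp (h1' t) (h2' t)).congr_deriv ?_) ?_ ?_ t
  · rw [ContinuousLinearMap.sub_comp, ContinuousLinearMap.comp_assoc, ContinuousLinearMap.comp_assoc,
      hQ, ContinuousLinearMap.comp_assoc]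
  · rw [coshOp_zero, coshOp_zero, ContinuousLinearMap.comp_id, ContinuousLinearMap.id_comp, sub_self]
  · rw [h10, h20, ContinuousLinearMap.comp_zero, ContinuousLinearMap.zero_comp, sub_self]

theorem Compat.comp_sinhOp {x : M} {y : M'} {T : E →L[ℝ] E'} (h : Compat S S' x y T) (v : E)
    (t : ℝ) : T.comp (S.sinhOp x v t) = (S'.sinhOp y (T v) t).comp T := by
  have h1 : ∀ t, HasDerivAt (fun t => T.comp (S.sinhOp x v t) - (S'.sinhOp y (T v) t).comp T)
      0 t := fun t => by
    have h2 := ((ContinuousLinearMap.compL ℝ E E E' T).hasFDerivAt.comp_hasDerivAt _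
      (S.hasDerivAt_sinhOp x v t)).sub (((ContinuousLinearMap.compL ℝ E E' E').flip
      T).hasFDerivAt.comp_hasDerivAt _ (S'.hasDerivAt_sinhOp y (T v) t))
    exact h2.congr_deriv (sub_eq_zero.2 (h v t))
  have h3 := is_const_of_deriv_eq_zero (fun t => (h1 t).differentiableAt) (fun t => (h1 t).deriv) t 0
  rw [sinhOp_zero, sinhOp_zero, ContinuousLinearMap.comp_zero, ContinuousLinearMap.zero_comp,
    sub_self] at h3
  exact sub_eq_zero.1 h3

end SymmetricSpace

/-! ### Normal neighbourhoods and local morphisms. -/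

theorem eventually_eq_of_hasT_zero {E : Type*} [NormedAddCommGroup E] [NormedSpace ℝ E]
    {M : Type*} [TopologicalSpace M] [ChartedSpace E M] [IsManifold 𝓘(ℝ, E) ∞ M] {c : ℝ → M} {s : ℝ}
    (h : ∀ᶠ r in 𝓝 s, HasT c r (0 : ℝ →L[ℝ] E)) : ∀ᶠ r in 𝓝 s, c r = c s := by
  have hc := h.self_of_nhds.continuousAt
  obtain ⟨ε, hε, hball⟩ := Metric.eventually_nhds_iff_ball.1 (h.and (hc.tendsto.eventually
    (extChartAt_source_mem_nhds (I := 𝓘(ℝ, E)) (c s))))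
  filter_upwards [Metric.ball_mem_nhds s hε] with r hr
  have hd : ∀ u ∈ Metric.ball s ε, HasFDerivAt (fun u => extChartAt 𝓘(ℝ, E) (c s) (c u))
      (0 : ℝ →L[ℝ] E) u := fun u hu => by
    have h1 := (hasT_extChartAt (hball u hu).2).comp (hball u hu).1 rfl
    rw [ContinuousLinearMap.comp_zero] at h1
    exact hasT_iff_hasFDerivAt.1 h1
  refine (extChartAt 𝓘(ℝ, E) (c s)).injOn (hball r hr).2 (mem_extChartAt_source (c s)) ?_
  exact Metric.isOpen_ball.is_const_of_fderiv_eq_zero (𝕜 := ℝ)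
    (convex_ball s ε).isPreconnected (fun u hu => (hd u hu).differentiableAt.differentiableWithinAt)
    (fun u hu => (hd u hu).fderiv) hr (Metric.mem_ball_self hε)

namespace SymmetricSpace

variable {E : Type*} [NormedAddCommGroup E] [NormedSpace ℝ E] [CompleteSpace E]
  {M : Type*} [TopologicalSpace M] [ChartedSpace E M] [IsManifold 𝓘(ℝ, E) ∞ M]
  {E' : Type*} [NormedAddCommGroup E'] [NormedSpace ℝ E'] [CompleteSpace E']
  {M' : Type*} [TopologicalSpace M'] [ChartedSpace E' M'] [IsManifold 𝓘(ℝ, E') ∞ M']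

section NormalNhd

variable (S : SymmetricSpace E M)

theorem log_base (b : M) : S.log b b = 0 := (S.isLog_log b).base

theorem continuousAt_log_base (b : M) : ContinuousAt (S.log b) b :=
  (S.isLog_log b).contMDiffAt.continuousAt

theorem exists_radius (b : M) : ∃ r : ℝ, 0 < r ∧ ∀ z : E, ‖z‖ < r → S.log b (S.exp b z) = z ∧
    ContMDiffAt 𝓘(ℝ, E) 𝓘(ℝ, E) 1 (S.log b) (S.exp b z) ∧
    ∀ᶠ y in 𝓝 (S.exp b z), S.exp b (S.log b y) = y := by
  have hl := S.isLog_log b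
  have : IsManifold 𝓘(ℝ, E) 1 M := IsManifold.of_le (n := ∞) (by simp)
  have he : Tendsto (S.exp b) (𝓝 0) (𝓝 b) := (S.continuous_exp b).tendsto' _ _ (S.exp_zero b)
  obtain ⟨r, hr, h⟩ := Metric.eventually_nhds_iff_ball.1 (hl.log_exp.and ((he.eventually
    ((contMDiffAt_iff_contMDiffAt_nhds (by simp)).1 hl.contMDiffAt)).and (he.eventually hl.exp_log.eventually_nhds)))
  exact ⟨r, hr, fun z hz => h z (by simpa using hz)⟩

/-- The radius of a normal ball. -/
noncomputable def radius (b : M) : ℝ := (S.exists_radius b).choose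

theorem radius_pos (b : M) : 0 < S.radius b := (S.exists_radius b).choose_spec.1

/-- A normal neighbourhood of `b`. -/
def normalNhd (b : M) : Set M := S.exp b '' Metric.ball 0 (S.radius b)

theorem log_exp {b : M} {z : E} (hz : ‖z‖ < S.radius b) : S.log b (S.exp b z) = z :=
  ((S.exists_radius b).choose_spec.2 z hz).1

theorem exp_mem_normalNhd {b : M} {z : E} (hz : ‖z‖ < S.radius b) : S.exp b z ∈ S.normalNhd b :=
  ⟨z, by simpa using hz, rfl⟩

theorem mem_normalNhd_self (b : M) : b ∈ S.normalNhd b := by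
  simpa using S.exp_mem_normalNhd (b := b) (z := 0) (by simpa using S.radius_pos b)

theorem exp_log {b y : M} (hy : y ∈ S.normalNhd b) : S.exp b (S.log b y) = y := by
  obtain ⟨z, hz, rfl⟩ := hy
  rw [S.log_exp (by simpa using hz)]

theorem norm_log_lt {b y : M} (hy : y ∈ S.normalNhd b) : ‖S.log b y‖ < S.radius b := by
  obtain ⟨z, hz, rfl⟩ := hy
  have hz' : ‖z‖ < S.radius b := by simpa using hz
  rwa [S.log_exp hz']

theorem contMDiffAt_log {b y : M} (hy : y ∈ S.normalNhd b) :
    ContMDiffAt 𝓘(ℝ, E) 𝓘(ℝ, E) 1 (S.log b) y := by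
  obtain ⟨z, hz, rfl⟩ := hy
  exact ((S.exists_radius b).choose_spec.2 z (mem_ball_zero_iff.1 hz)).2.1

theorem hasT_log {b y : M} (hy : y ∈ S.normalNhd b) :
    HasT (S.log b) y (tder (S.log b) y : E →L[ℝ] E) :=
  HasT.of_mdifferentiableAt ((S.contMDiffAt_log hy).mdifferentiableAt (by simp))

theorem isOpen_normalNhd (b : M) : IsOpen (S.normalNhd b) := by
  refine isOpen_iff_mem_nhds.2 fun y hy => ?_
  have h1 : ∀ᶠ w in 𝓝 y, S.exp b (S.log b w) = w := by
    obtain ⟨z, hz, rfl⟩ := hy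
    exact ((S.exists_radius b).choose_spec.2 z (mem_ball_zero_iff.1 hz)).2.2
  filter_upwards [h1, (S.contMDiffAt_log hy).continuousAt.norm.eventually_lt_const
    (S.norm_log_lt hy)] with w h2 h3
  rw [← h2]
  exact S.exp_mem_normalNhd h3

theorem normalNhd_mem_nhds (b : M) : S.normalNhd b ∈ 𝓝 b :=
  (S.isOpen_normalNhd b).mem_nhds (S.mem_normalNhd_self b)

theorem hasT_tr_exp (b : M) (z : E) :
    HasT (fun w => S.tr b (-z) (S.exp b w)) z (S.sinhOp b z 1) := by
  simpa using S.hasT_sinhOp b z 1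

theorem tr_neg_tr (b : M) (z : E) (y : M) : S.tr b (-z) (S.tr b z y) = y := by
  rw [tr_neg, Equiv.Perm.inv_def, Equiv.symm_apply_apply]

theorem tr_tr_neg (b : M) (z : E) (y : M) : S.tr b z (S.tr b (-z) y) = y := by
  rw [tr_neg, Equiv.Perm.inv_def, Equiv.apply_symm_apply]

theorem tr_neg_exp (b : M) (z : E) : S.tr b (-z) (S.exp b z) = b := by
  rw [← tr_apply_base, tr_neg_tr]

/-- With z = log y held fixed, differentiate `tr b (-z)` ∘ exp ∘ log = `tr b (-z)` at y. -/
theorem sinhOp_comp_tder_log {b y : M} (hy : y ∈ S.normalNhd b) :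
    (S.sinhOp b (S.log b y) 1).comp (tder (S.log b) y : E →L[ℝ] E) =
      (tder (S.tr b (-(S.log b y))) y : E →L[ℝ] E) := by
  refine ((S.hasT_tr_exp b (S.log b y)).comp (S.hasT_log hy) rfl).unique ?_
  refine (S.hasT_tr b _ y).congr ?_
  filter_upwards [(S.isOpen_normalNhd b).mem_nhds hy] with w hw
  rw [S.exp_log hw]

/-- The vector field `S.field b v`, where the tangent spaces are identified with the model space. -/
noncomputable def killing (b : M) (v : E) (x : M) : E := S.field b v x

theorem killing_apply (b x : M) (v : E) : S.killing b v x =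
    (1 / 2 : ℝ) • (tder (fun y => S.mul y (S.mul b x)) b : E →L[ℝ] E) v := rfl

theorem coshOp_one_apply (b : M) (z v : E) : S.coshOp b z 1 v =
    (tder (S.tr b (-z)) (S.exp b z) : E →L[ℝ] E) (S.killing b v (S.exp b z)) := by
  have h := S.coshOp_apply b z 1 v
  change _ = (tder (S.tr b ((-1 : ℝ) • z)) (S.exp b ((1 : ℝ) • z)) : E →L[ℝ] E)
    (S.killing b v (S.exp b ((1 : ℝ) • z))) at h
  simpa only [one_smul, neg_smul] using h

theorem hasT_tr_smul (b : M) (v : E) (y : M) : HasT (fun h : ℝ => S.tr b (h • v) y) 0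
    (ContinuousLinearMap.toSpanSingleton ℝ (S.killing b v y)) := by
  have h1 : HasT (fun z => S.mul z (S.mul b y)) b _ :=
    HasT.of_mdifferentiableAt ((S.contMDiff_mul_right _).mdifferentiable (by simp) b)
  have h2 : HasT (fun h : ℝ => (1 / 2 : ℝ) • h • v) 0
      ((1 / 2 : ℝ) • ContinuousLinearMap.toSpanSingleton ℝ v) :=
    hasT_iff_hasFDerivAt.2 ((ContinuousLinearMap.toSpanSingleton ℝ v).hasFDerivAt.const_smul _)
  have h3 := h1.comp ((S.hasT_exp_zero b).comp h2 (by simp)) (by simp)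
  have h4 : ContinuousLinearMap.toSpanSingleton ℝ (S.killing b v y) =
      (tder (fun z => S.mul z (S.mul b y)) b : E →L[ℝ] E).comp ((ContinuousLinearMap.id ℝ E).comp
        ((1 / 2 : ℝ) • ContinuousLinearMap.toSpanSingleton ℝ v)) := by
    ext
    change (1 : ℝ) • S.killing b v y = (tder (fun z => S.mul z (S.mul b y)) b : E →L[ℝ] E)
      ((1 / 2 : ℝ) • (1 : ℝ) • v)
    rw [one_smul, one_smul, map_smul, killing_apply]
  rw [h4]
  exact h3

end NormalNhd

variable {S : SymmetricSpace E M} {S' : SymmetricSpace E' M'}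

variable (S S') in
/-- The local map between normal neighbourhoods with given derivative `T` at `x`. -/
noncomputable def normalMap (x : M) (y : M') (T : E →L[ℝ] E') (p : M) : M' :=
  S'.exp y (T (S.log x p))

theorem normalMap_base (x : M) (y : M') (T : E →L[ℝ] E') : normalMap S S' x y T x = y := by
  simp [normalMap, log_base]

theorem normalMap_exp {x : M} (y : M') (T : E →L[ℝ] E') {z : E} (hz : ‖z‖ < S.radius x) :
    normalMap S S' x y T (S.exp x z) = S'.exp y (T z) := by
  rw [normalMap, S.log_exp hz]

/-- After translation back to the base points the differential of exp is S(1). Since T intertwines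
these operators, the one from exp' moves past T and is absorbed by the differential of log. -/
theorem Compat.hasT_normalMap {x : M} {y : M'} {T : E →L[ℝ] E'} (h : Compat S S' x y T) {p : M}
    (hp : p ∈ S.normalNhd x) : HasT (normalMap S S' x y T) p
      ((tder (S'.tr y (T (S.log x p))) y : E' →L[ℝ] E').comp (T.comp
        (tder (S.tr x (-(S.log x p))) p : E →L[ℝ] E))) := by
  have h1 := (S'.hasT_tr y (T (S.log x p)) y).comp ((S'.hasT_tr_exp y (T (S.log x p))).comp
    ((hasT_iff_hasFDerivAt.2 T.hasFDerivAt).comp (S.hasT_log hp) rfl) rfl) (S'.tr_neg_exp _ _)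
  simp only [tr_tr_neg] at h1
  rw [← ContinuousLinearMap.comp_assoc _ T, ← h.comp_sinhOp, ContinuousLinearMap.comp_assoc T,
    S.sinhOp_comp_tder_log hp] at h1
  exact h1

/-- C(1)v is the value of ξ_v at the endpoint pulled back to the base point, so this is the
intertwining of C at time 1. -/
theorem Compat.tder_normalMap_killing {x : M} {y : M'} {T : E →L[ℝ] E'} (h : Compat S S' x y T)
    {p : M} (hp : p ∈ S.normalNhd x) (v : E) :
    (tder (normalMap S S' x y T) p : E →L[ℝ] E') (S.killing x v p) =
      S'.killing y (T v) (normalMap S S' x y T p) := by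
  have h1 := S.coshOp_one_apply x (S.log x p) v
  rw [S.exp_log hp] at h1
  rw [(h.hasT_normalMap hp).tder_eq, ContinuousLinearMap.comp_apply, ContinuousLinearMap.comp_apply]
  rw [← h1, ← ContinuousLinearMap.comp_apply T, h, ContinuousLinearMap.comp_apply,
    S'.coshOp_one_apply]
  have h2 := (S'.hasT_tr y (T (S.log x p)) y).comp (S'.hasT_tr y (-(T (S.log x p)))
    (normalMap S S' x y T p)) (S'.tr_neg_exp _ _)
  simp only [tr_tr_neg] at h2
  have h3 := h2.unique (HasT.id _)
  exact congrArg (fun L : E' →L[ℝ] E' => L (S'.killing y (T v) (normalMap S S' x y T p))) h3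

/-- The local maps intertwine translations along geodesics. -/
theorem Compat.normalMap_tr {x : M} {y : M'} {T : E →L[ℝ] E'} (h : Compat S S' x y T) {p : M}
    {v : E} (hp : ∀ s ∈ Set.Icc (0 : ℝ) 1, S.tr x (s • v) p ∈ S.normalNhd x) :
    normalMap S S' x y T (S.tr x v p) = S'.tr y (T v) (normalMap S S' x y T p) := by
  have : IsManifold 𝓘(ℝ, E') 1 M' := IsManifold.of_le (n := ∞) (by simp)
  set f := normalMap S S' x y T with hf
  -- The claim is c 0 = c 1. The derivative of c vanishes because f carries ξ_v to ξ_{Tv}, the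
  -- generators of the two translation groups; the group law moves the computation to parameter 0.
  let c : ℝ → M' := fun s => S'.tr y ((-s) • T v) (f (S.tr x (s • v) p))
  have hder : ∀ s, S.tr x (s • v) p ∈ S.normalNhd x → HasT c s (0 : ℝ →L[ℝ] E') := by
    intro s hs
    set m := S.tr x (s • v) p with hm
    let G : ℝ × M' → M' := fun q => S'.tr y ((-q.1) • T v) q.2
    have hG : ContMDiff (𝓘(ℝ, ℝ).prod 𝓘(ℝ, E')) 𝓘(ℝ, E') 1 G := by
      refine S'.contMDiff_tr₂ y ?_ contMDiff_snd
      have : ContMDiff 𝓘(ℝ, ℝ) 𝓘(ℝ, E') 1 (fun s : ℝ => (-s) • T v) := by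
        refine ContDiff.contMDiff ?_
        fun_prop
      exact this.comp contMDiff_fst
    have h1 : HasT (fun h => G (h, f m)) 0
        (ContinuousLinearMap.toSpanSingleton ℝ (-(S'.killing y (T v) (f m)))) := by
      have h3 : HasT (fun h : ℝ => -h) 0 (-ContinuousLinearMap.id ℝ ℝ) :=
        hasT_iff_hasFDerivAt.2 (hasFDerivAt_id _).neg
      convert (S'.hasT_tr_smul y (T v) (f m)).comp h3 neg_zero using 1
      ext
      simp
    have h2 : HasT (fun m => G (0, m)) (f m) (ContinuousLinearMap.id ℝ E') := by
      refine (HasT.id _).congr (Eventually.of_forall fun m => ?_)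
      simp [G, tr_zero]
    have hg : HasT (fun h : ℝ => f (S.tr x (h • v) m)) 0
        (ContinuousLinearMap.toSpanSingleton ℝ (S'.killing y (T v) (f m))) := by
      convert (h.hasT_normalMap hs).comp (S.hasT_tr_smul x v m) (by simp [tr_zero]) using 1
      rw [← (h.hasT_normalMap hs).tder_eq]
      ext
      change (1 : ℝ) • _ = (tder (normalMap S S' x y T) m : E →L[ℝ] E') ((1 : ℝ) • S.killing x v m)
      rw [one_smul, one_smul, h.tder_normalMap_killing hs]
    have h3 := HasT.comp₂ (hG.mdifferentiable (by simp) (0, f m)) h1 h2 (HasT.id (0 : ℝ)) hg rfl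
      (by simp [tr_zero])
    have h4 := (S'.hasT_tr y ((-s) • T v) (f m)).comp h3 (by simp [G, tr_zero])
    have h5 : HasT (fun r : ℝ => r - s) s (ContinuousLinearMap.id ℝ ℝ) :=
      hasT_iff_hasFDerivAt.2 ((hasFDerivAt_id _).sub_const s)
    have h6 := h4.comp h5 (sub_self s)
    have h7 : (fun r => S'.tr y ((-s) • T v) (G (r - s, f (S.tr x ((r - s) • v) m)))) = c := by
      ext r
      simp only [c, G]
      rw [hm, ← Equiv.Perm.mul_apply, ← Equiv.Perm.mul_apply, ← tr_add_smul, ← tr_add_smul,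
        sub_add_cancel]
      congr 3
      ring
    rw [h7] at h6
    convert h6 using 1
    ext
    simp
  have hloc : ∀ s ∈ Set.Icc (0 : ℝ) 1, ∀ᶠ r in 𝓝 s, c r = c s := fun s hs => by
    refine eventually_eq_of_hasT_zero (E := E') ?_
    have hcont : Continuous fun r : ℝ => S.tr x (r • v) p :=
      S.continuous_tr x (by fun_prop) continuous_const
    filter_upwards [hcont.continuousAt.eventually ((S.isOpen_normalNhd x).mem_nhds (hp s hs))]
      with r hr using hder r hr
  have h01 : c 0 = c 1 := isPreconnected_Icc.induction₂ (s := Set.Icc (0 : ℝ) 1)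
    (fun s r => c s = c r) (fun s hs => ((hloc s hs).filter_mono nhdsWithin_le_nhds).mono
      fun r hr => hr.symm) (fun _ _ _ _ _ _ => Eq.trans) (fun _ _ _ _ => Eq.symm)
    (by simp) (by simp)
  simp only [c, neg_zero, zero_smul, tr_zero, one_smul, neg_smul, Equiv.Perm.one_apply] at h01
  rw [h01, tr_tr_neg]

variable (S S') in
/-- Near `x`, the map `f` is given in normal coordinates by the linear map `T`, which intertwines
the Jacobi fields. -/
structure Adm (f : M → M') (x : M) (T : E →L[ℝ] E') : Prop where
  compat : Compat S S' x (f x) T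
  eventually : ∀ᶠ w in 𝓝 (0 : E), f (S.exp x w) = S'.exp (f x) (T w)

theorem Adm.eventuallyEq {f : M → M'} {x : M} {T : E →L[ℝ] E'} (h : Adm S S' f x T) :
    f =ᶠ[𝓝 x] normalMap S S' x (f x) T := by
  have h1 := (S.continuousAt_log_base x).tendsto
  rw [log_base] at h1
  filter_upwards [h1.eventually h.eventually, S.normalNhd_mem_nhds x] with p h2 h3
  rw [S.exp_log h3] at h2
  exact h2

theorem Compat.hasT_normalMap_base {x : M} {y : M'} {T : E →L[ℝ] E'} (h : Compat S S' x y T) :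
    HasT (normalMap S S' x y T) x T := by
  have h1 := h.hasT_normalMap (S.mem_normalNhd_self x)
  have h2 : (tder (id : M → M) x : E →L[ℝ] E) = ContinuousLinearMap.id ℝ E :=
    (HasT.id x).tder_eq
  have h3 : (tder (id : M' → M') y : E' →L[ℝ] E') = ContinuousLinearMap.id ℝ E' :=
    (HasT.id y).tder_eq
  simpa [log_base, tr_zero, h2, h3] using h1

theorem Adm.hasT {f : M → M'} {x : M} {T : E →L[ℝ] E'} (h : Adm S S' f x T) : HasT f x T :=
  h.compat.hasT_normalMap_base.congr h.eventuallyEq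

theorem Adm.congr {f g : M → M'} {x : M} {T : E →L[ℝ] E'} (h : Adm S S' f x T)
    (hg : g =ᶠ[𝓝 x] f) : Adm S S' g x T := by
  refine ⟨by rw [hg.self_of_nhds]; exact h.compat, ?_⟩
  have he : Tendsto (S.exp x) (𝓝 0) (𝓝 x) := (S.continuous_exp x).tendsto' _ _ (S.exp_zero x)
  filter_upwards [h.eventually, he.eventually hg] with w h1 h2
  rw [h2, h1, hg.self_of_nhds]

/-- The local map is admissible on the whole normal neighbourhood. -/
theorem Compat.adm_normalMap {x : M} {y : M'} {T : E →L[ℝ] E'} (h : Compat S S' x y T) {p : M}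
    (hp : p ∈ S.normalNhd x) :
    Adm S S' (normalMap S S' x y T) p (tder (normalMap S S' x y T) p : E →L[ℝ] E') := by
  set v := S.log x p with hv
  have hpv : S.exp x v = p := S.exp_log hp
  have hvr : ‖v‖ < S.radius x := S.norm_log_lt hp
  have hfp : normalMap S S' x y T p = S'.exp y (T v) := rfl
  have hx : S.tr x (-v) p = x := by rw [← hpv, tr_neg_exp]
  rw [(h.hasT_normalMap hp).tder_eq, ← hv]
  refine ⟨?_, ?_⟩
  · have h1 := compat_tr (S := S) x (-v) p
    have h2 := compat_tr (S := S') y (T v) y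
    rw [hx] at h1
    rw [tr_apply_base] at h2
    exact h2.comp (h.comp h1)
  · have hcont : Continuous fun q : E × ℝ =>
        S.tr x (q.2 • v) (S.exp x ((tder (S.tr x (-v)) p : E →L[ℝ] E) q.1)) :=
      S.continuous_tr x (by fun_prop) ((S.continuous_exp x).comp (by fun_prop))
    -- By compactness of [0, 1], for small w the whole translation path to exp_p(w) stays in the
    -- normal neighbourhood, as `Compat.normalMap_tr` requires.
    have h1 := isCompact_Icc.eventually_forall_of_forall_eventually (x₀ := (0 : E))
      (K := Set.Icc (0 : ℝ) 1) (P := fun w s => S.tr x (s • v)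
        (S.exp x ((tder (S.tr x (-v)) p : E →L[ℝ] E) w)) ∈ S.normalNhd x) fun s hs => by
          refine hcont.continuousAt.eventually ((S.isOpen_normalNhd x).mem_nhds ?_)
          simp only [map_zero, exp_zero, tr_apply_base]
          refine S.exp_mem_normalNhd (lt_of_le_of_lt ?_ hvr)
          rw [norm_smul, Real.norm_of_nonneg hs.1]
          exact mul_le_of_le_one_left (norm_nonneg v) hs.2
    have hL : Tendsto (fun w => (tder (S.tr x (-v)) p : E →L[ℝ] E) w) (𝓝 0) (𝓝 0) :=
      (ContinuousLinearMap.continuous _).tendsto' _ _ (map_zero _)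
    filter_upwards [h1, hL.eventually (Metric.ball_mem_nhds 0 (S.radius_pos x))] with w h2 h3
    have h4 := map_exp (S.tr_map_mul x (-v)) (S.hasT_tr x (-v) p) w
    rw [hx] at h4
    have h5 : S.exp p w = S.tr x v (S.exp x ((tder (S.tr x (-v)) p : E →L[ℝ] E) w)) := by
      rw [← h4, tr_tr_neg]
    rw [h5, h.normalMap_tr h2, normalMap_exp _ _ (mem_ball_zero_iff.1 h3),
      map_exp (S'.tr_map_mul y (T v)) (S'.hasT_tr y (T v) y), tr_apply_base]
    rfl

end SymmetricSpace

theorem HasT.exists_hasFDerivAt_charts {E : Type*} [NormedAddCommGroup E] [NormedSpace ℝ E]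
    {M : Type*} [TopologicalSpace M] [ChartedSpace E M] [IsManifold 𝓘(ℝ, E) ∞ M]
    {E' : Type*} [NormedAddCommGroup E'] [NormedSpace ℝ E']
    {M' : Type*} [TopologicalSpace M'] [ChartedSpace E' M'] [IsManifold 𝓘(ℝ, E') ∞ M']
    {f : M → M'} {x p : M} {y : M'} {L : E →L[ℝ] E'} (h : HasT f p L)
    (hp : p ∈ (extChartAt 𝓘(ℝ, E) x).source) (hfp : f p ∈ (extChartAt 𝓘(ℝ, E') y).source) :
    ∃ D : E →L[ℝ] E', HasFDerivAt (fun u => extChartAt 𝓘(ℝ, E') y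
      (f ((extChartAt 𝓘(ℝ, E) x).symm u))) D (extChartAt 𝓘(ℝ, E) x p) ∧
      D.comp (tder (extChartAt 𝓘(ℝ, E) x) p : E →L[ℝ] E) =
        (tder (extChartAt 𝓘(ℝ, E') y) (f p) : E' →L[ℝ] E').comp L := by
  have h1 := (hasT_extChartAt hfp).comp h rfl
  have h2 : HasT (extChartAt 𝓘(ℝ, E) x).symm (extChartAt 𝓘(ℝ, E) x p) (tder
      (extChartAt 𝓘(ℝ, E) x).symm (extChartAt 𝓘(ℝ, E) x p) : E →L[ℝ] E) :=
    HasT.of_mdifferentiableAt (((contMDiffOn_extChartAt_symm (n := ∞) x).contMDiffAt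
      ((isOpen_extChartAt_target x).mem_nhds
        ((extChartAt 𝓘(ℝ, E) x).map_source hp))).mdifferentiableAt (by simp))
  have h3 := h1.comp h2 ((extChartAt 𝓘(ℝ, E) x).left_inv hp)
  refine ⟨_, hasT_iff_hasFDerivAt.1 h3, ?_⟩
  refine (h3.comp (hasT_extChartAt hp) rfl).unique (h1.congr ?_)
  filter_upwards [(isOpen_extChartAt_source x).mem_nhds hp] with z hz
  rw [(extChartAt 𝓘(ℝ, E) x).left_inv hz]

/-! ### Smoothness of admissible maps. -/

namespace SymmetricSpace

variable {E : Type*} [NormedAddCommGroup E] [NormedSpace ℝ E] [CompleteSpace E]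
  {M : Type*} [TopologicalSpace M] [ChartedSpace E M] [IsManifold 𝓘(ℝ, E) ∞ M]
  {E' : Type*} [NormedAddCommGroup E'] [NormedSpace ℝ E'] [CompleteSpace E']
  {M' : Type*} [TopologicalSpace M'] [ChartedSpace E' M'] [IsManifold 𝓘(ℝ, E') ∞ M']

variable (S : SymmetricSpace E M) in
/-- The trivialization of the tangent bundle near `x` by the vector fields `S.killing x v`, in the
chart around `x`. -/
noncomputable def chartFrame (x : M) (u : E) : E →L[ℝ] E :=
  (1 / 2 : ℝ) • (fderiv ℝ (S.chartMul x x) (extChartAt 𝓘(ℝ, E) x x, u)).comp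
    (ContinuousLinearMap.inl ℝ E E)

variable (S : SymmetricSpace E M) in
theorem contDiffAt_chartFrame (x : M) :
    ContDiffAt ℝ ∞ (S.chartFrame x) (extChartAt 𝓘(ℝ, E) x x) := by
  have h1 : ContDiffAt ℝ ∞ (fderiv ℝ (S.chartMul x x))
      (extChartAt 𝓘(ℝ, E) x x, extChartAt 𝓘(ℝ, E) x x) :=
    (S.contDiffAt_chartMul x x).fderiv_right (by simp)
  have h2 : ContDiffAt ℝ ∞ (fun u : E => (extChartAt 𝓘(ℝ, E) x x, u)) (extChartAt 𝓘(ℝ, E) x x) :=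
    contDiffAt_const.prodMk contDiffAt_id
  have h3 := ContDiffAt.comp (extChartAt 𝓘(ℝ, E) x x) h1 h2
  exact (h3.clm_comp contDiffAt_const).const_smul _

variable (S : SymmetricSpace E M) in
theorem chartFrame_apply (x : M) : ∀ᶠ p in 𝓝 x, ∀ v,
    S.chartFrame x (extChartAt 𝓘(ℝ, E) x p) v =
      (tder (extChartAt 𝓘(ℝ, E) x) p : E →L[ℝ] E) (S.killing x v p) := by
  have h := (continuousAt_extChartAt (I := 𝓘(ℝ, E)) x).eventually (S.chartField_field x x)
  filter_upwards [h, eventually_extChartAt_left_inv (E := E) x] with p h1 h2 v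
  refine (h1 v).symm.trans ?_
  exact congrArg (fun z => (tder (extChartAt 𝓘(ℝ, E) x) z : E →L[ℝ] E) (S.killing x v z)) h2

variable (S : SymmetricSpace E M) in
theorem chartFrame_base (x : M) :
    S.chartFrame x (extChartAt 𝓘(ℝ, E) x x) = 1 := by
  ext v
  rw [(S.chartFrame_apply x).self_of_nhds v, (hasT_extChartAt_self x).tder_eq, killing_apply,
    S.mul_self, (S.hasT_mul_right x).tder_eq]
  simp [smul_smul]

variable {S : SymmetricSpace E M} {S' : SymmetricSpace E' M'}

/-- The fields ξ_v form a smooth frame Φ near x, and f carries frame to frame: in charts F'(u) =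
Φ'(F(u)) ∘ T ∘ Φ(u)⁻¹, where Φ' is the frame at f(x). So F is C^{n+1} as soon as it is C^n. -/
theorem Adm.contMDiffAt {f : M → M'} {x : M} {T : E →L[ℝ] E'} (h : Adm S S' f x T) :
    ContMDiffAt 𝓘(ℝ, E) 𝓘(ℝ, E') ∞ f x := by
  refine ContMDiffAt.congr_of_eventuallyEq ?_ h.eventuallyEq
  have hT := h.compat
  set y := f x with hy
  clear_value y
  clear h hy
  set f := normalMap S S' x y T with hf
  have hfx : f x = y := normalMap_base x y T
  have hfc : ContinuousAt f x := hT.hasT_normalMap_base.continuousAt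
  refine contMDiffAt_iff.2 ⟨hfc, ?_⟩
  rw [ModelWithCorners.range_eq_univ, contDiffWithinAt_univ, hfx]
  set φ := extChartAt 𝓘(ℝ, E) x with hφ
  set ψ := extChartAt 𝓘(ℝ, E') y with hψ
  set F : E → E' := ψ ∘ f ∘ φ.symm with hF
  have hFq : F (φ x) = ψ y := by simp [hF, hφ, hfx]
  have hfc' : Tendsto f (𝓝 x) (𝓝 y) := by simpa [hfx] using hfc.tendsto
  have hder : ∀ᶠ u in 𝓝 (φ x), HasFDerivAt F
      ((S'.chartFrame y (F u)).comp (T.comp (Ring.inverse (S.chartFrame x u)))) u := by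
    have hunit : ∀ᶠ u in 𝓝 (φ x), IsUnit (S.chartFrame x u) := by
      refine (S.contDiffAt_chartFrame x).continuousAt.eventually ?_
      rw [chartFrame_base]
      exact Units.isOpen.mem_nhds isUnit_one
    have ht := tendsto_extChartAt_symm (E := E) x
    filter_upwards [hunit, ht.eventually (S.normalNhd_mem_nhds x), extChartAt_target_mem_nhds (I := 𝓘(ℝ, E)) x,
      ht.eventually (S.chartFrame_apply x), (hfc'.comp ht).eventually (S'.chartFrame_apply y),
      (hfc'.comp ht).eventually (extChartAt_source_mem_nhds (I := 𝓘(ℝ, E')) y)]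
      with u h1 h2 h3 h4 h5 h6
    set p := φ.symm u with hp
    have hps : p ∈ φ.source := φ.map_target h3
    have hpu : φ p = u := φ.right_inv h3
    have hfp := hT.hasT_normalMap h2
    rw [← hfp.tder_eq] at hfp
    obtain ⟨D, hD, hDL⟩ := hfp.exists_hasFDerivAt_charts hps h6
    rw [hpu] at hD h4
    have h7 : D = (S'.chartFrame y (F u)).comp (T.comp (Ring.inverse (S.chartFrame x u))) := by
      have h8 : D.comp (S.chartFrame x u) = (S'.chartFrame y (F u)).comp T := by
        ext v
        rw [ContinuousLinearMap.comp_apply, ContinuousLinearMap.comp_apply, h4]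
        refine (congrArg (fun L : E →L[ℝ] E' => L (S.killing x v p)) hDL).trans ?_
        refine Eq.trans ?_ (h5 (T v)).symm
        exact congrArg (tder ψ (f p) : E' →L[ℝ] E') (hT.tder_normalMap_killing h2 v)
      rw [← ContinuousLinearMap.comp_assoc, ← h8, ContinuousLinearMap.comp_assoc]
      exact (congrArg D.comp (Ring.mul_inverse_cancel _ h1)).symm
    rw [← h7]
    exact hD
  have hn : ∀ n : ℕ, ContDiffAt ℝ n F (φ x) := fun n => by
    induction n with
    | zero =>
      refine contDiffAt_zero.2 ⟨_, hder, fun u hu => hu.continuousAt.continuousWithinAt⟩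
    | succ n ih =>
      refine contDiffAt_succ_iff_hasFDerivAt.2 ⟨_, ⟨_, hder, fun u hu => hu⟩, ?_⟩
      have h1 : ContDiffAt ℝ n (fun u => S'.chartFrame y (F u)) (φ x) := by
        refine ContDiffAt.comp (g := S'.chartFrame y) _ ?_ ih
        rw [hFq]
        exact (S'.contDiffAt_chartFrame y).of_le (WithTop.coe_le_coe.2 le_top)
      have h2 : ContDiffAt ℝ n (fun u => Ring.inverse (S.chartFrame x u)) (φ x) := by
        refine ContDiffAt.comp (g := Ring.inverse) (f := S.chartFrame x) _ ?_
          ((S.contDiffAt_chartFrame x).of_le (WithTop.coe_le_coe.2 le_top))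
        rw [chartFrame_base]
        exact contDiffAt_ringInverse ℝ 1
      exact h1.clm_comp (contDiffAt_const.clm_comp h2)
  exact contDiffAt_infty.2 hn

end SymmetricSpace

/-! ### The covering space of 1-jets. -/

namespace SymmetricSpace

variable {E : Type*} [NormedAddCommGroup E] [NormedSpace ℝ E] [CompleteSpace E]
  {M : Type*} [TopologicalSpace M] [ChartedSpace E M] [IsManifold 𝓘(ℝ, E) ∞ M]
  {E' : Type*} [NormedAddCommGroup E'] [NormedSpace ℝ E'] [CompleteSpace E']
  {M' : Type*} [TopologicalSpace M'] [ChartedSpace E' M'] [IsManifold 𝓘(ℝ, E') ∞ M']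

section Translations

variable (S : SymmetricSpace E M)

/-- The automorphism `tr x v` commutes with itself, so carrying the base point and the velocity
along the geodesic leaves the translation unchanged. This makes transport of jets reversible. -/
theorem tr_tder_tr (x : M) (v : E) :
    S.tr (S.tr x v x) ((tder (S.tr x v) x : E →L[ℝ] E) v) = S.tr x v := by
  ext z
  have h := map_tr (S.tr_map_mul x v) (S.hasT_tr x v x) v (S.tr x (-v) z)
  rw [tr_tr_neg] at h
  exact h.symm

theorem tder_tr_neg_comp (x : M) (v : E) (y : M) :
    (tder (S.tr x (-v)) (S.tr x v y) : E →L[ℝ] E).comp (tder (S.tr x v) y : E →L[ℝ] E) =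
      ContinuousLinearMap.id ℝ E := by
  have h := (S.hasT_tr x (-v) (S.tr x v y)).comp (S.hasT_tr x v y) rfl
  simp only [tr_neg_tr] at h
  exact h.unique (HasT.id y)

theorem tder_tr_neg_tder_tr (x : M) (v w : E) (y : M) :
    (tder (S.tr x (-v)) (S.tr x v y) : E →L[ℝ] E) ((tder (S.tr x v) y : E →L[ℝ] E) w) = w :=
  congrArg (fun L : E →L[ℝ] E => L w) (S.tder_tr_neg_comp x v y)

end Translations

/-- The 1-jets of local morphisms between two symmetric spaces. -/
@[ext] structure Jet (S : SymmetricSpace E M) (S' : SymmetricSpace E' M') where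
  pt : M
  val : M'
  lin : E →L[ℝ] E'
  compat : Compat S S' pt val lin

namespace Jet

variable {S : SymmetricSpace E M} {S' : SymmetricSpace E' M'}

/-- Transport of a 1-jet along the geodesic with velocity `v`. -/
noncomputable def move (σ : Jet S S') (v : E) : Jet S S' where
  pt := S.tr σ.pt v σ.pt
  val := S'.tr σ.val (σ.lin v) σ.val
  lin := (tder (S'.tr σ.val (σ.lin v)) σ.val : E' →L[ℝ] E').comp
    (σ.lin.comp (tder (S.tr σ.pt (-v)) (S.tr σ.pt v σ.pt) : E →L[ℝ] E))
  compat := by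
    have h1 := compat_tr (S := S) σ.pt (-v) (S.tr σ.pt v σ.pt)
    rw [tr_neg_tr] at h1
    exact (compat_tr σ.val (σ.lin v) σ.val).comp (σ.compat.comp h1)

theorem move_zero (σ : Jet S S') : σ.move 0 = σ := by
  have h1 : (tder (id : M → M) σ.pt : E →L[ℝ] E) = ContinuousLinearMap.id ℝ E :=
    (HasT.id _).tder_eq
  have h2 : (tder (id : M' → M') σ.val : E' →L[ℝ] E') = ContinuousLinearMap.id ℝ E' :=
    (HasT.id _).tder_eq
  ext1
  · simp [move, tr_zero]
  · simp [move, tr_zero]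
  · simp [move, tr_zero, h1, h2]

theorem move_move (σ : Jet S S') (v : E) :
    (σ.move v).move (-((tder (S.tr σ.pt v) σ.pt : E →L[ℝ] E) v)) = σ := by
  have hS : S.tr (S.tr σ.pt v σ.pt) (-((tder (S.tr σ.pt v) σ.pt : E →L[ℝ] E) v)) =
      S.tr σ.pt (-v) := by
    rw [tr_neg, tr_tder_tr, ← tr_neg]
  have hlin : (σ.move v).lin (-((tder (S.tr σ.pt v) σ.pt : E →L[ℝ] E) v)) =
      -((tder (S'.tr σ.val (σ.lin v)) σ.val : E' →L[ℝ] E') (σ.lin v)) := by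
    rw [map_neg]
    congr 1
    change (tder (S'.tr σ.val (σ.lin v)) σ.val : E' →L[ℝ] E') (σ.lin
      ((tder (S.tr σ.pt (-v)) (S.tr σ.pt v σ.pt) : E →L[ℝ] E) _)) = _
    rw [tder_tr_neg_tder_tr]
  have hS' : S'.tr (σ.move v).val ((σ.move v).lin
      (-((tder (S.tr σ.pt v) σ.pt : E →L[ℝ] E) v))) = S'.tr σ.val (-(σ.lin v)) := by
    rw [hlin]
    change S'.tr (S'.tr σ.val (σ.lin v) σ.val) _ = _
    rw [tr_neg, tr_tder_tr, ← tr_neg]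
  ext1
  · change S.tr (S.tr σ.pt v σ.pt) _ (S.tr σ.pt v σ.pt) = _
    rw [hS, tr_neg_tr]
  · change S'.tr (σ.move v).val _ (S'.tr σ.val (σ.lin v) σ.val) = _
    rw [hS', tr_neg_tr]
  · change (tder (S'.tr (σ.move v).val _) (S'.tr σ.val (σ.lin v) σ.val) : E' →L[ℝ] E').comp
      (((tder (S'.tr σ.val (σ.lin v)) σ.val : E' →L[ℝ] E').comp
        (σ.lin.comp (tder (S.tr σ.pt (-v)) (S.tr σ.pt v σ.pt) : E →L[ℝ] E))).comp
        (tder (S.tr (S.tr σ.pt v σ.pt) (- -_)) (S.tr (S.tr σ.pt v σ.pt) _ (S.tr σ.pt v σ.pt)) :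
          E →L[ℝ] E)) = _
    rw [hS', hS, neg_neg, tr_tder_tr, tr_neg_tr]
    ext w
    simp only [ContinuousLinearMap.comp_apply, tder_tr_neg_tder_tr]

theorem move_injective {σ τ : Jet S S'} {v : E} (h : σ.pt = τ.pt) (hm : σ.move v = τ.move v) :
    σ = τ := by
  rw [← σ.move_move v, ← τ.move_move v, hm, h]

theorem exists_move_eq (σ : Jet S S') {x : M} {v : E} (h : S.tr x v x = σ.pt) :
    ∃ τ : Jet S S', τ.pt = x ∧ τ.move v = σ := by
  have hp : S.tr σ.pt (-((tder (S.tr x v) x : E →L[ℝ] E) v)) = S.tr x (-v) := by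
    rw [← h, tr_neg, tr_tder_tr, ← tr_neg]
  refine ⟨σ.move (-((tder (S.tr x v) x : E →L[ℝ] E) v)), ?_, ?_⟩
  · change S.tr σ.pt _ σ.pt = x
    rw [hp, ← h, tr_neg_tr]
  · convert σ.move_move (-((tder (S.tr x v) x : E →L[ℝ] E) v)) using 1
    rw [hp, map_neg, neg_neg, ← h, tder_tr_neg_tder_tr]

/-- The local section of the jets determined by a jet. -/
noncomputable def germ (σ : Jet S S') (p : M) : Jet S S' := σ.move (S.log σ.pt p)

theorem germ_pt (σ : Jet S S') {p : M} (hp : p ∈ S.normalNhd σ.pt) : (σ.germ p).pt = p := by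
  change S.tr _ _ _ = _
  rw [tr_apply_base, S.exp_log hp]

theorem germ_self (σ : Jet S S') : σ.germ σ.pt = σ := by
  rw [germ, log_base, move_zero]

theorem germ_val (σ : Jet S S') (p : M) :
    (σ.germ p).val = normalMap S S' σ.pt σ.val σ.lin p := by
  change S'.tr _ _ _ = _
  rw [tr_apply_base]
  rfl

theorem germ_lin (σ : Jet S S') {p : M} (hp : p ∈ S.normalNhd σ.pt) :
    (σ.germ p).lin = (tder (normalMap S S' σ.pt σ.val σ.lin) p : E →L[ℝ] E') := by
  have h := (σ.germ_pt hp)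
  change S.tr _ _ _ = _ at h
  rw [(σ.compat.hasT_normalMap hp).tder_eq]
  change (tder (S'.tr _ _) _ : E' →L[ℝ] E').comp (σ.lin.comp (tder _ (S.tr σ.pt _ σ.pt) :
    E →L[ℝ] E)) = _
  rw [h]

theorem adm_germ (σ : Jet S S') {p : M} (hp : p ∈ S.normalNhd σ.pt) :
    Adm S S' (normalMap S S' σ.pt σ.val σ.lin) p (σ.germ p).lin := by
  rw [σ.germ_lin hp]
  exact σ.compat.adm_normalMap hp

/-- A jet is that of a map with the same germ. -/
theorem eventually_eq_germ {f : M → M'} (j : M → Jet S S') (hpt : ∀ p, (j p).pt = p)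
    (hval : ∀ p, (j p).val = f p) (hadm : ∀ p, Adm S S' f p (j p).lin) {σ : Jet S S'} {p : M}
    (hp : p ∈ S.normalNhd σ.pt) (h : j p = σ.germ p) : ∀ᶠ q in 𝓝 p, j q = σ.germ q := by
  have h1 : f =ᶠ[𝓝 p] normalMap S S' σ.pt σ.val σ.lin := by
    refine (hadm p).eventuallyEq.trans (EventuallyEq.trans ?_ (σ.adm_germ hp).eventuallyEq.symm)
    rw [h, ← hval, h, germ_val]
  filter_upwards [h1.eventually_nhds, (S.isOpen_normalNhd σ.pt).mem_nhds hp] with q h2 h3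
  ext1
  · rw [hpt, σ.germ_pt h3]
  · rw [hval, σ.germ_val, h2.self_of_nhds]
  · exact ((hadm q).hasT.congr (EventuallyEq.symm h2)).unique (σ.adm_germ h3).hasT

/-- Each local map is admissible at p, hence determined near p by its jet there; nearby jets then
agree by uniqueness of derivatives. -/
theorem eventually_germ_eq_germ {σ τ : Jet S S'} {p : M} (hσ : p ∈ S.normalNhd σ.pt)
    (hτ : p ∈ S.normalNhd τ.pt) (h : σ.germ p = τ.germ p) :
    ∀ᶠ q in 𝓝 p, q ∈ S.normalNhd σ.pt ∧ q ∈ S.normalNhd τ.pt ∧ σ.germ q = τ.germ q := by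
  have h1 : normalMap S S' σ.pt σ.val σ.lin =ᶠ[𝓝 p] normalMap S S' τ.pt τ.val τ.lin := by
    refine (σ.adm_germ hσ).eventuallyEq.trans
      (EventuallyEq.trans ?_ (τ.adm_germ hτ).eventuallyEq.symm)
    rw [h, ← germ_val, ← germ_val, h]
  filter_upwards [h1.eventually_nhds, (S.isOpen_normalNhd σ.pt).mem_nhds hσ,
    (S.isOpen_normalNhd τ.pt).mem_nhds hτ] with q h2 h3 h4
  refine ⟨h3, h4, ?_⟩
  ext1
  · rw [σ.germ_pt h3, τ.germ_pt h4]
  · rw [σ.germ_val, τ.germ_val, h2.self_of_nhds]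
  · exact ((σ.adm_germ h3).hasT.congr (EventuallyEq.symm h2)).unique (τ.adm_germ h4).hasT

/-- This is the finest topology in which every local section `germ` is continuous on its normal
neighbourhood, as for the space of germs of a sheaf. -/
instance : TopologicalSpace (Jet S S') where
  IsOpen U := ∀ σ : Jet S S', IsOpen {p | p ∈ S.normalNhd σ.pt ∧ σ.germ p ∈ U}
  isOpen_univ σ := by simpa using S.isOpen_normalNhd σ.pt
  isOpen_inter U V hU hV σ := by
    convert (hU σ).inter (hV σ) using 1
    ext p
    simp only [Set.mem_ofPred_eq, Set.mem_inter_iff]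
    tauto
  isOpen_sUnion s hs σ := by
    convert isOpen_biUnion fun U hU => hs U hU σ using 1
    ext p
    simp

theorem isOpen_iff {U : Set (Jet S S')} :
    IsOpen U ↔ ∀ σ : Jet S S', IsOpen {p | p ∈ S.normalNhd σ.pt ∧ σ.germ p ∈ U} := Iff.rfl

theorem continuous_pt : Continuous (pt : Jet S S' → M) := by
  refine continuous_def.2 fun O hO => isOpen_iff.2 fun σ => ?_
  convert (S.isOpen_normalNhd σ.pt).inter hO using 1
  ext p
  simp only [Set.mem_ofPred_eq, Set.mem_inter_iff, Set.mem_preimage]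
  exact and_congr_right fun hp => by rw [σ.germ_pt hp]

theorem continuousOn_germ (σ : Jet S S') : ContinuousOn σ.germ (S.normalNhd σ.pt) :=
  (continuousOn_open_iff (S.isOpen_normalNhd σ.pt)).2 fun _ hU => isOpen_iff.1 hU σ

theorem isOpen_image_germ (σ : Jet S S') {W : Set M} (hW : IsOpen W)
    (hWV : W ⊆ S.normalNhd σ.pt) : IsOpen (σ.germ '' W) := by
  refine isOpen_iff.2 fun τ => isOpen_iff_mem_nhds.2 ?_
  rintro p ⟨hp, w, hw, hwp⟩
  have hpw : w = p := by rw [← σ.germ_pt (hWV hw), hwp, τ.germ_pt hp]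
  subst hpw
  filter_upwards [eventually_germ_eq_germ (hWV hw) hp hwp, hW.mem_nhds hw] with q hq hqW
  exact ⟨hq.2.1, q, hqW, hq.2.2⟩

theorem discreteTopology_fiber (x : M) :
    DiscreteTopology ((pt : Jet S S' → M) ⁻¹' {x}) := by
  refine discreteTopology_iff_isOpen_singleton.2 fun ⟨σ, hσ⟩ => ?_
  convert (σ.isOpen_image_germ (S.isOpen_normalNhd σ.pt) subset_rfl).preimage
    continuous_subtype_val using 1
  ext ⟨τ, hτ⟩
  simp only [Set.mem_singleton_iff, Set.mem_preimage, Subtype.mk.injEq] at hσ hτ ⊢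
  constructor
  · rintro rfl
    exact ⟨τ.pt, S.mem_normalNhd_self _, τ.germ_self⟩
  · rintro ⟨p, hp, rfl⟩
    rw [σ.germ_pt hp, ← hσ] at hτ
    rw [hτ, germ_self]

/-- The normal neighbourhood of x is evenly covered: Φ transports a jet over x along the radial
geodesic to p. Reversibility of transport makes Φ bijective onto the preimage. The neighbourhood
does not depend on the jet, because geodesics of M' are defined for all time. -/
theorem isCoveringMap_pt : IsCoveringMap (pt : Jet S S' → M) := by
  intro x
  have hd : DiscreteTopology ((pt : Jet S S' → M) ⁻¹' {x}) := discreteTopology_fiber x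
  set V := S.normalNhd x with hV
  have hVo : IsOpen V := S.isOpen_normalNhd x
  let Φ : V × ((pt : Jet S S' → M) ⁻¹' {x}) → Jet S S' := fun q => q.2.1.germ q.1.1
  have hmem : ∀ q : V × ((pt : Jet S S' → M) ⁻¹' {x}), q.1.1 ∈ S.normalNhd q.2.1.pt := fun q => by
    have h : q.2.1.pt = x := q.2.2
    rw [h]; exact q.1.2
  have hΦpt : ∀ q, (Φ q).pt = q.1.1 := fun q => germ_pt _ (hmem q)
  have hcont : Continuous Φ := by
    refine continuous_prod_of_discrete_right.2 fun τ => ?_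
    refine continuous_iff_continuousAt.2 fun p => ?_
    exact ContinuousAt.comp (g := τ.1.germ) ((continuousOn_germ τ.1).continuousAt
      ((S.isOpen_normalNhd _).mem_nhds (hmem (p, τ)))) continuous_subtype_val.continuousAt
  have hinj : Function.Injective Φ := by
    rintro ⟨⟨p, hp⟩, ⟨σ, hσ⟩⟩ ⟨⟨q, hq⟩, ⟨τ, hτ⟩⟩ h
    have hpq : p = q := by
      have := congrArg pt h
      rwa [hΦpt, hΦpt] at this
    subst hpq
    simp only [Set.mem_preimage, Set.mem_singleton_iff] at hσ hτ
    have h' : σ.move (S.log σ.pt p) = τ.move (S.log τ.pt p) := h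
    rw [hσ, hτ] at h'
    have := move_injective (hσ.trans hτ.symm) h'
    subst this
    rfl
  have hopen : IsOpenMap Φ := by
    intro O hO
    have : Φ '' O = ⋃ τ : (pt : Jet S S' → M) ⁻¹' {x}, τ.1.germ ''
        (Subtype.val '' ((fun p : V => (p, τ)) ⁻¹' O)) := by
      ext σ
      simp only [Set.mem_image, Set.mem_iUnion, Set.mem_preimage]
      constructor
      · rintro ⟨⟨p, τ⟩, h, rfl⟩
        exact ⟨τ, p.1, ⟨p, h, rfl⟩, rfl⟩
      · rintro ⟨τ, _, ⟨p, h, rfl⟩, rfl⟩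
        exact ⟨(p, τ), h, rfl⟩
    rw [this]
    refine isOpen_iUnion fun τ => τ.1.isOpen_image_germ ?_ ?_
    · exact hVo.isOpenMap_subtype_val _ (hO.preimage (by fun_prop))
    · rintro _ ⟨p, _, rfl⟩
      exact hmem (p, τ)
  have hemb := Topology.IsOpenEmbedding.of_continuous_injective_isOpenMap hcont hinj hopen
  have hrange : Set.range Φ = pt ⁻¹' V := by
    ext σ
    constructor
    · rintro ⟨q, rfl⟩
      rw [Set.mem_preimage, hΦpt]
      exact q.1.2
    · intro hσ
      obtain ⟨τ, hτ, h⟩ := σ.exists_move_eq (x := x) (v := S.log x σ.pt) (by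
        rw [tr_apply_base, S.exp_log hσ])
      refine ⟨(⟨σ.pt, hσ⟩, ⟨τ, hτ⟩), ?_⟩
      change τ.move (S.log τ.pt σ.pt) = σ
      rw [hτ, h]
  refine ⟨hd, V, S.mem_normalNhd_self x, hVo, hVo.preimage continuous_pt,
    ((hemb.isEmbedding.toHomeomorph).trans (Homeomorph.setCongr hrange)).symm, fun σ => ?_⟩
  rw [← hΦpt]
  congr 1
  exact congrArg Subtype.val (((hemb.isEmbedding.toHomeomorph).trans
    (Homeomorph.setCongr hrange)).apply_symm_apply σ)

end Jet

end SymmetricSpace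

/-! ### Global morphisms from sections of the covering. -/

namespace SymmetricSpace

variable {E : Type*} [NormedAddCommGroup E] [NormedSpace ℝ E] [CompleteSpace E]
  {M : Type*} [TopologicalSpace M] [ChartedSpace E M] [IsManifold 𝓘(ℝ, E) ∞ M]
  {E' : Type*} [NormedAddCommGroup E'] [NormedSpace ℝ E'] [CompleteSpace E']
  {M' : Type*} [TopologicalSpace M'] [ChartedSpace E' M'] [IsManifold 𝓘(ℝ, E') ∞ M']
  {S : SymmetricSpace E M} {S' : SymmetricSpace E' M'}

variable (S S') in
/-- A map that is admissible at every point. -/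
def AdmEverywhere (f : M → M') : Prop := ∀ p, Adm S S' f p (tder f p : E →L[ℝ] E')

theorem Adm.tder {f : M → M'} {p : M} {T : E →L[ℝ] E'} (h : Adm S S' f p T) :
    Adm S S' f p (tder f p : E →L[ℝ] E') := by
  rwa [h.hasT.tder_eq]

namespace AdmEverywhere

/-- The section of the jets defined by a map that is admissible at every point. -/
noncomputable def jet {f : M → M'} (hf : AdmEverywhere S S' f) (p : M) : Jet S S' where
  pt := p
  val := f p
  lin := tder f p
  compat := (hf p).compat

theorem continuous_jet {f : M → M'} (hf : AdmEverywhere S S' f) : Continuous hf.jet := by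
  refine continuous_iff_continuousAt.2 fun p => ?_
  have h := Jet.eventually_eq_germ (σ := hf.jet p) hf.jet (fun _ => rfl) (fun _ => rfl)
    hf (S.mem_normalNhd_self p) (hf.jet p).germ_self.symm
  exact ((hf.jet p).continuousOn_germ.continuousAt (S.normalNhd_mem_nhds p)).congr (EventuallyEq.symm h)

/-- Both maps define continuous sections of the covering by jets, and sections that agree at one
point of a connected base are equal. -/
theorem eq_of_tder_eq [PreconnectedSpace M] {f g : M → M'} (hf : AdmEverywhere S S' f)
    (hg : AdmEverywhere S S' g) {p : M} (h : f p = g p)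
    (ht : (tder f p : E →L[ℝ] E') = tder g p) : f = g := by
  have := Jet.isCoveringMap_pt.eq_of_comp_eq hf.continuous_jet hg.continuous_jet rfl p
    (Jet.ext rfl h ht)
  funext q
  exact congrArg (fun j => (j q).val) this

theorem contMDiff {f : M → M'} (hf : AdmEverywhere S S' f) :
    ContMDiff 𝓘(ℝ, E) 𝓘(ℝ, E') ∞ f := fun p => (hf p).contMDiffAt

theorem of_map_mul {f : M → M'} (hf : ContMDiff 𝓘(ℝ, E) 𝓘(ℝ, E') ∞ f)
    (hmul : ∀ x y, f (S.mul x y) = S'.mul (f x) (f y)) : AdmEverywhere S S' f := fun p =>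
  have h : HasT f p (tder f p : E →L[ℝ] E') :=
    HasT.of_mdifferentiableAt (hf.mdifferentiable (by simp) p)
  ⟨compat_of_map_mul hmul h, Eventually.of_forall (map_exp hmul h)⟩

theorem comp_mul_left {f : M → M'} (hf : AdmEverywhere S S' f) (x : M) :
    AdmEverywhere S S' (fun y => f (S.mul x y)) := fun p => by
  have h := of_map_mul (S := S) (S' := S) (S.contMDiff_mul_left x) (S.mul_distrib x) p
  refine Adm.tder ⟨(hf (S.mul x p)).compat.comp h.compat, ?_⟩
  have ht : Tendsto (fun w => (_root_.tder (S.mul x) p : E →L[ℝ] E) w) (𝓝 0) (𝓝 0) :=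
    (ContinuousLinearMap.continuous _).tendsto' _ _ (map_zero _)
  filter_upwards [h.eventually, ht.eventually (hf (S.mul x p)).eventually] with w h1 h2
  rw [h1, h2]
  rfl

theorem mul_left_comp {f : M → M'} (hf : AdmEverywhere S S' f) (x : M') :
    AdmEverywhere S S' (fun y => S'.mul x (f y)) := fun p => by
  have hd := HasT.of_mdifferentiableAt
    ((S'.contMDiff_mul_left x).mdifferentiable (by simp) (f p))
  have h := of_map_mul (S := S') (S' := S') (S'.contMDiff_mul_left x) (S'.mul_distrib x) (f p)
  refine Adm.tder ⟨h.compat.comp (hf p).compat, ?_⟩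
  filter_upwards [(hf p).eventually] with w h1
  rw [h1, map_exp (S'.mul_distrib x) hd]
  rfl

/-- As functions of y both sides are admissible; at y = x both take the value f(x) and have
derivative -T_x f. -/
theorem map_mul [PreconnectedSpace M] {f : M → M'} (hf : AdmEverywhere S S' f) (x y : M) :
    f (S.mul x y) = S'.mul (f x) (f y) := by
  have h1 := (hf x).hasT.comp (S.hasT_mul_left x) (S.mul_self x)
  have h2 := (S'.hasT_mul_left (f x)).comp (hf x).hasT rfl
  refine congrFun (eq_of_tder_eq (hf.comp_mul_left x) (hf.mul_left_comp (f x)) (p := x) ?_ ?_) y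
  · rw [S.mul_self, S'.mul_self]
  · rw [h1.tder_eq, h2.tder_eq]
    ext v
    simp

end AdmEverywhere

theorem exists_admEverywhere [SimplyConnectedSpace M] (σ : Jet S S') :
    ∃ f : M → M', AdmEverywhere S S' f ∧ f σ.pt = σ.val ∧ HasT f σ.pt σ.lin := by
  have : LocallyPathConnectedSpace M := ChartedSpace.locallyPathConnectedSpace E M
  obtain ⟨F, ⟨hF0, hF⟩, -⟩ := Jet.isCoveringMap_pt.existsUnique_continuousMap_lifts
    (ContinuousMap.id M) σ.pt σ rfl
  have hpt : ∀ p, (F p).pt = p := fun p => congrFun hF p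
  have hadm : ∀ p, Adm S S' (fun p => (F p).val) p (F p).lin := fun p => by
    have hopen := (F p).isOpen_image_germ (S.isOpen_normalNhd _) subset_rfl
    -- The image of a local section is open, so the continuous lift F coincides near p with the
    -- section through F p, and its values are given by the normal map there.
    have h1 : ∀ᶠ q in 𝓝 p, F q ∈ (F p).germ '' S.normalNhd (F p).pt :=
      F.continuous.continuousAt.eventually (hopen.mem_nhds
        ⟨(F p).pt, S.mem_normalNhd_self _, (F p).germ_self⟩)
    have h2 := (F p).adm_germ (S.mem_normalNhd_self (F p).pt)
    rw [(F p).germ_self] at h2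
    have h3 : (fun q => (F q).val) =ᶠ[𝓝 p]
        normalMap S S' (F p).pt (F p).val (F p).lin := by
      filter_upwards [h1] with q hq
      obtain ⟨r, hr, hrq⟩ := hq
      have : r = q := by rw [← (F p).germ_pt hr, hrq, hpt]
      rw [← hrq, this, Jet.germ_val]
    have h4 : ∀ x, x = p → Adm S S' (normalMap S S' (F p).pt (F p).val (F p).lin) x (F p).lin →
        Adm S S' (fun p => (F p).val) p (F p).lin := by
      rintro x rfl h
      exact h.congr h3
    exact h4 _ (hpt p) h2
  refine ⟨fun p => (F p).val, fun p => (hadm p).tder, by simp [hF0], ?_⟩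
  have := (hadm σ.pt).hasT
  rwa [hF0] at this

end SymmetricSpace

theorem mainTheorem1
    {E₁ : Type*} [NormedAddCommGroup E₁] [NormedSpace ℝ E₁] [CompleteSpace E₁]
    {M₁ : Type*} [TopologicalSpace M₁] [ChartedSpace E₁ M₁] [IsManifold 𝓘(ℝ, E₁) ∞ M₁]
    {E₂ : Type*} [NormedAddCommGroup E₂] [NormedSpace ℝ E₂] [CompleteSpace E₂]
    {M₂ : Type*} [TopologicalSpace M₂] [ChartedSpace E₂ M₂] [IsManifold 𝓘(ℝ, E₂) ∞ M₂]
    (S₁ : SymmetricSpace E₁ M₁) (b₁ : M₁) (S₂ : SymmetricSpace E₂ M₂) (b₂ : M₂)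
    [SimplyConnectedSpace M₁]
    (A : TangentSpace 𝓘(ℝ, E₁) b₁ →L[ℝ] TangentSpace 𝓘(ℝ, E₂) b₂)
    (hA : SymmetricSpace.IsLtsHom S₁ b₁ S₂ b₂ A) :
    ∃! f : SymmetricSpace.PointedHom S₁ b₁ S₂ b₂, f.lts = A := by
  have hA' : SymmetricSpace.Compat S₁ S₂ b₁ b₂ A := hA.compat
  obtain ⟨f, hf, hfb, hfT⟩ := SymmetricSpace.exists_admEverywhere
    (⟨b₁, b₂, A, hA'⟩ : SymmetricSpace.Jet S₁ S₂)
  refine ⟨⟨f, hf.contMDiff, hf.map_mul, hfb⟩, hfT.tder_eq, ?_⟩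
  rintro ⟨g, hg, hgm, hgb⟩ hgA
  have h : g = f := (SymmetricSpace.AdmEverywhere.of_map_mul hg hgm).eq_of_tder_eq hf (p := b₁)
    (hgb.trans hfb.symm) (Eq.trans hgA hfT.tder_eq.symm)
  subst h
  rfl
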